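/- **Theorem 5.** Let $0<p<1$, $q=1-p$, $h=-p\log p-q\log q$. Let $(X_n)_{n\ge0}$ be an additive shape parameter of random PATRICIA tries with tolls $T_n$: that is, $X_0=X_1=0$ and, for $n\ge2$, $$X_n\stackrel{d}{=}X_{I_n}+X^*_{n-I_n}+T_n,\qquad \mathbb P(I_n=k)=\frac{\binom nk p^kq^{n-k}}{1-p^n-q^n}\quad(1\le k\le n-1),$$ where $X^*_k$ is distributed as $X_k$ and $X_k$, $X^*_{n-k}$, $I_n$, $T_n$ are independent for every $1\le k<n$. The $T_n$ are integrable with $\mathbb E(T_0)=\mathbb E(T_1)=0$, and the Poisson generating function $\tilde g_1(z)=e^{-z}\sum_{n\ge0}\mathbb E(T_n)z^n/n!$ converges for every $z\in\mathbb C$. Write $\log_+x=\log(1+x)$. An entire function $\tilde f$ belongs to $\mathscr{JS}_{\alpha,\beta}$ ($\alpha,\beta\in\mathbb R$) if for some $0<\theta<\pi/2$ and some $\varepsilon>0$ one has, for $|z|\ge1$, $\tilde f(z)=O(|z|^\alpha(\log_+|z|)^\beta)$ uniformly for $|\arg z|\le\theta$, and $e^z\tilde f(z)=O(e^{(1-\varepsilon)|z|})$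 uniformly for $\theta\le|\arg z|\le\pi$. Let $\mathscr{JS}$ be the union of all $\mathscr{JS}_{\alpha,\beta}$. Let $\mathscr M[\phi;s]=\int_0^\infty\phi(t)t^{s-1}\,dt$. If $\log p/\log q=r/\ell$ with coprime positive integers $r,\ell$, put $\chi_k=2rk\pi i/\log p$ and $$\mathscr F[G](x)=\frac1h\sum_{k\in\mathbb Z\setminus\{0\}}G(-1+\chi_k)e^{2k\pi ix};$$ if $\log p/\log q$ is irrational, put $\mathscr F[G]=0$ (and $r=0$, say). Let $\phi(z)=\tilde g_1(z)-e^{-qz}\tilde g_1(pz)-e^{-pz}\tilde g_1(qz)$, and let $\alpha<1$, $\beta\in\mathbb R$. Then every $X_n$ is integrable, and the following holds. (a) If $\tilde g_1\in\mathscr{JS}_{\alpha,\beta}$, then $G_1(s)=\mathscr M[\phi;s]$ converges for $-2<\Re s<-\alpha$, the series $\mathscr F[G_1]$ converges absolutely, and, as $n\to\infty$, $$\frac{\mathbb E(X_n)}n=\frac{G_1(-1)}h+\mathscr F[G_1](r\log_{1/p}n)+o(1).$$ (b) Let $0<\theta<\pi/2$ and $c\in\mathbb R$. If $\tilde g_1\in\mathscr{JS}$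 and $\tilde g_1(z)=cz+O(|z|^\alpha(\log_+|z|)^\beta)$ uniformly for $|z|\ge1$, $|\arg z|\le\theta$, then $\mathscr M[\phi;s]$ converges for $-2<\Re s<-1$ and has a meromorphic continuation $G_1$ to $-2<\Re s<-\alpha$, holomorphic except possibly at $s=-1$; the limit $d=\lim_{s\to-1}\bigl(G_1(s)+c/(s+1)\bigr)$ exists, the series $\mathscr F[G_1]$ converges absolutely, and, as $n\to\infty$, $$\frac{\mathbb E(X_n)}n=\frac ch\log n+\frac dh+\frac{c\,(p\log^2p+q\log^2q)}{2h^2}+\mathscr F[G_1](r\log_{1/p}n)+o(1).$$ -/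

import Mathlib

open Filter Topology MeasureTheory ProbabilityTheory

/-- `g` is the Poisson generating function `g(z) = e^{-z} ∑_{n ≥ 0} a_n z^n / n!` of the real sequence
`a`, the series being required to converge for every complex `z` (so `g` is entire). -/
def IsPoissonGF (a : ℕ → ℝ) (g : ℂ → ℂ) : Prop :=
  ∀ z : ℂ, HasSum (fun n : ℕ => (a n : ℂ) * z ^ n / (n.factorial : ℂ)) (Complex.exp z * g z)

/-- `f(z) = O(|z|^α (log_+ |z|)^β)` uniformly for `|z| ≥ 1`, `|arg z| ≤ θ`, where
`log_+ x = log (1 + x)`. -/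
def SectorBound (θ α β : ℝ) (f : ℂ → ℂ) : Prop :=
  ∃ C : ℝ, ∀ z : ℂ, 1 ≤ ‖z‖ → |Complex.arg z| ≤ θ →
    ‖f z‖ ≤ C * (‖z‖ ^ α * Real.log (1 + ‖z‖) ^ β)

/-- The class `JS_{α,β}` of JS-admissible entire functions. -/
def JSAdmissibleWith (α β : ℝ) (f : ℂ → ℂ) : Prop :=
  Differentiable ℂ f ∧ ∃ θ : ℝ, 0 < θ ∧ θ < Real.pi / 2 ∧
    SectorBound θ α β f ∧
    ∃ ε : ℝ, 0 < ε ∧ ∃ C : ℝ, ∀ z : ℂ, 1 ≤ ‖z‖ → θ ≤ |Complex.arg z| →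
      ‖Complex.exp z * f z‖ ≤ C * Real.exp ((1 - ε) * ‖z‖)

/-- The class `JS` of JS-admissible functions. -/
def JSAdmissible (f : ℂ → ℂ) : Prop :=
  ∃ α β : ℝ, JSAdmissibleWith α β f

/-- The splitting probabilities of a random PATRICIA trie of size `n`, for `1 ≤ k < n`:
a binomial distribution conditioned on both subtries being non-empty. -/
noncomputable def patriciaSplit (p : ℝ) (n k : ℕ) : ℝ :=
  (n.choose k : ℝ) * p ^ k * (1 - p) ^ (n - k) / (1 - p ^ n - (1 - p) ^ n)

/-- `X n` is an additive shape parameter, with toll `T n`, of a random PATRICIA trie of size `n`: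
`X_0 = X_1 = 0` and, for `n ≥ 2`, `X_n` has the law of `X_{I_n} + X*_{n - I_n} + T_n`, where `X*_k` is
a copy of `X_k`, where `I_n` has the distribution `patriciaSplit p n` on `{1, …, n - 1}`, and where
all the variables on the right-hand side are independent. -/
structure IsPatriciaParameter {Ω : Type*} [MeasurableSpace Ω] (P : Measure Ω) (p : ℝ)
    (X Xs : ℕ → Ω → ℝ) (I : ℕ → Ω → ℕ) (T : ℕ → Ω → ℝ) : Prop where
  init_zero : X 0 =ᵐ[P] 0
  init_one : X 1 =ᵐ[P] 0
  copy : ∀ n, IdentDistrib (Xs n) (X n) P P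
  split_measurable : ∀ n, Measurable (I n)
  split_law : ∀ n, 2 ≤ n → ∀ k, 1 ≤ k → k < n →
    P {ω | I n ω = k} = ENNReal.ofReal (patriciaSplit p n k)
  indep : ∀ n, 2 ≤ n → ∀ k, 1 ≤ k → k < n →
    iIndepFun ![X k, Xs (n - k), T n, fun ω => (I n ω : ℝ)] P
  recurrence : ∀ n, 2 ≤ n →
    IdentDistrib (X n) (fun ω => X (I n ω) ω + Xs (n - I n ω) ω + T n ω) P P

/-- The function `t ↦ g(t) - e^{-qt} g(pt) - e^{-pt} g(qt)` on the real line, `q = 1 - p`. -/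
noncomputable def patriciaToll (p : ℝ) (g : ℂ → ℂ) (t : ℝ) : ℂ :=
  g (t : ℂ) - Complex.exp (-((1 - p : ℝ) : ℂ) * t) * g ((p : ℂ) * t)
    - Complex.exp (-(p : ℂ) * t) * g (((1 - p : ℝ) : ℂ) * t)

/-- `log p / log q` is rational, `q = 1 - p`. -/
def IsLattice (p : ℝ) : Prop :=
  ∃ x : ℚ, (x : ℝ) = Real.log p / Real.log (1 - p)

open Classical in
/-- The numerator `r` of `log p / log q = r / ℓ` in lowest terms with `ℓ > 0` (and `0`, which is not
used, if that ratio is irrational). -/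
noncomputable def latticeNum (p : ℝ) : ℤ :=
  if h : IsLattice p then h.choose.num else 0

/-- `χ_k = 2 r k π i / log p`. -/
noncomputable def chi (p : ℝ) (k : ℤ) : ℂ :=
  2 * (latticeNum p : ℂ) * (k : ℂ) * (Real.pi : ℂ) * Complex.I / (Real.log p : ℂ)

open Classical in
/-- The periodic function `F[G](x) = h⁻¹ ∑_{k ≠ 0} G(-1 + χ_k) e^{2 k π i x}` in the lattice case, and
`0` otherwise; the entropy `h = - p log p - q log q` is `Real.binEntropy p`. -/
noncomputable def fluctuation (p : ℝ) (G : ℂ → ℂ) (x : ℝ) : ℂ :=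
  if IsLattice p then
    (Real.binEntropy p : ℂ)⁻¹ * ∑' k : {k : ℤ // k ≠ 0},
      G (-1 + chi p k) * Complex.exp (2 * ((k : ℤ) : ℂ) * (Real.pi : ℂ) * Complex.I * (x : ℂ))
  else 0

/-- Absolute convergence of the Fourier series of `F[G]` (in the lattice case). -/
def FluctuationSummable (p : ℝ) (G : ℂ → ℂ) : Prop :=
  IsLattice p → Summable (fun k : {k : ℤ // k ≠ 0} => ‖G (-1 + chi p k)‖)

/-- `G` is the meromorphic continuation, to the strip `-2 < Re s < b` and with no pole there other
than possibly `-1`, of the Mellin transform of `φ`, which converges for `-2 < Re s < -1`. By the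
identity theorem `G` is determined by this on the strip without `-1`. -/
structure IsMellinContinuation (φ : ℝ → ℂ) (b : ℝ) (G : ℂ → ℂ) : Prop where
  meromorphic : MeromorphicOn G {s : ℂ | -2 < s.re ∧ s.re < b}
  holomorphic : DifferentiableOn ℂ G ({s : ℂ | -2 < s.re ∧ s.re < b} \ {-1})
  convergent : ∀ s : ℂ, -2 < s.re → s.re < -1 → MellinConvergent φ s
  eq_mellin : ∀ s : ℂ, -2 < s.re → s.re < -1 → G s = mellin φ s

open scoped FourierTransform

/-! Write q = 1 - p, x_n = E X_n, a_n = E T_n. Conditioning on the split gives x_n = Σ C(n,k) p^k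
q^(n-k) (x_k + x_(n-k)) + (1 - p^n - q^n) a_n, the last factor arising because the empty splits k =
0, n are put back. Hence f(t) = e^(-t) Σ x_n t^n / n! satisfies f(t) = f(pt) + f(qt) + φ(t) with φ =
`patriciaToll p g` (`poisson_functional_equation`).

No Mellin transform is inverted. With F(u) = f(e^u) e^(-u) and ψ(u) = φ(e^u) e^(-u) this is the
renewal equation F(u) = p F(u - log 1/p) + q F(u - log 1/q) + ψ(u), where F → 0 at -∞ and the mean
step is the entropy h. Suppose ψ is exponentially small at both ends. For incommensurable steps F
tends to h⁻¹ ∫ ψ = h⁻¹ M[φ; -1] (`renewal_nonlattice`). For steps of span l the difference F(u) -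
(l/h) Σ_j ψ(u + jl) tends to 0 (`renewal_lattice`), and Poisson summation turns the periodic sum
into the Fourier series with coefficients M[φ; -1 + χ_k] / h (`tendsto_of_functional_equation`).
Holomorphy of φ in a sector makes ψ holomorphic in a strip, whence quadratic decay of its Fourier
transform and absolute convergence.

The renewal theorems rest on a maximum principle. A bounded solution G of the centred equation that
is near its limit superior M > 0 at u is near M at all points u - ja - kb with j + k bounded, and
these fill, or nearly fill, a whole window (`renewal_propagate`). But summing or integrating the
equation shows that weighted window averages of G tend to 0, a contradiction.

Depoissonization goes through increments. Take b < 1 with b > α and b > 1/2, and put γ = b - 1/2.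
Cauchy's formula on |z| = n gives a_(n+1) - a_n = O(n^γ) (`increment_bound_of_poissonGF`); the
recurrence for the increments of x contracts by p^(1+γ) + q^(1+γ) < 1, so they are O(n^γ) too
(`increment_bound`); since a Poisson variable of mean n fluctuates by √n, f(n) - x_n = O(n^b) = o(n)
(`depoissonization`).

If g is cz to leading order, subtract (c/h) K with K(z) = z log z (1 - e^(-z)). As K(z) - K(pz) -
K(qz) is hz up to exponentially small terms, the remaining toll is covered by the above, while K
supplies (c/h) log n. The Mellin transform (1 - p^(-s) - q^(-s)) (-Γ'(s+1)) of this difference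
vanishes at -1 + χ_k, k ≠ 0, and its Laurent expansion at -1 yields the explicit constant in the
second part. -/

/-! ### Renewal equations with a two-point step -/

/-- Comparison principle for subsolutions of a renewal equation. -/
theorem renewal_le_zero {p q a b : ℝ} (hp : 0 < p) (hq : 0 < q) (hpq : p + q = 1)
    (ha : 0 < a) (hb : 0 < b) {D : ℝ → ℝ} (hD : ∀ u, D u ≤ p * D (u - a) + q * D (u - b))
    (hbot : ∀ ε > 0, ∀ᶠ u in atBot, D u ≤ ε) (u : ℝ) : D u ≤ 0 := by
  refine le_of_forall_pos_le_add fun ε hε => ?_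
  rw [zero_add]
  obtain ⟨U, hU⟩ := eventually_atBot.1 (hbot ε hε)
  have hm : 0 < min a b := lt_min ha hb
  have key : ∀ n : ℕ, ∀ v, v ≤ U + n * min a b → D v ≤ ε := by
    intro n
    induction n with
    | zero => intro v hv; exact hU v (by simpa using hv)
    | succ n ih =>
      intro v hv
      push_cast at hv
      have h1 := ih (v - a) (by linarith [min_le_left a b])
      have h2 := ih (v - b) (by linarith [min_le_right a b])
      calc D v ≤ p * D (v - a) + q * D (v - b) := hD v
        _ ≤ p * ε + q * ε := by gcongr
        _ = ε := by rw [← add_mul, hpq, one_mul]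
  obtain ⟨n, hn⟩ := exists_nat_ge ((u - U) / min a b)
  refine key n u ?_
  rw [div_le_iff₀ hm] at hn
  linarith

/-- Solutions of a renewal equation which vanish at `-∞` are bounded linearly in the size of an
exponentially decaying inhomogeneity. -/
theorem renewal_bound {p q a b δ : ℝ} (hp : 0 < p) (hq : 0 < q) (hpq : p + q = 1)
    (ha : 0 < a) (hb : 0 < b) (hδ : 0 < δ) :
    ∃ K : ℝ, 0 < K ∧ ∀ (C : ℝ) (F ψ : ℝ → ℂ), 0 ≤ C →
      (∀ u, F u = p * F (u - a) + q * F (u - b) + ψ u) →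
      (∀ u, ‖ψ u‖ ≤ C * Real.exp (-(δ * |u|))) → Tendsto F atBot (𝓝 0) →
      ∀ u, ‖F u‖ ≤ K * C ∧ ‖F u‖ ≤ K * C * Real.exp (δ * u) := by
  have e1 : Real.exp (-(δ * a)) < 1 := by
    rw [Real.exp_lt_one_iff]; nlinarith
  have e2 : Real.exp (-(δ * b)) < 1 := by
    rw [Real.exp_lt_one_iff]; nlinarith
  have e3 : 1 < Real.exp (δ * a) := by
    rw [Real.one_lt_exp_iff]; positivity
  have e4 : 1 < Real.exp (δ * b) := by
    rw [Real.one_lt_exp_iff]; positivity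
  -- Barriers: ρ⁻¹ C e^(δu) solves the equation with toll C e^(δu), and any constant minus σ⁻¹ C
  -- e^(-δu) solves it with toll C e^(-δu). The first dominates everywhere, the second is the one
  -- that stays bounded at +∞.
  set ρ := 1 - p * Real.exp (-(δ * a)) - q * Real.exp (-(δ * b)) with hρ
  set σ := p * Real.exp (δ * a) + q * Real.exp (δ * b) - 1 with hσ
  have hρ0 : 0 < ρ := by nlinarith
  have hσ0 : 0 < σ := by nlinarith
  set L := max a b
  have hL : 0 < L := lt_max_of_lt_left ha
  refine ⟨ρ⁻¹ + σ⁻¹ * Real.exp (δ * L), by positivity, ?_⟩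
  intro C F ψ hC hF hψ hbot
  have hnorm : ∀ u, ‖F u‖ ≤ p * ‖F (u - a)‖ + q * ‖F (u - b)‖ + ‖ψ u‖ := by
    intro u
    rw [hF u]
    refine (norm_add₃_le).trans ?_
    simp [abs_of_pos hp, abs_of_pos hq]
  have h1 : ∀ u, ‖F u‖ ≤ ρ⁻¹ * C * Real.exp (δ * u) := by
    intro u
    have := renewal_le_zero hp hq hpq ha hb
      (D := fun u => ‖F u‖ - ρ⁻¹ * C * Real.exp (δ * u)) ?_ ?_ u
    · simpa using this
    · intro v
      have h := hnorm v
      have h' := hψ v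
      have h2 : Real.exp (-(δ * |v|)) ≤ Real.exp (δ * v) := by
        apply Real.exp_le_exp.2
        nlinarith [neg_abs_le v]
      have h3 : Real.exp (δ * (v - a)) = Real.exp (δ * v) * Real.exp (-(δ * a)) := by
        rw [← Real.exp_add]; ring_nf
      have h4 : Real.exp (δ * (v - b)) = Real.exp (δ * v) * Real.exp (-(δ * b)) := by
        rw [← Real.exp_add]; ring_nf
      have h5 : C * Real.exp (δ * v) = ρ⁻¹ * C * Real.exp (δ * v) * ρ := by
        field_simp
      have h6 := mul_le_mul_of_nonneg_left h2 hC
      simp only [h3, h4]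
      rw [hρ] at h5
      rw [← hρ] at h5
      have h7 : ρ⁻¹ * C * Real.exp (δ * v) * ρ = ρ⁻¹ * C * Real.exp (δ * v) *
        (1 - p * Real.exp (-(δ * a)) - q * Real.exp (-(δ * b))) := by rw [hρ]
      nlinarith
    · intro ε hε
      have := (tendsto_zero_iff_norm_tendsto_zero.1 hbot).eventually (gt_mem_nhds hε)
      filter_upwards [this] with v hv
      have : 0 ≤ ρ⁻¹ * C * Real.exp (δ * v) := by positivity
      linarith
  -- The constant is chosen so that the second barrier lies above the first one on [-L, 0]; since L
  -- = max a b, steps from u > 0 never leave [-L, ∞).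
  set A := ρ⁻¹ * C + σ⁻¹ * C * Real.exp (δ * L) with hA
  have hm : 0 < min a b := lt_min ha hb
  have h2 : ∀ n : ℕ, ∀ u, -L ≤ u → u ≤ n * min a b → ‖F u‖ ≤ A - σ⁻¹ * C * Real.exp (-(δ * u)) := by
    intro n
    induction n with
    | zero =>
      intro u hu hu'
      simp only [CharP.cast_eq_zero, zero_mul] at hu'
      have g1 : Real.exp (δ * u) ≤ 1 := by
        rw [Real.exp_le_one_iff]; nlinarith
      have g2 : Real.exp (-(δ * u)) ≤ Real.exp (δ * L) := by
        apply Real.exp_le_exp.2; nlinarith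
      have g3 : ρ⁻¹ * C * Real.exp (δ * u) ≤ ρ⁻¹ * C * 1 := by gcongr
      have g4 : σ⁻¹ * C * Real.exp (-(δ * u)) ≤ σ⁻¹ * C * Real.exp (δ * L) := by gcongr
      linarith [h1 u]
    | succ n ih =>
      intro u hu hu'
      push_cast at hu'
      by_cases hu0 : u ≤ 0
      · exact ih u hu (hu0.trans (by positivity))
      push Not at hu0
      have i1 := ih (u - a) (by linarith [le_max_left a b]) (by linarith [min_le_left a b])
      have i2 := ih (u - b) (by linarith [le_max_right a b]) (by linarith [min_le_right a b])
      have h := hnorm u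
      have h' := hψ u
      rw [abs_of_pos hu0] at h'
      have h3 : Real.exp (-(δ * (u - a))) = Real.exp (-(δ * u)) * Real.exp (δ * a) := by
        rw [← Real.exp_add]; ring_nf
      have h4 : Real.exp (-(δ * (u - b))) = Real.exp (-(δ * u)) * Real.exp (δ * b) := by
        rw [← Real.exp_add]; ring_nf
      rw [h3] at i1
      rw [h4] at i2
      have h5 : C * Real.exp (-(δ * u)) = σ⁻¹ * C * Real.exp (-(δ * u)) *
          (p * Real.exp (δ * a) + q * Real.exp (δ * b) - 1) := by
        rw [← hσ]; field_simp
      have i1' := mul_le_mul_of_nonneg_left i1 hp.le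
      have i2' := mul_le_mul_of_nonneg_left i2 hq.le
      have hA' : p * A + q * A = A := by rw [← add_mul, hpq, one_mul]
      linarith
  intro u
  constructor
  · have hKC : (ρ⁻¹ + σ⁻¹ * Real.exp (δ * L)) * C = A := by rw [hA]; ring
    rw [hKC]
    by_cases hu : u ≤ -L
    · refine (h1 u).trans ?_
      have g1 : Real.exp (δ * u) ≤ 1 := by
        rw [Real.exp_le_one_iff]; nlinarith
      have g3 : ρ⁻¹ * C * Real.exp (δ * u) ≤ ρ⁻¹ * C * 1 := by gcongr
      have : 0 ≤ σ⁻¹ * C * Real.exp (δ * L) := by positivity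
      linarith
    · push Not at hu
      obtain ⟨n, hn⟩ := exists_nat_ge (u / min a b)
      rw [div_le_iff₀ hm] at hn
      have := h2 n u hu.le hn
      have g : 0 ≤ σ⁻¹ * C * Real.exp (-(δ * u)) := by positivity
      linarith
  · refine (h1 u).trans ?_
    gcongr
    have : 0 ≤ σ⁻¹ * Real.exp (δ * L) := by positivity
    linarith

/-- Near its limit superior, a bounded solution of an asymptotically homogeneous renewal equation
stays near it along the steps of the random walk. -/
theorem renewal_propagate {p q a b M : ℝ} (hp : 0 < p) (hq : 0 < q) (hpq : p + q = 1)
    {G ψ : ℝ → ℝ} (hG : ∀ u, G u = p * G (u - a) + q * G (u - b) + ψ u)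
    (hψ : Tendsto ψ atTop (𝓝 0)) (hM : ∀ ε > 0, ∀ᶠ u in atTop, G u ≤ M + ε) (n : ℕ) :
    ∀ η > 0, ∃ η' > 0, ∃ U, ∀ u ≥ U, M - η' ≤ G u →
      ∀ j k : ℕ, j + k ≤ n → M - η ≤ G (u - j * a - k * b) := by
  have step : ∀ η > 0, ∃ η' > 0, ∃ U, ∀ u ≥ U, M - η' ≤ G u →
      M - η ≤ G (u - a) ∧ M - η ≤ G (u - b) := by
    intro η hη
    have hm : 0 < min p q := lt_min hp hq
    -- Three errors of size η' occur: the defect of G u below M, the excess of the other neighbour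
    -- over M, and ψ u. Dividing by the weight p or q gives at most η.
    set η' := min p q * η / 3 with hη'
    have hη0 : 0 < η' := by positivity
    have ea := tendsto_atTop_add_const_right atTop (-a) tendsto_id
    have eb := tendsto_atTop_add_const_right atTop (-b) tendsto_id
    obtain ⟨U, hU⟩ := eventually_atTop.1 ((ea.eventually (hM η' hη0)).and
      ((eb.eventually (hM η' hη0)).and (hψ.eventually (gt_mem_nhds hη0))))
    refine ⟨η', hη0, U, fun u hu hGu => ?_⟩
    obtain ⟨h1, h2, h3⟩ := hU u hu
    simp only [id, ← sub_eq_add_neg] at h1 h2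
    have h := hG u
    have m1 : 3 * η' ≤ p * η := by
      rw [hη']; nlinarith [mul_le_mul_of_nonneg_right (min_le_left p q) hη.le]
    have m2 : 3 * η' ≤ q * η := by
      rw [hη']; nlinarith [mul_le_mul_of_nonneg_right (min_le_right p q) hη.le]
    have b1 := mul_le_mul_of_nonneg_left h1 hp.le
    have b2 := mul_le_mul_of_nonneg_left h2 hq.le
    have hq1 : q ≤ 1 := by linarith
    have hp1 : p ≤ 1 := by linarith
    have hMM : M = p * M + q * M := by rw [← add_mul, hpq, one_mul]
    have hpη : p * η' ≤ η' := by nlinarith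
    have hqη : q * η' ≤ η' := by nlinarith
    constructor
    · by_contra hlt
      push Not at hlt
      have := mul_lt_mul_of_pos_left hlt hp
      linarith
    · by_contra hlt
      push Not at hlt
      have := mul_lt_mul_of_pos_left hlt hq
      linarith
  induction n with
  | zero =>
    intro η hη
    refine ⟨η, hη, 0, fun u _ h j k hjk => ?_⟩
    obtain ⟨rfl, rfl⟩ : j = 0 ∧ k = 0 := by omega
    simpa using h
  | succ n ih =>
    intro η hη
    obtain ⟨η₁, h1, U₁, H1⟩ := ih η hη
    obtain ⟨η₂, h2, U₂, H2⟩ := step η₁ h1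
    refine ⟨min η η₂, lt_min hη h2, max (max U₁ U₂) (max (U₁ + a) (U₁ + b)), fun u hu h j k hjk => ?_⟩
    have hu1 : U₁ + a ≤ u := (le_max_left _ _).trans ((le_max_right _ _).trans hu)
    have hu2 : U₁ + b ≤ u := (le_max_right _ _).trans ((le_max_right _ _).trans hu)
    have hu3 : U₂ ≤ u := (le_max_right _ _).trans ((le_max_left _ _).trans hu)
    obtain ⟨g1, g2⟩ := H2 u hu3 (by linarith [min_le_right η η₂])
    rcases j with _ | j
    · rcases k with _ | k
      · simpa using (by linarith [min_le_left η η₂] : M - η ≤ G u)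
      · have := H1 (u - b) (by linarith) g2 0 k (by omega)
        convert this using 2
        push_cast; ring
    · have := H1 (u - a) (by linarith) g1 j k (by omega)
      convert this using 2
      push_cast; ring

/-- A bounded solution of an asymptotically homogeneous renewal equation is asymptotically
nonpositive if it cannot stay near a positive value on long stretches of the random walk. -/
theorem renewal_eventually_le {p q a b B : ℝ} (hp : 0 < p) (hq : 0 < q) (hpq : p + q = 1)
    {G ψ : ℝ → ℝ} (hG : ∀ u, G u = p * G (u - a) + q * G (u - b) + ψ u)
    (hψ : Tendsto ψ atTop (𝓝 0)) (hB : ∀ u, |G u| ≤ B)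
    (h : ∀ M > 0, ∃ η > 0, ∃ n : ℕ, ∀ᶠ u in atTop,
      ¬ ∀ j k : ℕ, j + k ≤ n → M - η ≤ G (u - j * a - k * b)) {ε : ℝ} (hε : 0 < ε) :
    ∀ᶠ u in atTop, G u ≤ ε := by
  have hbd : IsBoundedUnder (· ≤ ·) atTop G :=
    isBoundedUnder_of ⟨B, fun u => (abs_le.1 (hB u)).2⟩
  have hbd' : IsBoundedUnder (· ≥ ·) atTop G :=
    isBoundedUnder_of ⟨-B, fun u => (abs_le.1 (hB u)).1⟩
  have hcb : IsCoboundedUnder (· ≤ ·) atTop G := hbd'.isCoboundedUnder_le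
  set M := limsup G atTop with hM
  have hup : ∀ ε > 0, ∀ᶠ u in atTop, G u ≤ M + ε := fun ε hε =>
    (eventually_lt_of_limsup_lt (show limsup G atTop < M + ε by linarith) hbd).mono
      fun _ h => h.le
  rcases le_or_gt M 0 with hM0 | hM0
  · exact (hup ε hε).mono fun u hu => by linarith
  · exfalso
    obtain ⟨η, hη, n, hn⟩ := h M hM0
    obtain ⟨η', hη', U, hU⟩ := renewal_propagate hp hq hpq hG hψ hup n η hη
    have hfr : ∃ᶠ u in atTop, M - η' < G u :=
      frequently_lt_of_lt_limsup hcb (show M - η' < limsup G atTop by linarith)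
    obtain ⟨u, hu1, hu2, hu3⟩ := (hfr.and_eventually (hn.and (eventually_ge_atTop U))).exists
    exact hu2 (hU u hu3 hu1.le)

/-- Real solutions of a lattice renewal equation with vanishing window sums tend to zero. -/
theorem renewal_lattice_real {p q l B : ℝ} (hp : 0 < p) (hq : 0 < q) (hpq : p + q = 1)
    {r m : ℕ} (hr : 0 < r) (hm : 0 < m) (hrm : r.Coprime m) {G ψ : ℝ → ℝ}
    (hG : ∀ u, G u = p * G (u - r * l) + q * G (u - m * l) + ψ u)
    (hψ : Tendsto ψ atTop (𝓝 0)) (hB : ∀ u, |G u| ≤ B)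
    (hW : Tendsto (fun u => p * ∑ i ∈ Finset.range r, G (u - i * l)
      + q * ∑ i ∈ Finset.range m, G (u - i * l)) atTop (𝓝 0)) :
    Tendsto G atTop (𝓝 0) := by
  have main : ∀ G ψ : ℝ → ℝ, (∀ u, G u = p * G (u - r * l) + q * G (u - m * l) + ψ u) →
      Tendsto ψ atTop (𝓝 0) → (∀ u, |G u| ≤ B) →
      Tendsto (fun u => p * ∑ i ∈ Finset.range r, G (u - i * l)
        + q * ∑ i ∈ Finset.range m, G (u - i * l)) atTop (𝓝 0) →
      ∀ ε > 0, ∀ᶠ u in atTop, G u ≤ ε := by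
    intro G ψ hG hψ hB hW ε hε
    refine renewal_eventually_le hp hq hpq hG hψ hB (fun M hM => ?_) hε
    -- By coprimality every integer rm + i is jr + km with j, k ≥ 0, and for i < r + m then j + k ≤
    -- rm + i. So G ≥ M/2 at r + m consecutive lattice points, which makes a window sum at least (pr
    -- + qm) M/2.
    refine ⟨M / 2, by positivity, r * m + r + m, ?_⟩
    have hκ : 0 < p * r + q * m := by positivity
    have hlim := tendsto_atTop_add_const_right atTop (-((r * m : ℕ) * l)) tendsto_id
    have := hlim.eventually (hW.eventually
      (gt_mem_nhds (show (0 : ℝ) < (p * r + q * m) * (M / 2) by positivity)))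
    filter_upwards [this] with u hu hall
    have hpt : ∀ i : ℕ, i < r + m → M / 2 ≤ G (u + -((r * m : ℕ) * l) - i * l) := by
      intro i hi
      obtain ⟨j, k, hjk⟩ := Nat.exists_add_mul_eq_of_gcd_dvd_of_mul_pred_le r m (r * m + i)
        (by rw [hrm.gcd_eq_one]; exact one_dvd _)
        ((Nat.mul_le_mul (Nat.pred_le r) (Nat.pred_le m)).trans (Nat.le_add_right _ _))
      have hj : j ≤ j * r := Nat.le_mul_of_pos_right _ hr
      have hk : k ≤ k * m := Nat.le_mul_of_pos_right _ hm
      have h1 := hall j k (by omega)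
      have h2 : u + -((r * m : ℕ) * l) - i * l = u - j * (r * l) - k * (m * l) := by
        have : (j : ℝ) * r + k * m = (r * m : ℕ) + i := by exact_mod_cast hjk
        linear_combination l * this
      rw [h2]
      linarith
    have hs : ∀ t : ℕ, t ≤ r + m →
        t * (M / 2) ≤ ∑ i ∈ Finset.range t, G (u + -((r * m : ℕ) * l) - i * l) := by
      intro t ht
      have := Finset.card_nsmul_le_sum (Finset.range t)
        (fun i : ℕ => G (u + -((r * m : ℕ) * l) - i * l)) (M / 2)
        (fun i hi => hpt i ((Finset.mem_range.1 hi).trans_le ht))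
      simpa [nsmul_eq_mul] using this
    have b1 := mul_le_mul_of_nonneg_left (hs r (by omega)) hp.le
    have b2 := mul_le_mul_of_nonneg_left (hs m (by omega)) hq.le
    simp only [id] at hu
    linarith
  have h1 := main G ψ hG hψ hB hW
  have h2 := main (fun u => -G u) (fun u => -ψ u) (fun u => by rw [hG u]; ring)
    (by simpa using hψ.neg) (fun u => by simpa using hB u)
    (by
      have := hW.neg
      rw [neg_zero] at this
      refine this.congr fun u => ?_
      simp only [Finset.sum_neg_distrib]
      ring)
  refine Metric.tendsto_nhds.2 fun ε hε => ?_
  filter_upwards [h1 (ε / 2) (half_pos hε), h2 (ε / 2) (half_pos hε)] with u hu1 hu2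
  rw [Real.dist_eq, sub_zero, abs_lt]
  constructor <;> linarith

/-- If `a / b` is irrational, the semigroup generated by `a, b > 0` is eventually `ε`-dense. -/
theorem exists_window_near_semigroup {a b : ℝ} (hab : Irrational (a / b)) {ε : ℝ}
    (hε : 0 < ε) (L : ℝ) :
    ∃ (T : ℝ) (n : ℕ), ∀ t, T ≤ t → t ≤ T + L →
      ∃ j k : ℕ, j + k ≤ n ∧ |t - (j * a + k * b)| < ε := by
  have hd := dense_addSubgroupClosure_pair_iff.2 hab
  have hex : ∀ x : ℝ, ∃ m n : ℤ, |x - (m * a + n * b)| < ε / 2 := by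
    intro x
    obtain ⟨y, hy, hxy⟩ := Metric.dense_iff.1 hd x (ε / 2) (half_pos hε)
    obtain ⟨m, n, rfl⟩ := AddSubgroup.mem_closure_pair.1 hxy
    refine ⟨m, n, ?_⟩
    rw [Metric.mem_ball, dist_comm, Real.dist_eq] at hy
    simpa using hy
  choose m n hmn using hex
  obtain ⟨t, -, htf, hcov⟩ := isCompact_Icc.finite_cover_balls (s := Set.Icc (0 : ℝ) L)
    (half_pos hε)
  obtain ⟨K, hK⟩ := (htf.image fun x => (m x).natAbs + (n x).natAbs).bddAbove
  -- Density concerns the group ℤa + ℤb. Compactness bounds the coefficients needed on [0, L] by K,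
  -- and translating by Ka + Kb makes them nonnegative, with sum at most 3K.
  refine ⟨K * a + K * b, 4 * K, fun u hu1 hu2 => ?_⟩
  have hmem : u - (K * a + K * b) ∈ Set.Icc (0 : ℝ) L := ⟨by linarith, by linarith⟩
  obtain ⟨x, hx, hxu⟩ := Set.mem_iUnion₂.1 (hcov hmem)
  have hKx : (m x).natAbs + (n x).natAbs ≤ K := hK ⟨x, hx, rfl⟩
  have h0 := hmn x
  refine ⟨(K + m x).toNat, (K + n x).toNat, by omega, ?_⟩
  have c1 : (((K + m x).toNat : ℕ) : ℝ) = K + m x := by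
    have : (((K + m x).toNat : ℕ) : ℤ) = K + m x := Int.toNat_of_nonneg (by omega)
    exact_mod_cast this
  have c2 : (((K + n x).toNat : ℕ) : ℝ) = K + n x := by
    have : (((K + n x).toNat : ℕ) : ℤ) = K + n x := Int.toNat_of_nonneg (by omega)
    exact_mod_cast this
  rw [c1, c2]
  rw [Metric.mem_ball, Real.dist_eq] at hxu
  calc |u - ((K + m x) * a + (K + n x) * b)|
      = |(u - (K * a + K * b) - x) + (x - (m x * a + n x * b))| := by ring_nf
    _ ≤ _ := abs_add_le _ _
    _ < ε := by linarith

/-- Real Lipschitz solutions of a non-lattice renewal equation with vanishing window integrals tend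
to zero. -/
theorem renewal_nonlattice_real {p q a b B K : ℝ} (hp : 0 < p) (hq : 0 < q) (hpq : p + q = 1)
    (ha : 0 < a) (hb : 0 < b) (hab : Irrational (a / b)) (hK : 0 ≤ K) {G ψ : ℝ → ℝ}
    (hG : ∀ u, G u = p * G (u - a) + q * G (u - b) + ψ u)
    (hψ : Tendsto ψ atTop (𝓝 0)) (hB : ∀ u, |G u| ≤ B)
    (hlip : ∀ u v, |G u - G v| ≤ K * |u - v|)
    (hW : Tendsto (fun u => p * (∫ v in (u - a)..u, G v) + q * (∫ v in (u - b)..u, G v))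
      atTop (𝓝 0)) :
    Tendsto G atTop (𝓝 0) := by
  have main : ∀ G ψ : ℝ → ℝ, (∀ u, G u = p * G (u - a) + q * G (u - b) + ψ u) →
      Tendsto ψ atTop (𝓝 0) → (∀ u, |G u| ≤ B) → (∀ u v, |G u - G v| ≤ K * |u - v|) →
      Tendsto (fun u => p * (∫ v in (u - a)..u, G v) + q * (∫ v in (u - b)..u, G v))
        atTop (𝓝 0) →
      ∀ ε > 0, ∀ᶠ u in atTop, G u ≤ ε := by
    intro G ψ hG hψ hB hlip hW ε hε
    refine renewal_eventually_le hp hq hpq hG hψ hB (fun M hM => ?_) hε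
    have hcont : Continuous G := by
      refine (LipschitzWith.of_dist_le_mul (K := ⟨K, hK⟩) fun u v => ?_).continuous
      rw [Real.dist_eq, Real.dist_eq]
      exact hlip u v
    -- With this radius the Lipschitz error is at most M/4; with the loss M/4 along the walk, G ≥
    -- M/2 remains on a window of length a + b, enough to contain both integration intervals.
    obtain ⟨T, n, hT⟩ := exists_window_near_semigroup hab
      (show 0 < M / (4 * (K + 1)) by positivity) (a + b)
    refine ⟨M / 4, by positivity, n, ?_⟩
    have hκ : 0 < p * a + q * b := by positivity
    have hlim := tendsto_atTop_add_const_right atTop (-T) tendsto_id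
    have := hlim.eventually (hW.eventually
      (gt_mem_nhds (show (0 : ℝ) < (p * a + q * b) * (M / 2) by positivity)))
    filter_upwards [this] with u hu hall
    simp only [id] at hu
    have hpt : ∀ v, u + -T - (a + b) ≤ v → v ≤ u + -T → M / 2 ≤ G v := by
      intro v hv1 hv2
      obtain ⟨j, k, hjk, hd⟩ := hT (u - v) (by linarith) (by linarith)
      have h1 := hall j k hjk
      have h2 := hlip v (u - j * a - k * b)
      have h3 : |v - (u - j * a - k * b)| ≤ M / (4 * (K + 1)) := by
        rw [← abs_neg]
        refine le_of_eq_of_le ?_ hd.le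
        congr 1; ring
      have h4 : K * |v - (u - j * a - k * b)| ≤ M / 4 := by
        refine (mul_le_mul_of_nonneg_left h3 hK).trans ?_
        rw [mul_div_assoc', div_le_div_iff₀ (by positivity) (by norm_num)]
        nlinarith
      have := (abs_le.1 (h2.trans h4)).1
      linarith
    have hs : ∀ c, 0 ≤ c → c ≤ a + b → c * (M / 2) ≤ ∫ v in (u + -T - c)..(u + -T), G v := by
      intro c hc hc'
      have := intervalIntegral.integral_mono_on (a := u + -T - c) (b := u + -T)
        (f := fun _ => M / 2) (g := G) (μ := volume) (by linarith) intervalIntegrable_const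
        (hcont.intervalIntegrable _ _) (fun v hv => hpt v (by linarith [hv.1]) hv.2)
      rw [intervalIntegral.integral_const, sub_sub_cancel, smul_eq_mul] at this
      exact this
    have b1 := mul_le_mul_of_nonneg_left (hs a ha.le (by linarith)) hp.le
    have b2 := mul_le_mul_of_nonneg_left (hs b hb.le (by linarith)) hq.le
    linarith
  have h1 := main G ψ hG hψ hB hlip hW
  have h2 := main (fun u => -G u) (fun u => -ψ u) (fun u => by rw [hG u]; ring)
    (by simpa using hψ.neg) (fun u => by rw [abs_neg]; exact hB u)
    (fun u v => by rw [neg_sub_neg, abs_sub_comm]; exact hlip u v)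
    (by
      have := hW.neg
      rw [neg_zero] at this
      refine this.congr fun u => ?_
      have e : ∀ c, ∫ v in c..u, -G v = -∫ v in c..u, G v := fun c =>
        intervalIntegral.integral_neg
      rw [e, e]
      ring)
  refine Metric.tendsto_nhds.2 fun ε hε => ?_
  filter_upwards [h1 (ε / 2) (half_pos hε), h2 (ε / 2) (half_pos hε)] with u hu1 hu2
  rw [Real.dist_eq, sub_zero, abs_lt]
  constructor <;> linarith

theorem tendsto_zero_of_re_im {F : ℝ → ℂ} (h1 : Tendsto (fun u => (F u).re) atTop (𝓝 0))
    (h2 : Tendsto (fun u => (F u).im) atTop (𝓝 0)) : Tendsto F atTop (𝓝 0) := by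
  rw [tendsto_zero_iff_norm_tendsto_zero]
  refine squeeze_zero (fun _ => norm_nonneg _) (fun u => Complex.norm_le_abs_re_add_abs_im _) ?_
  simpa using h1.abs.add h2.abs

theorem exp_decay_tendsto_zero {C δ : ℝ} (hδ : 0 < δ) :
    Tendsto (fun u : ℝ => C * Real.exp (-(δ * |u|))) atTop (𝓝 0) := by
  have : Tendsto (fun u : ℝ => -(δ * |u|)) atTop atBot :=
    tendsto_neg_atTop_atBot.comp (tendsto_abs_atTop_atTop.const_mul_atTop hδ)
  simpa using (Real.tendsto_exp_atBot.comp this).const_mul C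

/-- Comparison of the exponential with a geometric sequence along an arithmetic progression. -/
theorem exp_decay_geometric (δ l u : ℝ) (i : ℕ) :
    Real.exp (-(δ * (u + i * l))) = Real.exp (-(δ * u)) * Real.exp (-(δ * l)) ^ i := by
  rw [← Real.exp_nat_mul, ← Real.exp_add]
  ring_nf

/-- Key renewal theorem for a two-point lattice step distribution. -/
theorem renewal_lattice {p q l δ C : ℝ} (hp : 0 < p) (hq : 0 < q) (hpq : p + q = 1)
    (hl : 0 < l) (hδ : 0 < δ) (hC : 0 ≤ C) {r m : ℕ} (hr : 0 < r) (hm : 0 < m)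
    (hrm : r.Coprime m) {F ψ : ℝ → ℂ}
    (hF : ∀ u, F u = p * F (u - r * l) + q * F (u - m * l) + ψ u)
    (hψ : ∀ u, ‖ψ u‖ ≤ C * Real.exp (-(δ * |u|))) (hbot : Tendsto F atBot (𝓝 0)) :
    Tendsto (fun u => F u - (∑' j : ℤ, ψ (u + j * l)) / ((p * r + q * m : ℝ) : ℂ))
      atTop (𝓝 0) := by
  have ha : 0 < r * l := by positivity
  have hb : 0 < m * l := by positivity
  obtain ⟨K, hK, hKF⟩ := renewal_bound hp hq hpq ha hb hδ
  have hFb := hKF C F ψ hC hF hψ hbot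
  set κ : ℝ := p * r + q * m with hκ
  have hκ0 : 0 < κ := by positivity
  have hκc : (κ : ℂ) ≠ 0 := by exact_mod_cast hκ0.ne'
  have hg1 : Real.exp (-(δ * l)) < 1 := by
    rw [Real.exp_lt_one_iff]; nlinarith
  have hgeo := summable_geometric_of_lt_one (Real.exp_pos _).le hg1
  set S : ℝ → ℂ := fun u => ∑' j : ℤ, ψ (u + j * l) with hS
  -- backward sums
  have hsumF : ∀ u, Summable fun i : ℕ => F (u - i * l) := by
    intro u
    refine Summable.of_norm_bounded (g := fun i : ℕ => K * C * Real.exp (δ * u) *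
      Real.exp (-(δ * l)) ^ i) (hgeo.mul_left _) fun i => ?_
    refine (hFb _).2.trans (le_of_eq ?_)
    have := exp_decay_geometric δ l (-u) i
    rw [mul_assoc (K * C)]
    rw [show δ * u = -(δ * -u) by ring, ← this]
    ring_nf
  have hexpneg : ∀ v, ‖ψ v‖ ≤ C * Real.exp (δ * v) := fun v => (hψ v).trans <| by
    gcongr; nlinarith [neg_abs_le v]
  have hexppos : ∀ v, ‖ψ v‖ ≤ C * Real.exp (-(δ * v)) := fun v => (hψ v).trans <| by
    gcongr; exact le_abs_self v
  have hsumψ : ∀ u, Summable fun i : ℕ => ψ (u - i * l) := by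
    intro u
    refine Summable.of_norm_bounded (g := fun i : ℕ => C * Real.exp (δ * u) *
      Real.exp (-(δ * l)) ^ i) (hgeo.mul_left _) fun i => ?_
    refine (hexpneg _).trans (le_of_eq ?_)
    have := exp_decay_geometric δ l (-u) i
    rw [mul_assoc C]
    rw [show δ * u = -(δ * -u) by ring, ← this]
    ring_nf
  have hbdψ : ∀ u (i : ℕ), ‖ψ (u + i * l)‖ ≤ C * Real.exp (-(δ * u)) * Real.exp (-(δ * l)) ^ i := by
    intro u i
    refine (hexppos _).trans (le_of_eq ?_)
    rw [exp_decay_geometric, mul_assoc]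
  have hsumψ' : ∀ u, Summable fun i : ℕ => ψ (u + i * l) := fun u =>
    Summable.of_norm_bounded (hgeo.mul_left _) (hbdψ u)
  -- Sum the renewal equation over u, u - l, u - 2l, …: because p + q = 1 the full sums cancel and
  -- only two finite windows of F survive.
  have hWF : ∀ u, p * ∑ i ∈ Finset.range r, F (u - i * l)
      + q * ∑ i ∈ Finset.range m, F (u - i * l) = ∑' i : ℕ, ψ (u - i * l) := by
    intro u
    have hshift : ∀ t : ℕ, ∑ i ∈ Finset.range t, F (u - i * l)
        = ∑' i : ℕ, F (u - i * l) - ∑' i : ℕ, F (u - t * l - i * l) := by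
      intro t
      rw [eq_sub_iff_add_eq, ← (hsumF u).sum_add_tsum_nat_add t]
      congr 2
      ext i
      congr 1
      push_cast; ring
    have hsplit : ∑' i : ℕ, F (u - i * l) = p * ∑' i : ℕ, F (u - r * l - i * l)
        + q * ∑' i : ℕ, F (u - m * l - i * l) + ∑' i : ℕ, ψ (u - i * l) := by
      rw [← tsum_mul_left, ← tsum_mul_left, ← ((hsumF _).mul_left _).tsum_add
        ((hsumF _).mul_left _), ← (((hsumF _).mul_left _).add ((hsumF _).mul_left _)).tsum_add
        (hsumψ u)]
      refine tsum_congr fun i => ?_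
      rw [hF (u - i * l)]
      congr 3 <;> ring_nf
    rw [hshift, hshift]
    have hpq' : (p : ℂ) + q = 1 := by exact_mod_cast hpq
    linear_combination hsplit + (∑' i : ℕ, F (u - i * l)) * hpq'
  have hSW : ∀ u, S u = ∑' i : ℕ, ψ (u - i * l) + (∑' i : ℕ, ψ (u + i * l) - ψ u) := by
    intro u
    have hs2 : Summable fun i : ℕ => ψ (u - (i + 1 : ℕ) * l) :=
      (summable_nat_add_iff 1).2 (hsumψ u)
    have h := tsum_of_nat_of_neg_add_one (f := fun j : ℤ => ψ (u + j * l))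
      (by simpa using hsumψ' u)
      (by
        refine hs2.congr fun i => ?_
        congr 1; push_cast; ring)
    rw [hS]
    simp only
    rw [h, (hsumψ u).tsum_eq_zero_add]
    have : ∀ i : ℕ, ψ (u + ((-((i : ℤ) + 1) : ℤ) : ℝ) * l) = ψ (u - (i + 1 : ℕ) * l) := by
      intro i
      congr 1; push_cast; ring
    simp only [this, Int.cast_natCast, Nat.cast_zero, zero_mul, sub_zero]
    ring
  have hperiodic : ∀ (u : ℝ) (t : ℤ), S (u + t * l) = S u := by
    intro u t
    simp only [hS]
    rw [← (Equiv.addRight t).tsum_eq (fun j : ℤ => ψ (u + j * l))]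
    refine tsum_congr fun j => ?_
    congr 1
    simp only [Equiv.coe_addRight, Int.cast_add]
    ring
  set D : ℝ := C * (∑' i : ℕ, Real.exp (-(δ * l)) ^ i) + C with hD
  have hD0 : 0 ≤ D := by
    have : 0 ≤ ∑' i : ℕ, Real.exp (-(δ * l)) ^ i := tsum_nonneg fun i => by positivity
    positivity
  have hdiff : ∀ u, ‖∑' i : ℕ, ψ (u + i * l) - ψ u‖ ≤ D * Real.exp (-(δ * u)) := by
    intro u
    refine (norm_sub_le _ _).trans ?_
    have := tsum_of_norm_bounded (hgeo.mul_left (C * Real.exp (-(δ * u)))).hasSum (hbdψ u)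
    rw [tsum_mul_left] at this
    rw [hD]
    linarith [hexppos u]
  -- By periodicity u may be moved to the right of 0, where the forward tail is at most D and the
  -- backward sum is a window sum of the bounded function F.
  have hSbound : ∀ u, ‖S u‖ ≤ (p * r + q * m) * (K * C) + D := by
    intro u
    obtain ⟨t, ht⟩ := exists_nat_ge (-u / l)
    have hpos : 0 ≤ u + (t : ℤ) * l := by
      rw [div_le_iff₀ hl] at ht
      push_cast
      linarith
    rw [← hperiodic u t, hSW, ← hWF]
    have hr' : ∀ t : ℕ, ∀ v, ‖∑ i ∈ Finset.range t, F (v - i * l)‖ ≤ t * (K * C) := by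
      intro t v
      refine (norm_sum_le _ _).trans ?_
      refine (Finset.sum_le_sum fun i _ => (hFb _).1).trans ?_
      simp
    refine (norm_add₃_le).trans ?_
    rw [norm_mul, norm_mul, Complex.norm_real, Complex.norm_real, Real.norm_of_nonneg hp.le,
      Real.norm_of_nonneg hq.le]
    have h1 := mul_le_mul_of_nonneg_left (hr' r (u + (t : ℤ) * l)) hp.le
    have h2 := mul_le_mul_of_nonneg_left (hr' m (u + (t : ℤ) * l)) hq.le
    have h3 := hdiff (u + (t : ℤ) * l)
    have h4 : D * Real.exp (-(δ * (u + (t : ℤ) * l))) ≤ D * 1 := by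
      gcongr
      rw [Real.exp_le_one_iff]
      nlinarith
    linarith
  -- Both r l and m l are periods of S, so S / κ solves the homogeneous equation. Its weighted
  -- window sum is S, which cancels that of F up to the forward tail of ψ.
  set G : ℝ → ℂ := fun u => F u - S u / κ with hGdef
  have hSr : ∀ u (t : ℕ), S (u - t * l) = S u := by
    intro u t
    have := hperiodic u (-t)
    rw [← this]
    congr 1; push_cast; ring
  have hG : ∀ u, G u = p * G (u - r * l) + q * G (u - m * l) + ψ u := by
    intro u
    simp only [hGdef, hSr]
    rw [hF u]
    have hpq' : (p : ℂ) + q = 1 := by exact_mod_cast hpq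
    linear_combination (S u / κ) * hpq'
  have hGW : Tendsto (fun u => p * ∑ i ∈ Finset.range r, G (u - i * l)
      + q * ∑ i ∈ Finset.range m, G (u - i * l)) atTop (𝓝 (0 : ℂ)) := by
    have heq : ∀ u, p * ∑ i ∈ Finset.range r, G (u - i * l)
      + q * ∑ i ∈ Finset.range m, G (u - i * l) = -(∑' i : ℕ, ψ (u + i * l) - ψ u) := by
      intro u
      simp only [hGdef, hSr, Finset.sum_sub_distrib, Finset.sum_const, Finset.card_range,
        nsmul_eq_mul]
      have e1 := hWF u
      have e2 := hSW u
      have e3 : (κ : ℂ) = p * r + q * m := by rw [hκ]; push_cast; ring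
      have e4 : S u = κ * (S u / κ) := by field_simp
      rw [e3] at e4
      rw [← e3] at e4
      have e5 : S u = (p * r + q * m) * (S u / κ) := by rw [← e3]; exact e4
      linear_combination e1 - e2 + e5
    refine (squeeze_zero_norm (a := fun u => D * Real.exp (-(δ * u))) (fun u => ?_) ?_)
    · rw [heq, norm_neg]
      exact hdiff u
    · refine (exp_decay_tendsto_zero (C := D) hδ).congr' ?_
      filter_upwards [eventually_ge_atTop 0] with u hu
      rw [abs_of_nonneg hu]
  have hGb : ∀ u, ‖G u‖ ≤ K * C + ((p * r + q * m) * (K * C) + D) / κ := by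
    intro u
    refine (norm_sub_le _ _).trans ?_
    rw [norm_div, Complex.norm_real, Real.norm_of_nonneg hκ0.le]
    have := (hFb u).1
    have := hSbound u
    gcongr
  have hψ0 : Tendsto ψ atTop (𝓝 0) := squeeze_zero_norm hψ (exp_decay_tendsto_zero hδ)
  refine tendsto_zero_of_re_im ?_ ?_
  · refine renewal_lattice_real hp hq hpq hr hm hrm (l := l) (ψ := fun u => (ψ u).re)
      (fun u => ?_) ?_ (fun u => (Complex.abs_re_le_norm _).trans (hGb u)) ?_
    · have := congrArg Complex.re (hG u)
      simpa [hGdef] using this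
    · simpa [Function.comp_def] using (Complex.continuous_re.tendsto 0).comp hψ0
    · simpa [hGdef, Function.comp_def] using (Complex.continuous_re.tendsto 0).comp hGW
  · refine renewal_lattice_real hp hq hpq hr hm hrm (l := l) (ψ := fun u => (ψ u).im)
      (fun u => ?_) ?_ (fun u => (Complex.abs_im_le_norm _).trans (hGb u)) ?_
    · have := congrArg Complex.im (hG u)
      simpa [hGdef] using this
    · simpa [Function.comp_def] using (Complex.continuous_im.tendsto 0).comp hψ0
    · simpa [hGdef, Function.comp_def] using (Complex.continuous_im.tendsto 0).comp hGW

theorem integrable_exp_neg_mul_abs {δ : ℝ} (hδ : 0 < δ) :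
    Integrable fun u : ℝ => Real.exp (-(δ * |u|)) := by
  rw [← integrableOn_univ, ← Set.Iic_union_Ioi (a := (0 : ℝ))]
  refine IntegrableOn.union ?_ ?_
  · refine (integrableOn_exp_mul_Iic hδ 0).congr_fun (fun u hu => ?_) measurableSet_Iic
    simp only
    rw [abs_of_nonpos hu]
    ring_nf
  · refine (integrableOn_exp_mul_Ioi (neg_lt_zero.2 hδ) 0).congr_fun (fun u hu => ?_)
      measurableSet_Ioi
    simp only
    rw [abs_of_pos hu]
    ring_nf

/-- Key renewal theorem for a two-point non-lattice step distribution. -/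
theorem renewal_nonlattice {p q a b δ C : ℝ} (hp : 0 < p) (hq : 0 < q) (hpq : p + q = 1)
    (ha : 0 < a) (hb : 0 < b) (hδ : 0 < δ) (hC : 0 ≤ C) (hab : Irrational (a / b))
    {F ψ : ℝ → ℂ} (hF : ∀ u, F u = p * F (u - a) + q * F (u - b) + ψ u)
    (hψ : ∀ u, ‖ψ u‖ ≤ C * Real.exp (-(δ * |u|)))
    (hψ' : ∀ u η, 0 ≤ η → η ≤ 1 → ‖ψ (u + η) - ψ u‖ ≤ C * η * Real.exp (-(δ * |u|)))
    (hψc : Continuous ψ) (hbot : Tendsto F atBot (𝓝 0)) :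
    Tendsto F atTop (𝓝 ((∫ u, ψ u) / ((p * a + q * b : ℝ) : ℂ))) := by
  obtain ⟨K, hK, hKF⟩ := renewal_bound hp hq hpq ha hb hδ
  have hFb := hKF C F ψ hC hF hψ hbot
  set κ : ℝ := p * a + q * b with hκ
  have hκ0 : 0 < κ := by positivity
  have hκc : (κ : ℂ) ≠ 0 := by exact_mod_cast hκ0.ne'
  -- Lipschitz continuity
  have hlip1 : ∀ u η, 0 ≤ η → η ≤ 1 → ‖F (u + η) - F u‖ ≤ K * C * η := by
    intro u η h0 h1
    -- A translate difference solves the same equation with a toll of size C η, so linearity of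
    -- `renewal_bound` in its constant gives a Lipschitz bound.
    have h := (hKF (C * η) (fun u => F (u + η) - F u) (fun u => ψ (u + η) - ψ u) (by positivity)
      (fun u => ?_) (fun u => hψ' u η h0 h1) ?_ u).1
    · simpa [mul_assoc] using h
    · rw [hF (u + η), hF u, show u + η - a = u - a + η by ring, show u + η - b = u - b + η by ring]
      ring
    · have := (hbot.comp (tendsto_atBot_add_const_right atBot η tendsto_id)).sub hbot
      simpa using this
  have hlip2 : ∀ u v, u ≤ v → ‖F v - F u‖ ≤ 2 * K * C * (v - u) := by
    intro u v huv
    rcases le_or_gt (v - u) 1 with h | h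
    · have := hlip1 u (v - u) (by linarith) h
      rw [add_sub_cancel] at this
      have h0 : 0 ≤ K * C * (v - u) := mul_nonneg (by positivity) (by linarith)
      linarith
    · refine (norm_sub_le _ _).trans ?_
      have h0 : 0 ≤ K * C * (v - u - 1) := mul_nonneg (by positivity) (by linarith)
      linarith [(hFb u).1, (hFb v).1]
  have hlip : ∀ u v, ‖F u - F v‖ ≤ 2 * K * C * |u - v| := by
    intro u v
    rcases le_total u v with h | h
    · rw [norm_sub_rev, abs_sub_comm, abs_of_nonneg (by linarith : 0 ≤ v - u)]
      exact hlip2 u v h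
    · rw [abs_of_nonneg (by linarith : 0 ≤ u - v)]
      exact hlip2 v u h
  have hcont : Continuous F := by
    refine (LipschitzWith.of_dist_le_mul (K := ⟨2 * K * C, by positivity⟩) fun u v => ?_).continuous
    rw [dist_eq_norm, Real.dist_eq]
    exact hlip u v
  have hψi : Integrable ψ := ((integrable_exp_neg_mul_abs hδ).const_mul C).mono'
    hψc.aestronglyMeasurable (ae_of_all _ hψ)
  have hFi : ∀ u, IntegrableOn F (Set.Iic u) := fun u =>
    ((integrableOn_exp_mul_Iic hδ u).const_mul (K * C)).mono' hcont.aestronglyMeasurable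
      (ae_of_all _ fun v => (hFb v).2)
  -- window integrals
  have hshift : ∀ c u, ∫ v in Set.Iic u, F (v - c) = ∫ v in Set.Iic (u - c), F v := by
    intro c u
    have := (measurePreserving_sub_right volume c).setIntegral_preimage_emb
      (MeasurableEquiv.subRight c).measurableEmbedding F (Set.Iic (u - c))
    rw [← this]
    congr 2
    ext v
    simp
  have hshifti : ∀ c u, IntegrableOn (fun v => F (v - c)) (Set.Iic u) := fun c u => by
    refine ((integrableOn_exp_mul_Iic hδ u).const_mul (K * C * Real.exp (-(δ * c)))).mono'
      (by fun_prop) (ae_of_all _ fun v => (hFb _).2.trans (le_of_eq ?_))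
    rw [mul_assoc (K * C), ← Real.exp_add]
    ring_nf
  -- Continuous form of the telescoping: integrate the equation over (-∞, u] and use p + q = 1.
  have hW : ∀ u, p * (∫ v in (u - a)..u, F v) + q * (∫ v in (u - b)..u, F v)
      = ∫ v in Set.Iic u, ψ v := by
    intro u
    rw [← intervalIntegral.integral_Iic_sub_Iic (hFi _) (hFi _),
      ← intervalIntegral.integral_Iic_sub_Iic (hFi _) (hFi _)]
    have hsplit : ∫ v in Set.Iic u, F v = p * (∫ v in Set.Iic (u - a), F v)
        + q * (∫ v in Set.Iic (u - b), F v) + ∫ v in Set.Iic u, ψ v := by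
      have i1 := (hshifti a u).const_mul (p : ℂ)
      have i2 := (hshifti b u).const_mul (q : ℂ)
      have e1 := integral_add (i1.add i2) hψi.integrableOn
      have e2 := integral_add i1 i2
      rw [integral_const_mul, integral_const_mul, hshift, hshift] at e2
      rw [← e2]
      exact (integral_congr_ae (ae_of_all _ hF)).trans e1
    have hpq' : (p : ℂ) + q = 1 := by exact_mod_cast hpq
    linear_combination hsplit + (∫ v in Set.Iic u, F v) * hpq'
  set A : ℂ := (∫ u, ψ u) / (κ : ℂ) with hA
  set G : ℝ → ℂ := fun u => F u - A with hGdef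
  have hG : ∀ u, G u = p * G (u - a) + q * G (u - b) + ψ u := by
    intro u
    simp only [hGdef]
    rw [hF u]
    have hpq' : (p : ℂ) + q = 1 := by exact_mod_cast hpq
    linear_combination A * hpq'
  have hGi : ∀ u v, ∫ w in u..v, G w = (∫ w in u..v, F w) - (v - u) * A := by
    intro u v
    simp only [hGdef]
    rw [intervalIntegral.integral_sub (hcont.intervalIntegrable _ _) intervalIntegrable_const,
      intervalIntegral.integral_const]
    simp
  have hGW : Tendsto (fun u => p * (∫ v in (u - a)..u, G v) + q * (∫ v in (u - b)..u, G v))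
      atTop (𝓝 (0 : ℂ)) := by
    have hlim : Tendsto (fun u => ∫ v in Set.Iic u, ψ v) atTop (𝓝 (∫ v, ψ v)) :=
      (aecover_Iic tendsto_id).integral_tendsto_of_countably_generated hψi
    have := hlim.sub_const (∫ v, ψ v)
    rw [sub_self] at this
    refine this.congr fun u => ?_
    rw [hGi, hGi, ← hW]
    have e : (∫ v, ψ v) = (p * a + q * b) * A := by
      have : (κ : ℂ) = p * a + q * b := by rw [hκ]; push_cast; ring
      rw [← this, hA]
      field_simp
    rw [e]
    push_cast
    ring
  have hGc : Continuous G := hcont.sub continuous_const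
  have hGb : ∀ u, ‖G u‖ ≤ K * C + ‖A‖ := fun u => (norm_sub_le _ _).trans (by
    linarith [(hFb u).1])
  have hGlip : ∀ u v, ‖G u - G v‖ ≤ 2 * K * C * |u - v| := fun u v => by
    simpa [hGdef] using hlip u v
  have hψ0 : Tendsto ψ atTop (𝓝 0) := squeeze_zero_norm hψ (exp_decay_tendsto_zero hδ)
  have hre : ∀ u v, ∫ w in u..v, (G w).re = (∫ w in u..v, G w).re := fun u v =>
    Complex.reCLM.intervalIntegral_comp_comm (hGc.intervalIntegrable u v)
  have him : ∀ u v, ∫ w in u..v, (G w).im = (∫ w in u..v, G w).im := fun u v =>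
    Complex.imCLM.intervalIntegral_comp_comm (hGc.intervalIntegrable u v)
  have hfin : Tendsto G atTop (𝓝 0) := by
    refine tendsto_zero_of_re_im ?_ ?_
    · refine renewal_nonlattice_real hp hq hpq ha hb hab (K := 2 * K * C) (by positivity)
        (ψ := fun u => (ψ u).re) (fun u => ?_) ?_
        (fun u => (Complex.abs_re_le_norm _).trans (hGb u))
        (fun u v => (Complex.abs_re_le_norm (G u - G v)).trans (hGlip u v)) ?_
      · have := congrArg Complex.re (hG u)
        simpa [hGdef] using this
      · simpa [Function.comp_def] using (Complex.continuous_re.tendsto 0).comp hψ0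
      · simp only [hre]
        simpa [Function.comp_def] using (Complex.continuous_re.tendsto 0).comp hGW
    · refine renewal_nonlattice_real hp hq hpq ha hb hab (K := 2 * K * C) (by positivity)
        (ψ := fun u => (ψ u).im) (fun u => ?_) ?_
        (fun u => (Complex.abs_im_le_norm _).trans (hGb u))
        (fun u v => (Complex.abs_im_le_norm (G u - G v)).trans (hGlip u v)) ?_
      · have := congrArg Complex.im (hG u)
        simpa [hGdef] using this
      · simpa [Function.comp_def] using (Complex.continuous_im.tendsto 0).comp hψ0
      · simp only [him]
        simpa [Function.comp_def] using (Complex.continuous_im.tendsto 0).comp hGW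
  simpa [hGdef] using hfin.add_const A

/-! ### Functions with exponential decay on a horizontal strip -/

/-- `Ψ` is holomorphic on the strip `|Im w| < θ` and is `O(e^{-δ |Re w|})` there. -/
structure StripDecay (θ δ C : ℝ) (Ψ : ℂ → ℂ) : Prop where
  diff : DifferentiableOn ℂ Ψ {w | |w.im| < θ}
  bound : ∀ w : ℂ, |w.im| < θ → ‖Ψ w‖ ≤ C * Real.exp (-(δ * |w.re|))

theorem isOpen_strip (θ : ℝ) : IsOpen {w : ℂ | |w.im| < θ} :=
  isOpen_lt (Complex.continuous_im.abs) continuous_const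

namespace StripDecay

variable {θ δ C : ℝ} {Ψ : ℂ → ℂ}

theorem const_nonneg (h : StripDecay θ δ C Ψ) (hθ : 0 < θ) : 0 ≤ C := by
  have := (norm_nonneg _).trans (h.bound 0 (by simpa using hθ))
  simpa using this

/-- The derivative of a function decaying on a strip decays on the half strip. -/
theorem deriv (h : StripDecay θ δ C Ψ) (hθ : 0 < θ) (hδ : 0 < δ) :
    StripDecay (θ / 2) δ (C * Real.exp (δ * (θ / 4)) / (θ / 4)) (deriv Ψ) := by
  have hsub : {w : ℂ | |w.im| < θ / 2} ⊆ {w : ℂ | |w.im| < θ} := fun w hw => by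
    simp only [Set.mem_ofPred_eq] at hw ⊢
    linarith
  refine ⟨(h.diff.deriv (isOpen_strip θ)).mono hsub, fun w hw => ?_⟩
  -- Cauchy's estimate on circles of radius θ/4: these stay inside the strip, and moving the real
  -- part by θ/4 costs the factor e^(δθ/4).
  have hball : Metric.closedBall w (θ / 4) ⊆ {w : ℂ | |w.im| < θ} := by
    intro z hz
    have h1 := Complex.abs_im_le_norm (z - w)
    rw [Metric.mem_closedBall, dist_eq_norm] at hz
    rw [Complex.sub_im] at h1
    have h2 := abs_sub_abs_le_abs_sub z.im w.im
    simp only [Set.mem_ofPred_eq]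
    linarith
  have hC := h.const_nonneg hθ
  have := Complex.norm_deriv_le_of_forall_mem_sphere_norm_le (c := w) (R := θ / 4) (f := Ψ)
    (C := C * Real.exp (δ * (θ / 4)) * Real.exp (-(δ * |w.re|))) (by positivity)
    ((h.diff.mono (by rw [closure_ball _ (by positivity)]; exact hball)).diffContOnCl)
    (fun z hz => ?_)
  · refine this.trans (le_of_eq ?_)
    ring
  · refine (h.bound z (hball (Metric.sphere_subset_closedBall hz))).trans ?_
    rw [mul_assoc, ← Real.exp_add]
    gcongr
    have h1 := Complex.abs_re_le_norm (z - w)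
    rw [mem_sphere_iff_norm] at hz
    rw [Complex.sub_re, hz, abs_sub_comm] at h1
    have h2 := abs_sub_abs_le_abs_sub w.re z.re
    nlinarith

theorem hasDerivAt (h : StripDecay θ δ C Ψ) (hθ : 0 < θ) (u : ℝ) :
    HasDerivAt (fun v : ℝ => Ψ v) (_root_.deriv Ψ u) u :=
  ((h.diff.differentiableAt ((isOpen_strip θ).mem_nhds
    (by simpa using hθ))).hasDerivAt (x := (u : ℂ))).comp_ofReal

theorem continuous (h : StripDecay θ δ C Ψ) (hθ : 0 < θ) : Continuous fun v : ℝ => Ψ v :=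
  continuous_iff_continuousAt.2 fun u => (h.hasDerivAt hθ u).continuousAt

theorem bound_real (h : StripDecay θ δ C Ψ) (hθ : 0 < θ) (u : ℝ) :
    ‖Ψ u‖ ≤ C * Real.exp (-(δ * |u|)) := by
  simpa using h.bound u (by simpa using hθ)

theorem integrable (h : StripDecay θ δ C Ψ) (hθ : 0 < θ) (hδ : 0 < δ) :
    Integrable fun v : ℝ => Ψ v :=
  ((integrable_exp_neg_mul_abs hδ).const_mul C).mono' (h.continuous hθ).aestronglyMeasurable
    (ae_of_all _ (h.bound_real hθ))

/-- Mean value inequality with the decaying derivative; e^δ pays for a displacement of at most 1.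
This is the regularity that `renewal_nonlattice` asks of its toll. -/
theorem norm_sub_le (h : StripDecay θ δ C Ψ) (hθ : 0 < θ) (hδ : 0 < δ) :
    ∃ C', ∀ u η : ℝ, 0 ≤ η → η ≤ 1 →
      ‖Ψ ((u + η : ℝ) : ℂ) - Ψ u‖ ≤ C' * η * Real.exp (-(δ * |u|)) := by
  have h' := h.deriv hθ hδ
  have hC' := h'.const_nonneg (by positivity)
  set C' := C * Real.exp (δ * (θ / 4)) / (θ / 4)
  refine ⟨C' * Real.exp δ, fun u η h0 h1 => ?_⟩
  have := Convex.norm_image_sub_le_of_norm_hasDerivWithin_le (f := fun v : ℝ => Ψ v)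
    (f' := fun v : ℝ => _root_.deriv Ψ v) (s := Set.Icc u (u + η)) (x := u) (y := u + η)
    (C := C' * Real.exp δ * Real.exp (-(δ * |u|)))
    (fun x _ => (h.hasDerivAt hθ x).hasDerivWithinAt) (fun x hx => ?_) (convex_Icc _ _)
    (by simp [h0]) (by simp [h0])
  · refine this.trans (le_of_eq ?_)
    rw [add_sub_cancel_left, Real.norm_of_nonneg h0]
    ring
  · refine (h'.bound_real (by positivity) x).trans ?_
    rw [mul_assoc, ← Real.exp_add]
    gcongr
    have h2 := abs_sub_abs_le_abs_sub u x
    have h3 : |u - x| ≤ 1 := by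
      rw [abs_le]; constructor <;> linarith [hx.1, hx.2]
    nlinarith

/-- The Fourier transform of a function decaying on a strip is `O(x⁻²)`. -/
theorem fourier_bound (h : StripDecay θ δ C Ψ) (hθ : 0 < θ) (hδ : 0 < δ) :
    ∃ B, ∀ x : ℝ, ‖𝓕 (fun v : ℝ => Ψ v) x‖ * x ^ 2 ≤ B := by
  have h1 := h.deriv hθ hδ
  have h2 := h1.deriv (half_pos hθ) hδ
  have d0 : _root_.deriv (fun v : ℝ => Ψ v) = fun v : ℝ => _root_.deriv Ψ v :=
    funext fun u => (h.hasDerivAt hθ u).deriv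
  have d1 : _root_.deriv (fun v : ℝ => _root_.deriv Ψ v)
      = fun v : ℝ => _root_.deriv (_root_.deriv Ψ) v :=
    funext fun u => (h1.hasDerivAt (half_pos hθ) u).deriv
  have i0 := h.integrable hθ hδ
  have i1 := h1.integrable (half_pos hθ) hδ
  have i2 := h2.integrable (half_pos (half_pos hθ)) hδ
  have f1 := Real.fourier_deriv i0 (fun u => (h.hasDerivAt hθ u).differentiableAt)
    (by rw [d0]; exact i1)
  have f2 := Real.fourier_deriv i1 (fun u => (h1.hasDerivAt (half_pos hθ) u).differentiableAt)
    (by rw [d1]; exact i2)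
  rw [d0] at f1
  rw [d1, f1] at f2
  refine ⟨∫ v : ℝ, ‖_root_.deriv (_root_.deriv Ψ) v‖, fun x => ?_⟩
  have h3 : ‖𝓕 (fun v : ℝ => _root_.deriv (_root_.deriv Ψ) v) x‖
      ≤ ∫ v : ℝ, ‖_root_.deriv (_root_.deriv Ψ) v‖ := by
    rw [Real.fourier_real_eq_integral_exp_smul]
    refine (norm_integral_le_integral_norm _).trans (le_of_eq ?_)
    congr 1
    ext v
    rw [norm_smul, Complex.norm_exp_ofReal_mul_I, one_mul]
  rw [f2] at h3
  refine le_trans ?_ h3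
  simp only [norm_smul, norm_mul, Complex.norm_real, Complex.norm_I, Real.norm_eq_abs,
    Complex.norm_ofNat, mul_one]
  have hpi : 1 ≤ 2 * |Real.pi| := by
    rw [abs_of_pos Real.pi_pos]; linarith [Real.pi_gt_three]
  have hx := norm_nonneg (𝓕 (fun v : ℝ => Ψ v) x)
  have : x ^ 2 = |x| * |x| := by rw [← abs_mul, ← sq, abs_of_nonneg (sq_nonneg x)]
  rw [this]
  have hm : 1 ≤ (2 * |Real.pi|) * (2 * |Real.pi|) := by nlinarith
  have hn : 0 ≤ ‖𝓕 (fun v : ℝ => Ψ v) x‖ * (|x| * |x|) := by positivity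
  nlinarith

/-- Source of the absolute convergence of the fluctuation series, by comparison with Σ n⁻²; the
index 0, where the bound is empty, is discarded as a finite set. -/
theorem summable_fourier (h : StripDecay θ δ C Ψ) (hθ : 0 < θ) (hδ : 0 < δ) :
    Summable fun n : ℤ => 𝓕 (fun v : ℝ => Ψ v) (n : ℝ) := by
  obtain ⟨B, hB⟩ := h.fourier_bound hθ hδ
  have hs : Summable fun n : ℤ => B * |(n : ℝ)| ^ (-2 : ℝ) :=
    (Real.summable_abs_int_rpow (b := 2) (by norm_num)).mul_left B
  refine Summable.of_norm_bounded_eventually hs ?_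
  have : ∀ᶠ n : ℤ in cofinite, n ≠ 0 :=
    (Set.finite_singleton (0 : ℤ)).compl_mem_cofinite
  filter_upwards [this] with n hn
  have hn' : (0 : ℝ) < |(n : ℝ)| := abs_pos.2 (by exact_mod_cast hn)
  rw [Real.rpow_neg hn'.le, ← div_eq_mul_inv, le_div_iff₀ (by positivity)]
  have := hB n
  rw [← sq_abs] at this
  exact_mod_cast this

/-- Poisson summation for functions decaying on a strip. -/
theorem poisson (h : StripDecay θ δ C Ψ) (hθ : 0 < θ) (hδ : 0 < δ) (x : ℝ) :
    ∑' n : ℤ, Ψ ((x + n : ℝ) : ℂ)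
      = ∑' n : ℤ, 𝓕 (fun v : ℝ => Ψ v) n * fourier n (x : UnitAddCircle) := by
  refine Real.tsum_eq_tsum_fourier_of_rpow_decay_of_summable (f := fun v : ℝ => Ψ v)
    (h.continuous hθ) (b := 2) (by norm_num) ?_ (h.summable_fourier hθ hδ) x
  have h1 : (fun v : ℝ => Ψ v) =O[cocompact ℝ] fun v => Real.exp (-(δ * |v|)) :=
    Asymptotics.isBigO_of_le' (c := C) _ fun v => by
      simpa using h.bound_real hθ v
  refine h1.trans ?_
  have h2 := (isLittleO_exp_neg_mul_rpow_atTop hδ (-2)).isBigO.comp_tendsto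
    (tendsto_norm_cocompact_atTop (E := ℝ))
  simpa [Function.comp_def] using h2

/-- Scaling by the span l turns lattice sums into sums over ℤ; the sign matches the substitution t =
e^(-v) that identifies Mellin with Fourier transforms. -/
theorem comp_neg_mul (h : StripDecay θ δ C Ψ) {l : ℝ} (hl : 0 < l) :
    StripDecay (θ / l) (δ * l) C fun w => Ψ (-(l * w)) := by
  have key : ∀ w : ℂ, |w.im| < θ / l → |(-(l * w)).im| < θ := by
    intro w hw
    rw [lt_div_iff₀ hl] at hw
    simp only [Complex.neg_im, Complex.im_ofReal_mul, abs_neg, abs_mul,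
      abs_of_pos hl]
    linarith
  refine ⟨h.diff.comp (by fun_prop) key, fun w hw => (h.bound _ (key w hw)).trans (le_of_eq ?_)⟩
  simp only [Complex.neg_re, Complex.re_ofReal_mul, abs_neg, abs_mul, abs_of_pos hl, mul_assoc]

end StripDecay

/-! ### Functional equations in a sector -/

/-- `φ` is holomorphic on the sector `|arg z| < θ` and is `O(|z|^{1+δ})` at the origin and
`O(|z|^{1-δ})` at infinity. -/
structure SectorDecay (θ δ C : ℝ) (φ : ℂ → ℂ) : Prop where
  diff : DifferentiableOn ℂ φ {z | z ≠ 0 ∧ |z.arg| < θ}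
  bound : ∀ z : ℂ, z ≠ 0 → |z.arg| < θ → ‖φ z‖ ≤ C * ‖z‖ * Real.exp (-(δ * |Real.log ‖z‖|))

/-- The pull-back of a function on a sector to a strip by the exponential. -/
noncomputable def logPullback (φ : ℂ → ℂ) (w : ℂ) : ℂ := φ (Complex.exp w) * Complex.exp (-w)

/-- For θ < π the argument of e^w is Im w, so the exponential maps the strip to the sector; the
weight e^(-w) removes the factor |z| from the bound. -/
theorem SectorDecay.stripDecay {θ δ C : ℝ} {φ : ℂ → ℂ} (h : SectorDecay θ δ C φ)
    (hθ : θ < Real.pi) : StripDecay θ δ C (logPullback φ) := by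
  have harg : ∀ w : ℂ, |w.im| < θ → (Complex.exp w).arg = w.im := fun w hw => by
    obtain ⟨h1, h2⟩ := abs_lt.1 hw
    rw [Complex.arg_exp, toIocMod_eq_self]
    constructor <;> linarith
  constructor
  · refine (h.diff.comp Complex.differentiable_exp.differentiableOn fun w hw => ?_).mul
      (by fun_prop)
    have hw' : |w.im| < θ := hw
    exact ⟨Complex.exp_ne_zero w, by rw [harg w hw']; exact hw'⟩
  · intro w hw
    have := h.bound (Complex.exp w) (Complex.exp_ne_zero w) (by rwa [harg w hw])
    rw [logPullback, norm_mul, Complex.norm_exp (-w)]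
    rw [Complex.norm_exp, Real.log_exp] at this
    have h1 : Real.exp w.re * Real.exp (-w).re = 1 := by
      rw [← Real.exp_add]; simp
    calc _ ≤ C * Real.exp w.re * Real.exp (-(δ * |w.re|)) * Real.exp (-w).re := by gcongr
      _ = C * Real.exp (-(δ * |w.re|)) * (Real.exp w.re * Real.exp (-w).re) := by ring
      _ = _ := by rw [h1, mul_one]

/-- The Fourier transform of the rescaled pull-back is a Mellin transform on `Re s = -1`. -/
theorem fourier_logPullback (φ : ℂ → ℂ) {l : ℝ} (hl : 0 < l) (x : ℝ) :
    𝓕 (fun v : ℝ => logPullback φ (-(l * v))) x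
      = (l : ℂ)⁻¹ * mellin (fun t : ℝ => φ t) (-1 + 2 * Real.pi * x * Complex.I / l) := by
  rw [mellin_eq_fourier]
  have him : (-1 + 2 * (Real.pi : ℂ) * x * Complex.I / l).im / (2 * Real.pi) = x / l := by
    have : (-1 + 2 * (Real.pi : ℂ) * x * Complex.I / l)
        = ((-1 : ℝ) : ℂ) + ((2 * Real.pi * x / l : ℝ) : ℂ) * Complex.I := by
      push_cast; ring
    rw [this, Complex.add_im, Complex.ofReal_im, Complex.im_ofReal_mul, Complex.I_im]
    field_simp
    ring
  have hre : (-1 + 2 * (Real.pi : ℂ) * x * Complex.I / l).re = -1 := by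
    have : (-1 + 2 * (Real.pi : ℂ) * x * Complex.I / l)
        = ((-1 : ℝ) : ℂ) + ((2 * Real.pi * x / l : ℝ) : ℂ) * Complex.I := by
      push_cast; ring
    rw [this, Complex.add_re, Complex.ofReal_re, Complex.re_ofReal_mul, Complex.I_re]
    ring
  rw [him, hre, Real.fourier_real_eq_integral_exp_smul, Real.fourier_real_eq_integral_exp_smul]
  have := Measure.integral_comp_mul_left (fun v : ℝ =>
    Complex.exp (((-2 * Real.pi * v * (x / l) : ℝ) : ℂ) * Complex.I) •
      (Real.exp (-(-1) * v) • φ ((Real.exp (-v) : ℝ) : ℂ))) l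
  rw [abs_of_pos (inv_pos.2 hl)] at this
  rw [← Complex.ofReal_inv, ← Complex.real_smul, ← this]
  congr 1
  ext v
  congr 2
  · congr 2
    field_simp
  · rw [logPullback, neg_neg, Complex.real_smul, mul_comm]
    push_cast
    ring_nf

theorem integral_logPullback (φ : ℂ → ℂ) :
    ∫ u : ℝ, logPullback φ u = mellin (fun t : ℝ => φ t) (-1) := by
  have := fourier_logPullback φ one_pos 0
  rw [Real.fourier_real_eq_integral_exp_smul] at this
  simp only [mul_zero, Complex.ofReal_zero, zero_mul, Complex.exp_zero, one_smul,
    Complex.ofReal_one, one_mul, inv_one, zero_div, add_zero] at this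
  rw [← this, ← integral_neg_eq_self]
  simp

/-! ### Lattice dichotomy and asymptotics of the functional equation -/

theorem binEntropy_eq_neg_log (p : ℝ) :
    Real.binEntropy p = p * (-Real.log p) + (1 - p) * (-Real.log (1 - p)) := by
  simp [Real.binEntropy, Real.log_inv]

/-- The lattice data: `log p = - r λ` and `log (1 - p) = - ℓ λ` with `r, ℓ` coprime. -/
theorem IsLattice.exists_span {p : ℝ} (hp0 : 0 < p) (hp1 : p < 1) (h : IsLattice p) :
    ∃ (r m : ℕ) (l : ℝ), 0 < r ∧ 0 < m ∧ r.Coprime m ∧ 0 < l ∧ latticeNum p = r ∧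
      -Real.log p = r * l ∧ -Real.log (1 - p) = m * l := by
  have hlp : Real.log p < 0 := Real.log_neg hp0 hp1
  have hlq : Real.log (1 - p) < 0 := Real.log_neg (by linarith) (by linarith)
  set x : ℚ := h.choose with hx
  have hxe : (x : ℝ) = Real.log p / Real.log (1 - p) := h.choose_spec
  have hx0 : 0 < x := by
    have : (0 : ℝ) < x := by rw [hxe]; exact div_pos_of_neg_of_neg hlp hlq
    exact_mod_cast this
  have hnum : 0 < x.num := Rat.num_pos.2 hx0
  have hnat : ((x.num.natAbs : ℕ) : ℤ) = x.num := Int.natAbs_of_nonneg hnum.le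
  have hr : 0 < x.num.natAbs := Int.natAbs_pos.2 hnum.ne'
  have hr' : (0 : ℝ) < x.num.natAbs := by exact_mod_cast hr
  refine ⟨x.num.natAbs, x.den, -Real.log p / x.num.natAbs, hr, x.pos, x.reduced,
    div_pos (by linarith) hr', ?_, by field_simp, ?_⟩
  · rw [hnat, latticeNum, dif_pos h]
  · have hden : (0 : ℝ) < x.den := by exact_mod_cast x.pos
    have h1 : (x : ℝ) = (x.num.natAbs : ℝ) / x.den := by
      rw [Rat.cast_def]
      congr 1
      exact (congrArg (fun z : ℤ => (z : ℝ)) hnat.symm).trans (Int.cast_natCast _)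
    rw [h1, div_eq_div_iff hden.ne' hlq.ne] at hxe
    field_simp
    linarith

theorem tsum_int_eq_zero_add {f : ℤ → ℂ} (hf : Summable f) :
    ∑' k, f k = f 0 + ∑' k : {k : ℤ // k ≠ 0}, f k := by
  rw [hf.tsum_eq_add_tsum_ite 0]
  congr 1
  have := tsum_subtype {k : ℤ | k ≠ 0} f
  refine Eq.trans (tsum_congr fun k => ?_) this.symm
  by_cases hk : k = 0 <;> simp [hk, Set.indicator]

/-- Asymptotics of the solutions of `f(x) = f(px) + f(qx) + φ(x)`. -/
theorem tendsto_of_functional_equation {p θ δ C : ℝ} (hp0 : 0 < p) (hp1 : p < 1) (hθ0 : 0 < θ)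
    (hθ : θ < Real.pi) (hδ : 0 < δ) {φ : ℂ → ℂ} (hφ : SectorDecay θ δ C φ) {f : ℝ → ℂ}
    (hf : ∀ x, 0 < x → f x = f (p * x) + f ((1 - p) * x) + φ x)
    (hf0 : Tendsto (fun x : ℝ => f x / x) (𝓝[>] 0) (𝓝 0)) :
    FluctuationSummable p (mellin fun t : ℝ => φ t) ∧
    Tendsto (fun n : ℕ => f n / n - (mellin (fun t : ℝ => φ t) (-1) / (Real.binEntropy p : ℂ)
      + fluctuation p (mellin fun t : ℝ => φ t) ((latticeNum p : ℝ) * Real.logb (1 / p) n)))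
      atTop (𝓝 0) := by
  have hq0 : 0 < 1 - p := by linarith
  have hlp : 0 < -Real.log p := by linarith [Real.log_neg hp0 hp1]
  have hlq : 0 < -Real.log (1 - p) := by linarith [Real.log_neg hq0 (by linarith)]
  have hS := hφ.stripDecay hθ
  have hC := hS.const_nonneg hθ0
  set F : ℝ → ℂ := fun u => f (Real.exp u) / Real.exp u with hFdef
  have hF : ∀ u, F u = p * F (u - -Real.log p) + (1 - p : ℝ) * F (u - -Real.log (1 - p))
      + logPullback φ u := by
    intro u
    have e1 : Real.exp (u - -Real.log p) = p * Real.exp u := by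
      rw [sub_neg_eq_add, Real.exp_add, Real.exp_log hp0, mul_comm]
    have e2 : Real.exp (u - -Real.log (1 - p)) = (1 - p) * Real.exp u := by
      rw [sub_neg_eq_add, Real.exp_add, Real.exp_log hq0, mul_comm]
    have h1 : (Real.exp u : ℂ) ≠ 0 := by exact_mod_cast (Real.exp_pos u).ne'
    have h2 : (p : ℂ) ≠ 0 := by exact_mod_cast hp0.ne'
    have h3 : ((1 - p : ℝ) : ℂ) ≠ 0 := by exact_mod_cast hq0.ne'
    simp only [hFdef, e1, e2]
    rw [hf _ (Real.exp_pos u), logPullback, Complex.exp_neg, ← Complex.ofReal_exp]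
    rw [Complex.ofReal_mul, Complex.ofReal_mul]
    field_simp
  have hbot : Tendsto F atBot (𝓝 0) := hf0.comp
    (tendsto_nhdsWithin_iff.2 ⟨Real.tendsto_exp_atBot, Eventually.of_forall fun u => Real.exp_pos u⟩)
  have hFn : ∀ n : ℕ, 0 < n → F (Real.log n) = f n / n := by
    intro n hn
    have : (0 : ℝ) < n := by exact_mod_cast hn
    simp only [hFdef, Real.exp_log this]
    simp
  have hlog : Tendsto (fun n : ℕ => Real.log n) atTop atTop :=
    Real.tendsto_log_atTop.comp tendsto_natCast_atTop_atTop
  by_cases hL : IsLattice p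
  · obtain ⟨r, m, l, hr, hm, hrm, hl, hnum, ha, hb⟩ := hL.exists_span hp0 hp1
    rw [ha, hb] at hF
    have hren := renewal_lattice hp0 hq0 (by ring) hl hδ hC hr hm hrm hF
      (hS.bound_real hθ0) hbot
    set Mf := mellin fun t : ℝ => φ t with hMf
    have hlogp : Real.log p = -(r * l) := by linarith
    have hlc : (l : ℂ) ≠ 0 := by exact_mod_cast hl.ne'
    have hrc : (r : ℂ) ≠ 0 := by exact_mod_cast hr.ne'
    -- Since log p = -r l is negative, χ_k belongs to the frequency -k; hence the reflections of ℤ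
    -- below.
    have hchi : ∀ k : ℤ, chi p k = 2 * Real.pi * ((-k : ℤ) : ℝ) * Complex.I / l := by
      intro k
      rw [chi, hnum, hlogp]
      push_cast
      field_simp
    have hS' := hS.comp_neg_mul hl
    have hsum := hS'.summable_fourier (by positivity) (by positivity)
    have hsumM : Summable fun k : ℤ => Mf (-1 + chi p k) := by
      have := ((Equiv.neg ℤ).summable_iff.2 hsum).mul_left (l : ℂ)
      refine this.congr fun k => ?_
      simp only [Function.comp_apply, Equiv.neg_apply]
      rw [fourier_logPullback φ hl, hchi, mul_inv_cancel_left₀ hlc]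
    have hh : Real.binEntropy p = (p * r + (1 - p) * m) * l := by
      rw [binEntropy_eq_neg_log, ha, hb]; ring
    refine ⟨fun _ => hsumM.norm.comp_injective Subtype.val_injective, ?_⟩
    -- Poisson summation at -u/l. It contributes a factor l⁻¹, and l (pr + qm) = h; the term k = 0
    -- is the constant M[φ; -1] / h.
    have hmain : ∀ u : ℝ, (∑' j : ℤ, logPullback φ ((u + j * l : ℝ) : ℂ))
        / ((p * r + (1 - p) * m : ℝ) : ℂ)
        = Mf (-1) / (Real.binEntropy p : ℂ) + fluctuation p Mf (u / l) := by
      intro u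
      have hpo := hS'.poisson (by positivity) (by positivity) (-u / l)
      have e1 : ∑' j : ℤ, logPullback φ ((u + j * l : ℝ) : ℂ)
          = ∑' n : ℤ, logPullback φ (-(l * ((-u / l + n : ℝ) : ℂ))) := by
        rw [← (Equiv.neg ℤ).tsum_eq]
        refine tsum_congr fun n => ?_
        congr 1
        simp only [Equiv.neg_apply]
        push_cast
        field_simp
        ring
      set g : ℤ → ℂ := fun k => Mf (-1 + chi p k) *
        Complex.exp (2 * (k : ℂ) * (Real.pi : ℂ) * Complex.I * ((u / l : ℝ) : ℂ)) with hg
      have e2 : ∑' n : ℤ, 𝓕 (fun v : ℝ => logPullback φ (-(l * v))) n *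
          fourier n ((-u / l : ℝ) : UnitAddCircle) = (l : ℂ)⁻¹ * ∑' k : ℤ, g k := by
        rw [← tsum_mul_left, ← (Equiv.neg ℤ).tsum_eq]
        refine tsum_congr fun k => ?_
        simp only [Equiv.neg_apply]
        rw [fourier_logPullback φ hl, ← hchi, fourier_coe_apply, hg, mul_assoc]
        congr 3
        push_cast
        ring
      have hsg : Summable g := by
        refine Summable.of_norm (hsumM.norm.congr fun k => ?_)
        rw [hg]
        simp only
        rw [norm_mul]
        have : (2 * (k : ℂ) * (Real.pi : ℂ) * Complex.I * ((u / l : ℝ) : ℂ))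
            = ((2 * k * Real.pi * (u / l) : ℝ) : ℂ) * Complex.I := by push_cast; ring
        rw [this, Complex.norm_exp_ofReal_mul_I, mul_one]
      have hκ : ((p * r + (1 - p) * m : ℝ) : ℂ) ≠ 0 := by
        have : 0 < p * r + (1 - p) * m := by positivity
        exact_mod_cast this.ne'
      rw [e1, hpo, e2, tsum_int_eq_zero_add hsg, fluctuation, if_pos hL, hh]
      have g0 : g 0 = Mf (-1) := by simp [hg, chi]
      rw [g0, Complex.ofReal_mul]
      change _ = _ + _ * ∑' k : {k : ℤ // k ≠ 0}, g k
      field_simp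
    refine (hren.comp hlog).congr' ?_
    filter_upwards [eventually_gt_atTop 0] with n hn
    simp only [Function.comp_apply]
    rw [hFn n hn, hmain]
    congr 4
    rw [hnum, Real.logb, one_div, Real.log_inv, ha]
    push_cast
    field_simp
  · refine ⟨fun h => absurd h hL, ?_⟩
    have hirr : Irrational (-Real.log p / -Real.log (1 - p)) := by
      rw [neg_div_neg_eq]
      rintro ⟨x, hx⟩
      exact hL ⟨x, hx⟩
    obtain ⟨C', hC'⟩ := hS.norm_sub_le hθ0 hδ
    have hb1 : ∀ u : ℝ, ‖logPullback φ u‖ ≤ max C C' * Real.exp (-(δ * |u|)) := fun u =>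
      (hS.bound_real hθ0 u).trans (by gcongr; exact le_max_left _ _)
    have hb2 : ∀ u η : ℝ, 0 ≤ η → η ≤ 1 → ‖logPullback φ ((u + η : ℝ) : ℂ) - logPullback φ u‖
        ≤ max C C' * η * Real.exp (-(δ * |u|)) := fun u η h0 h1 =>
      (hC' u η h0 h1).trans (by gcongr; exact le_max_right _ _)
    have hren := renewal_nonlattice hp0 hq0 (by ring) hlp hlq hδ (le_max_of_le_left hC) hirr hF
      hb1 hb2 (hS.continuous hθ0) hbot
    rw [integral_logPullback, ← binEntropy_eq_neg_log] at hren
    have := (hren.comp hlog).sub_const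
      (mellin (fun t : ℝ => φ t) (-1) / (Real.binEntropy p : ℂ))
    rw [sub_self] at this
    refine this.congr' ?_
    filter_upwards [eventually_gt_atTop 0] with n hn
    simp only [Function.comp_apply]
    rw [hFn n hn, fluctuation, if_neg hL, add_zero]

/-! ### Binomial means -/

/-- The mean `∑_{i+j=n} C(n,i) p^i q^j x_i`. -/
noncomputable def binomialMean (p q : ℝ) (x : ℕ → ℝ) (n : ℕ) : ℝ :=
  ∑ ij ∈ Finset.HasAntidiagonal.antidiagonal n, (n.choose ij.1 : ℝ) * (p ^ ij.1 * q ^ ij.2 * x ij.1)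

/-- Pascal's rule, that is, conditioning on one trial. It makes the increments of a solution satisfy
a recurrence whose weights carry an extra factor p or q. -/
theorem binomialMean_succ (p q : ℝ) (x : ℕ → ℝ) (n : ℕ) :
    binomialMean p q x (n + 1)
      = p * binomialMean p q (fun k => x (k + 1)) n + q * binomialMean p q x n := by
  have := Finset.sum_antidiagonal_choose_succ_mul (R := ℝ) (fun i j => p ^ i * q ^ j * x i) n
  rw [binomialMean, this, binomialMean, binomialMean, Finset.mul_sum, Finset.mul_sum, add_comm]
  congr 1
  · refine Finset.sum_congr rfl fun ij hij => ?_
    rw [Nat.choose_symm_of_eq_add (Finset.HasAntidiagonal.mem_antidiagonal.1 hij).symm]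
    ring
  · refine Finset.sum_congr rfl fun ij _ => ?_
    ring

theorem binomialMean_sub (p q : ℝ) (x y : ℕ → ℝ) (n : ℕ) :
    binomialMean p q (fun k => x k - y k) n = binomialMean p q x n - binomialMean p q y n := by
  simp only [binomialMean, mul_sub, Finset.sum_sub_distrib]

theorem binomialMean_add (p q : ℝ) (x y : ℕ → ℝ) (n : ℕ) :
    binomialMean p q (fun k => x k + y k) n = binomialMean p q x n + binomialMean p q y n := by
  simp only [binomialMean, mul_add, Finset.sum_add_distrib]

theorem binomialMean_const_mul (p q c : ℝ) (x : ℕ → ℝ) (n : ℕ) :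
    binomialMean p q (fun k => c * x k) n = c * binomialMean p q x n := by
  simp only [binomialMean, Finset.mul_sum]
  exact Finset.sum_congr rfl fun _ _ => by ring

theorem binomialMean_mono {p q : ℝ} (hp : 0 ≤ p) (hq : 0 ≤ q) {x y : ℕ → ℝ} {n : ℕ}
    (h : ∀ k ≤ n, x k ≤ y k) : binomialMean p q x n ≤ binomialMean p q y n := by
  refine Finset.sum_le_sum fun ij hij => ?_
  have := h ij.1 (by have := Finset.HasAntidiagonal.mem_antidiagonal.1 hij; omega)
  gcongr

theorem abs_binomialMean_le {p q : ℝ} (hp : 0 ≤ p) (hq : 0 ≤ q) (x : ℕ → ℝ) (n : ℕ) :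
    |binomialMean p q x n| ≤ binomialMean p q (fun k => |x k|) n := by
  refine (Finset.abs_sum_le_sum_abs _ _).trans (Finset.sum_le_sum fun ij _ => ?_)
  rw [abs_mul, abs_mul, abs_of_nonneg (by positivity : (0 : ℝ) ≤ n.choose ij.1),
    abs_of_nonneg (by positivity : 0 ≤ p ^ ij.1 * q ^ ij.2)]

theorem binomialMean_one {p q : ℝ} (hpq : p + q = 1) (n : ℕ) :
    binomialMean p q (fun _ => 1) n = 1 := by
  induction n with
  | zero => simp [binomialMean]
  | succ n ih => rw [binomialMean_succ, ih]; linarith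

theorem binomialMean_id {p q : ℝ} (hpq : p + q = 1) (n : ℕ) :
    binomialMean p q (fun k => (k : ℝ)) n = n * p := by
  induction n with
  | zero => simp [binomialMean]
  | succ n ih =>
    rw [binomialMean_succ]
    simp only [Nat.cast_add, Nat.cast_one]
    rw [binomialMean_add, ih, binomialMean_one hpq]
    linear_combination (n * p) * hpq

theorem binomialMean_indicator_top (p q : ℝ) (n : ℕ) :
    binomialMean p q (fun k => if k = n then 1 else 0) n = p ^ n := by
  rw [binomialMean, Finset.sum_eq_single (n, 0)]
  · simp
  · rintro ⟨i, j⟩ hij hne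
    have : i ≠ n := by
      rintro rfl
      apply hne
      have := Finset.HasAntidiagonal.mem_antidiagonal.1 hij
      simp only [Prod.mk.injEq, true_and]
      simpa using this
    simp [this]
  · intro h
    simp at h

/-- Jensen's inequality for binomial means of powers. -/
theorem binomialMean_rpow_le {p q γ : ℝ} (hp : 0 ≤ p) (hq : 0 ≤ q) (hpq : p + q = 1)
    (hγ0 : 0 ≤ γ) (hγ1 : γ ≤ 1) (n : ℕ) :
    binomialMean p q (fun k => (k : ℝ) ^ γ) n ≤ (n * p) ^ γ := by
  have h := (Real.concaveOn_rpow hγ0 hγ1).le_map_sum (t := Finset.HasAntidiagonal.antidiagonal n)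
    (w := fun ij => (n.choose ij.1 : ℝ) * (p ^ ij.1 * q ^ ij.2)) (p := fun ij => (ij.1 : ℝ))
    (fun _ _ => by positivity)
    (by
      have := binomialMean_one hpq n
      simpa [binomialMean] using this)
    (fun _ _ => by simp)
  simp only [smul_eq_mul] at h
  have h2 := binomialMean_id hpq n
  simp only [binomialMean, ← mul_assoc] at h h2 ⊢
  rwa [h2] at h

/-! ### Increments of the solution of the recurrence -/

/-- If the increments of the tolls are `O(n^γ)`, `0 < γ ≤ 1`, so are those of the solution of
`x_n = ∑ C(n,k) p^k q^{n-k} (x_k + x_{n-k}) + τ_n`. -/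
theorem increment_bound {p q γ C : ℝ} (hp : 0 < p) (hq : 0 < q) (hpq : p + q = 1)
    (hγ0 : 0 < γ) (hγ1 : γ ≤ 1) (hC : 0 ≤ C) {x τ : ℕ → ℝ}
    (hx : ∀ n, x n = binomialMean p q x n + binomialMean q p x n + τ n)
    (hτ : ∀ n, 1 ≤ n → |τ (n + 1) - τ n| ≤ C * (n : ℝ) ^ γ) (h0 : x 0 = 0) (h1 : x 1 = 0) :
    ∃ K, 0 ≤ K ∧ ∀ n, |x (n + 1) - x n| ≤ K * (n : ℝ) ^ γ := by
  -- The contraction factor, less than 1 because γ > 0; the constant K below is the fixed point of K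
  -- ↦ ρ K + C.
  set ρ := p * p ^ γ + q * q ^ γ with hρ
  have hp1 : p < 1 := by linarith
  have hq1 : q < 1 := by linarith
  have e1 : p ^ γ < 1 := Real.rpow_lt_one hp.le hp1 hγ0
  have e2 : q ^ γ < 1 := Real.rpow_lt_one hq.le hq1 hγ0
  have hρ1 : ρ < 1 := by nlinarith
  set K := C / (1 - ρ) with hK
  have hK0 : 0 ≤ K := div_nonneg hC (by linarith)
  have hKC : K * (1 - ρ) = C := div_mul_cancel₀ _ (by linarith)
  set y : ℕ → ℝ := fun n => x (n + 1) - x n with hy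
  have hrec : ∀ n, y n = p * binomialMean p q y n + q * binomialMean q p y n
      + (τ (n + 1) - τ n) := by
    intro n
    have h1 := hx (n + 1)
    have h2 := hx n
    rw [binomialMean_succ, binomialMean_succ] at h1
    have h3 := binomialMean_sub p q (fun k => x (k + 1)) x n
    have h4 := binomialMean_sub q p (fun k => x (k + 1)) x n
    simp only [hy]
    linear_combination h1 - h2 - p * h3 - q * h4 +
      (binomialMean p q x n + binomialMean q p x n) * hpq
  refine ⟨K, hK0, fun n => ?_⟩
  induction n using Nat.strong_induction_on with
  | _ n ih =>
    rcases Nat.eq_zero_or_pos n with rfl | hn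
    · simp [h0, h1, Real.zero_rpow hγ0.ne']
    · by_contra hcon
      push Not at hcon
      change K * (n : ℝ) ^ γ < |y n| at hcon
      -- The increment y n occurs on both sides of its recurrence, on the right with weights p^n and
      -- q^n. An excess e > 0 over the claimed bound would satisfy e ≤ e (p p^n + q q^n) < e.
      set e := |y n| - K * (n : ℝ) ^ γ with he
      have he0 : 0 < e := by linarith
      have hle : ∀ k ≤ n, |y k| ≤ K * (k : ℝ) ^ γ + e * (if k = n then 1 else 0) := by
        intro k hk
        rcases hk.lt_or_eq with hk | rfl
        · simpa [hk.ne] using ih k hk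
        · simp [he]
      have hB : ∀ s t : ℝ, 0 ≤ s → 0 ≤ t → s + t = 1 →
          |binomialMean s t y n| ≤ K * (n * s) ^ γ + e * s ^ n := by
        intro s t hs ht hst
        refine (abs_binomialMean_le hs ht y n).trans ((binomialMean_mono hs ht hle).trans ?_)
        rw [binomialMean_add, binomialMean_const_mul, binomialMean_const_mul,
          binomialMean_indicator_top]
        gcongr
        exact binomialMean_rpow_le hs ht hst hγ0.le hγ1 n
      have b1 := hB p q hp.le hq.le hpq
      have b2 := hB q p hq.le hp.le (by linarith)
      have hn0 : (0 : ℝ) ≤ n := Nat.cast_nonneg n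
      rw [Real.mul_rpow hn0 hp.le] at b1
      rw [Real.mul_rpow hn0 hq.le] at b2
      have b3 := hτ n hn
      have hyn : |y n| ≤ p * |binomialMean p q y n| + q * |binomialMean q p y n|
          + |τ (n + 1) - τ n| := by
        conv_lhs => rw [hrec n]
        refine (abs_add_three _ _ _).trans ?_
        rw [abs_mul, abs_mul, abs_of_pos hp, abs_of_pos hq]
      have hpn : p ^ n ≤ p := pow_le_of_le_one hp.le hp1.le (by omega)
      have hqn : q ^ n ≤ q := pow_le_of_le_one hq.le hq1.le (by omega)
      have hs : p * p ^ n + q * q ^ n < 1 := by nlinarith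
      have b1' := mul_le_mul_of_nonneg_left b1 hp.le
      have b2' := mul_le_mul_of_nonneg_left b2 hq.le
      have hsum : K * (n : ℝ) ^ γ + e ≤ K * (n : ℝ) ^ γ * ρ + e * (p * p ^ n + q * q ^ n)
          + C * (n : ℝ) ^ γ := by
        have : K * (n : ℝ) ^ γ + e = |y n| := by rw [he]; ring
        rw [this, hρ]
        linarith
      rw [← hKC] at hsum
      nlinarith

theorem abs_sub_le_of_increment {γ K : ℝ} (hγ0 : 0 ≤ γ) (hK : 0 ≤ K) {x : ℕ → ℝ}
    (hx : ∀ n, |x (n + 1) - x n| ≤ K * (n : ℝ) ^ γ) {m k : ℕ} (hmk : m ≤ k) :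
    |x k - x m| ≤ K * (k : ℝ) ^ γ * (k - m) := by
  induction k, hmk using Nat.le_induction with
  | base => simp
  | succ k hk ih =>
    have h1 : |x (k + 1) - x m| ≤ |x (k + 1) - x k| + |x k - x m| := abs_sub_le _ _ _
    have h2 : (k : ℝ) ^ γ ≤ ((k + 1 : ℕ) : ℝ) ^ γ := by
      gcongr; omega
    have h3 : (m : ℝ) ≤ k := by exact_mod_cast hk
    have h4 : K * (k : ℝ) ^ γ ≤ K * ((k + 1 : ℕ) : ℝ) ^ γ := by gcongr
    have h5 := mul_le_mul_of_nonneg_right h4 (sub_nonneg.2 h3)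
    have h6 := hx k
    push_cast at *
    linarith

/-- For k ≥ n the increments up to k are at most K k^γ, and γ ≤ 1 gives k^γ ≤ n^γ (1 + (k - n)/n).
The resulting quadratic term has Poisson mean 1 by the variance formula, so it does no harm. -/
theorem abs_sub_le_quadratic {γ K : ℝ} (hγ0 : 0 ≤ γ) (hγ1 : γ ≤ 1) (hK : 0 ≤ K) {x : ℕ → ℝ}
    (hx : ∀ n, |x (n + 1) - x n| ≤ K * (n : ℝ) ^ γ) {n : ℕ} (hn : 0 < n) (k : ℕ) :
    |x k - x n| ≤ K * (n : ℝ) ^ γ * (|(k : ℝ) - n| + (k - n) ^ 2 / n) := by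
  have hn' : (0 : ℝ) < n := by exact_mod_cast hn
  rcases le_total n k with h | h
  · have h' : (n : ℝ) ≤ k := by exact_mod_cast h
    refine (abs_sub_le_of_increment hγ0 hK hx h).trans ?_
    have h1 : (k : ℝ) ^ γ ≤ (n : ℝ) ^ γ * (k / n) := by
      have h2 : (k : ℝ) = n * (k / n) := by field_simp
      have h3 : 1 ≤ (k : ℝ) / n := by rwa [one_le_div hn']
      conv_lhs => rw [h2, Real.mul_rpow hn'.le (by positivity)]
      gcongr
      calc ((k : ℝ) / n) ^ γ ≤ ((k : ℝ) / n) ^ (1 : ℝ) := Real.rpow_le_rpow_of_exponent_le h3 hγ1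
        _ = _ := Real.rpow_one _
    rw [abs_of_nonneg (by linarith)]
    have h4 : (k : ℝ) / n = 1 + (k - n) / n := by field_simp; ring
    rw [h4] at h1
    calc K * (k : ℝ) ^ γ * (k - n) ≤ K * ((n : ℝ) ^ γ * (1 + (k - n) / n)) * (k - n) := by
          gcongr
      _ = _ := by ring
  · have h' : (k : ℝ) ≤ n := by exact_mod_cast h
    rw [abs_sub_comm]
    refine (abs_sub_le_of_increment hγ0 hK hx h).trans ?_
    rw [abs_sub_comm, abs_of_nonneg (by linarith)]
    have : 0 ≤ ((k : ℝ) - n) ^ 2 / n := by positivity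
    gcongr
    linarith

/-! ### Poisson means -/

theorem hasSum_pow_div_factorial (t : ℝ) :
    HasSum (fun k : ℕ => t ^ k / (k.factorial : ℝ)) (Real.exp t) := by
  rw [Real.exp_eq_exp_ℝ]
  exact NormedSpace.expSeries_div_hasSum_exp t

theorem hasSum_poisson_first (t : ℝ) :
    HasSum (fun k : ℕ => (k : ℝ) * (t ^ k / (k.factorial : ℝ))) (t * Real.exp t) := by
  rw [← hasSum_nat_add_iff' 1]
  simp only [Finset.range_one, Finset.sum_singleton, Nat.cast_zero, zero_mul, sub_zero]
  refine ((hasSum_pow_div_factorial t).mul_left t).congr_fun fun k => ?_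
  rw [Nat.factorial_succ]
  push_cast
  field_simp
  ring

theorem hasSum_poisson_second (t : ℝ) :
    HasSum (fun k : ℕ => (k : ℝ) * (k - 1) * (t ^ k / (k.factorial : ℝ)))
      (t ^ 2 * Real.exp t) := by
  rw [← hasSum_nat_add_iff' 1]
  simp only [Finset.range_one, Finset.sum_singleton, Nat.cast_zero, zero_mul, sub_zero]
  have := (hasSum_poisson_first t).mul_left t
  rw [← mul_assoc, ← sq] at this
  refine this.congr_fun fun k => ?_
  rw [Nat.factorial_succ]
  push_cast
  field_simp
  ring

theorem hasSum_poisson_variance (t : ℝ) :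
    HasSum (fun k : ℕ => ((k : ℝ) - t) ^ 2 * (t ^ k / (k.factorial : ℝ)))
      (t * Real.exp t) := by
  have := ((hasSum_poisson_second t).add (((hasSum_poisson_first t).mul_left (1 - 2 * t)))).add
    ((hasSum_pow_div_factorial t).mul_left (t ^ 2))
  convert this using 1
  · ext k; ring
  · ring

/-- The exponential generating function `∑ x_k t^k / k!`. -/
noncomputable def expGF (x : ℕ → ℝ) (t : ℝ) : ℝ := ∑' k : ℕ, x k * (t ^ k / (k.factorial : ℝ))

theorem summable_expGF {K : ℝ} {x : ℕ → ℝ} (hx : ∀ k : ℕ, |x k| ≤ K * (k * (k - 1))) (t : ℝ) :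
    Summable fun k : ℕ => x k * (t ^ k / (k.factorial : ℝ)) := by
  refine Summable.of_norm_bounded ((hasSum_poisson_second |t|).summable.mul_left K) fun k => ?_
  rw [Real.norm_eq_abs, abs_mul, abs_div, abs_pow, Nat.abs_cast]
  have := hx k
  calc |x k| * (|t| ^ k / (k.factorial : ℝ)) ≤ K * (k * (k - 1)) * (|t| ^ k / k.factorial) := by
        gcongr
    _ = _ := by ring

theorem abs_expGF_le {K : ℝ} {x : ℕ → ℝ} (hx : ∀ k : ℕ, |x k| ≤ K * (k * (k - 1))) {t : ℝ}
    (ht : 0 ≤ t) : |expGF x t| ≤ K * t ^ 2 * Real.exp t := by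
  have h := (hasSum_poisson_second t).mul_left K
  rw [← mul_assoc] at h
  rw [expGF, ← Real.norm_eq_abs]
  refine tsum_of_norm_bounded h fun k => ?_
  rw [Real.norm_eq_abs, abs_mul, abs_of_nonneg (by positivity : 0 ≤ t ^ k / (k.factorial : ℝ))]
  have := hx k
  calc |x k| * (t ^ k / (k.factorial : ℝ)) ≤ K * (k * (k - 1)) * (t ^ k / k.factorial) := by
        gcongr
    _ = _ := by ring

/-- Depoissonization of a sequence with increments `O(n^γ)`. -/
theorem depoissonization {γ K K' : ℝ} (hγ0 : 0 ≤ γ) (hγ1 : γ ≤ 1) (hK : 0 ≤ K) {x : ℕ → ℝ}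
    (hx : ∀ n, |x (n + 1) - x n| ≤ K * (n : ℝ) ^ γ)
    (hx' : ∀ k : ℕ, |x k| ≤ K' * (k * (k - 1))) {n : ℕ} (hn : 0 < n) :
    |Real.exp (-n) * expGF x n - x n| ≤ K * (n : ℝ) ^ γ * (√n + 1) := by
  have hn' : (0 : ℝ) < n := by exact_mod_cast hn
  have hs : 0 < √(n : ℝ) := Real.sqrt_pos.2 hn'
  have hss : √(n : ℝ) * √n = n := Real.mul_self_sqrt hn'.le
  have h1 := (summable_expGF hx' n).hasSum.sub ((hasSum_pow_div_factorial n).mul_left (x n))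
  -- The majorant comes from |k - n| ≤ √n/2 + (k - n)²/(2√n), which replaces Cauchy–Schwarz and
  -- leaves only the Poisson variance n to be summed.
  have h2 := (((hasSum_pow_div_factorial (n : ℝ)).mul_left (√n / 2)).add
    ((hasSum_poisson_variance (n : ℝ)).mul_left (1 / (2 * √n) + 1 / n))).mul_left (K * (n : ℝ) ^ γ)
  have h3 := h1.norm_le_of_bounded h2 fun k => ?_
  · have e : Real.exp (-n) * expGF x n - x n
        = Real.exp (-n) * ((∑' k : ℕ, x k * ((n : ℝ) ^ k / (k.factorial : ℝ)))
          - x n * Real.exp n) := by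
      rw [mul_sub, expGF, mul_left_comm, ← Real.exp_add, neg_add_cancel, Real.exp_zero, mul_one]
    rw [e, abs_mul, abs_of_pos (Real.exp_pos _)]
    rw [Real.norm_eq_abs] at h3
    have hexp : Real.exp (-(n : ℝ)) * Real.exp n = 1 := by
      rw [← Real.exp_add, neg_add_cancel, Real.exp_zero]
    refine (mul_le_mul_of_nonneg_left h3 (Real.exp_pos _).le).trans (le_of_eq ?_)
    have e1 : (1 / (2 * √(n : ℝ)) + 1 / n) * (n * Real.exp n)
        = (√n / 2 + 1) * Real.exp n := by
      have : (n : ℝ) / √n = √n := by rw [div_eq_iff hs.ne', hss]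
      calc _ = ((n : ℝ) / √n / 2 + n / n) * Real.exp n := by ring
        _ = _ := by rw [this, div_self hn'.ne']
    rw [e1]
    linear_combination (K * (n : ℝ) ^ γ * (√n + 1)) * hexp
  · rw [← sub_mul, Real.norm_eq_abs, abs_mul,
      abs_of_nonneg (by positivity : 0 ≤ (n : ℝ) ^ k / (k.factorial : ℝ))]
    have h4 := abs_sub_le_quadratic hγ0 hγ1 hK hx hn k
    have h5 : |(k : ℝ) - n| ≤ √n / 2 + 1 / (2 * √n) * (k - n) ^ 2 := by
      have h6 := sq_nonneg (|(k : ℝ) - n| - √n)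
      have h7 : (|(k : ℝ) - n|) ^ 2 = (k - n) ^ 2 := sq_abs _
      rw [show √(n : ℝ) / 2 + 1 / (2 * √n) * ((k : ℝ) - n) ^ 2
        = (√n * √n + (k - n) ^ 2) / (2 * √n) by field_simp, le_div_iff₀ (by positivity)]
      nlinarith
    calc |x k - x n| * ((n : ℝ) ^ k / (k.factorial : ℝ))
        ≤ K * (n : ℝ) ^ γ * ((√n / 2 + 1 / (2 * √n) * (k - n) ^ 2) + (k - n) ^ 2 / n)
          * ((n : ℝ) ^ k / (k.factorial : ℝ)) := by
          refine mul_le_mul_of_nonneg_right (h4.trans ?_) (by positivity)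
          gcongr
      _ = _ := by ring

/-- Poisson thinning: binomial means are the coefficients of the Cauchy product of the generating
function at pt with e^(qt). -/
theorem hasSum_binomialMean {K : ℝ} (p q : ℝ) {x : ℕ → ℝ}
    (hx : ∀ k : ℕ, |x k| ≤ K * (k * (k - 1))) (t : ℝ) :
    HasSum (fun n : ℕ => binomialMean p q x n * (t ^ n / (n.factorial : ℝ)))
      (expGF x (p * t) * Real.exp (q * t)) := by
  have h1 := (summable_expGF hx (p * t)).norm
  have h2 := (hasSum_pow_div_factorial (q * t)).summable.norm
  have h3 := (summable_norm_sum_mul_antidiagonal_of_summable_norm h1 h2).of_norm.hasSum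
  rw [← tsum_mul_tsum_eq_tsum_sum_antidiagonal_of_summable_norm h1 h2,
    (hasSum_pow_div_factorial (q * t)).tsum_eq] at h3
  refine h3.congr_fun fun n => ?_
  rw [binomialMean, Finset.sum_mul]
  refine Finset.sum_congr rfl fun ij hij => ?_
  obtain ⟨i, j⟩ := ij
  have hn := Finset.HasAntidiagonal.mem_antidiagonal.1 hij
  simp only at hn ⊢
  subst hn
  have hc : ((i + j).choose i : ℝ) * i.factorial * j.factorial = (i + j).factorial := by
    rw [Nat.choose_symm_add]
    exact_mod_cast Nat.add_choose_mul_factorial_mul_factorial i j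
  have hi : (i.factorial : ℝ) ≠ 0 := by positivity
  have hj : (j.factorial : ℝ) ≠ 0 := by positivity
  have hij' : ((i + j).factorial : ℝ) ≠ 0 := by positivity
  field_simp
  rw [← hc]
  ring

/-- Poissonization turns the recurrence into a functional equation. -/
theorem poisson_functional_equation {p K : ℝ} {x a : ℕ → ℝ} {g : ℂ → ℂ}
    (hx : ∀ n, x n = binomialMean p (1 - p) x n + binomialMean (1 - p) p x n
      + (1 - p ^ n - (1 - p) ^ n) * a n)
    (hxb : ∀ k : ℕ, |x k| ≤ K * (k * (k - 1))) (hg : IsPoissonGF a g) (t : ℝ) :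
    ((Real.exp (-t) * expGF x t : ℝ) : ℂ)
      = ((Real.exp (-(p * t)) * expGF x (p * t) : ℝ) : ℂ)
        + ((Real.exp (-((1 - p) * t)) * expGF x ((1 - p) * t) : ℝ) : ℂ) + patriciaToll p g t := by
  have h1 := Complex.hasSum_ofReal.2 (summable_expGF hxb t).hasSum
  have h2 := Complex.hasSum_ofReal.2 (hasSum_binomialMean p (1 - p) hxb t)
  have h3 := Complex.hasSum_ofReal.2 (hasSum_binomialMean (1 - p) p hxb t)
  -- The factor 1 - p^n - q^n in front of a_n dilates the argument; after multiplication by e^(-t)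
  -- the three terms are those of `patriciaToll`.
  have h4 := (((hg t).sub (hg ((p : ℂ) * t))).sub (hg (((1 - p : ℝ) : ℂ) * t)))
  have h5 := ((h2.add h3).add h4).congr_fun (g := fun n : ℕ =>
      ((x n * (t ^ n / (n.factorial : ℝ)) : ℝ) : ℂ)) fun n => by
    conv_lhs => rw [hx n]
    push_cast
    rw [mul_pow, mul_pow]
    ring
  have h6 := h1.unique h5
  change ((expGF x t : ℝ) : ℂ) = _ at h6
  rw [Complex.ofReal_mul, h6, patriciaToll]
  have e1 : Complex.exp (-(t : ℂ)) * Complex.exp t = 1 := by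
    rw [← Complex.exp_add, neg_add_cancel, Complex.exp_zero]
  have e2 : Complex.exp (-(t : ℂ)) * Complex.exp (((1 - p : ℝ) : ℂ) * t)
      = Complex.exp (-((p : ℂ) * t)) := by
    rw [← Complex.exp_add]; congr 1; push_cast; ring
  have e3 : Complex.exp (-(t : ℂ)) * Complex.exp ((p : ℂ) * t)
      = Complex.exp (-(((1 - p : ℝ) : ℂ) * t)) := by
    rw [← Complex.exp_add]; congr 1; push_cast; ring
  simp only [Complex.ofReal_mul, Complex.ofReal_exp, Complex.ofReal_neg, neg_mul]
  linear_combination (expGF x (p * t) : ℂ) * e2 + (expGF x ((1 - p) * t) : ℂ) * e3 + g t * e1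
    - g (p * t) * e3 - g (((1 - p : ℝ) : ℂ) * t) * e2

theorem exists_bound_sq_mul_pow {p : ℝ} (hp0 : 0 ≤ p) (hp1 : p < 1) :
    ∃ B, 0 ≤ B ∧ ∀ n : ℕ, (n : ℝ) ^ 2 * p ^ n ≤ B := by
  obtain ⟨B, hB⟩ := (tendsto_pow_const_mul_const_pow_of_abs_lt_one 2
    (by rwa [abs_of_nonneg hp0])).bddAbove_range
  exact ⟨max B 0, le_max_right _ _, fun n => (hB ⟨n, rfl⟩).trans (le_max_left _ _)⟩

/-- The form k (k - 1) vanishes at k = 0 and 1, so the Poisson transform is O(t²) at 0. This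
provides the condition at -∞ in the renewal equation. -/
theorem abs_le_of_increment {γ K : ℝ} (hγ0 : 0 ≤ γ) (hγ1 : γ ≤ 1) (hK : 0 ≤ K) {x : ℕ → ℝ}
    (hx : ∀ n, |x (n + 1) - x n| ≤ K * (n : ℝ) ^ γ) (h0 : x 0 = 0) (h1 : x 1 = 0) (k : ℕ) :
    |x k| ≤ K * (k * (k - 1)) := by
  rcases Nat.eq_zero_or_pos k with rfl | hk
  · simp [h0]
  · have h := abs_sub_le_of_increment hγ0 hK hx (m := 1) (k := k) hk
    have hk' : (1 : ℝ) ≤ k := by exact_mod_cast hk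
    have h2 : (k : ℝ) ^ γ ≤ k := by
      calc (k : ℝ) ^ γ ≤ (k : ℝ) ^ (1 : ℝ) := Real.rpow_le_rpow_of_exponent_le hk' hγ1
        _ = _ := Real.rpow_one _
    rw [h1, sub_zero, Nat.cast_one] at h
    refine h.trans ?_
    rw [← mul_assoc]
    have : (0 : ℝ) ≤ k - 1 := by linarith
    gcongr

/-- The increments of the tolls `(1 - p^n - q^n) a_n` are `O(n^γ)` if those of `a` are. -/
theorem toll_increment_bound {p γ C : ℝ} (hp0 : 0 < p) (hp1 : p < 1) (hγ0 : 0 ≤ γ) (hγ1 : γ ≤ 1)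
    (hC : 0 ≤ C) {a : ℕ → ℝ} (ha : ∀ n, |a (n + 1) - a n| ≤ C * (n : ℝ) ^ γ)
    (h0 : a 0 = 0) (h1 : a 1 = 0) :
    ∃ C', 0 ≤ C' ∧ ∀ n : ℕ, 1 ≤ n →
      |(1 - p ^ (n + 1) - (1 - p) ^ (n + 1)) * a (n + 1) - (1 - p ^ n - (1 - p) ^ n) * a n|
        ≤ C' * (n : ℝ) ^ γ := by
  have hq0 : 0 < 1 - p := by linarith
  have hq1 : 1 - p < 1 := by linarith
  obtain ⟨B₁, hB₁0, hB₁⟩ := exists_bound_sq_mul_pow hp0.le hp1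
  obtain ⟨B₂, hB₂0, hB₂⟩ := exists_bound_sq_mul_pow hq0.le hq1
  refine ⟨C + C * (B₁ + B₂), by positivity, fun n hn => ?_⟩
  have hn' : (1 : ℝ) ≤ n := by exact_mod_cast hn
  have hnγ : (1 : ℝ) ≤ (n : ℝ) ^ γ := Real.one_le_rpow hn' hγ0
  have ha' : |a n| ≤ C * (n : ℝ) ^ 2 := by
    refine (abs_le_of_increment hγ0 hγ1 hC ha h0 h1 n).trans ?_
    gcongr
    nlinarith
  have hp := pow_le_one₀ (n := n) hp0.le hp1.le
  have hq := pow_le_one₀ (n := n) hq0.le hq1.le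
  have hpn := pow_pos hp0 n
  have hqn := pow_pos hq0 n
  have hpq : 0 ≤ 1 - p ^ (n + 1) - (1 - p) ^ (n + 1) := by
    rw [pow_succ, pow_succ]; nlinarith
  have hpq' : 1 - p ^ (n + 1) - (1 - p) ^ (n + 1) ≤ 1 := by
    have := pow_pos hp0 (n + 1)
    have := pow_pos hq0 (n + 1)
    linarith
  -- Discrete product rule; the second term is exponentially small, as |a n| grows at most
  -- quadratically.
  have e : (1 - p ^ (n + 1) - (1 - p) ^ (n + 1)) * a (n + 1) - (1 - p ^ n - (1 - p) ^ n) * a n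
      = (1 - p ^ (n + 1) - (1 - p) ^ (n + 1)) * (a (n + 1) - a n)
        + (p ^ n * (1 - p) + (1 - p) ^ n * p) * a n := by
    rw [pow_succ, pow_succ]; ring
  rw [e]
  refine (abs_add_le _ _).trans ?_
  rw [abs_mul, abs_mul, abs_of_nonneg hpq,
    abs_of_nonneg (by positivity : 0 ≤ p ^ n * (1 - p) + (1 - p) ^ n * p)]
  have t1 : (1 - p ^ (n + 1) - (1 - p) ^ (n + 1)) * |a (n + 1) - a n| ≤ 1 * (C * (n : ℝ) ^ γ) :=
    mul_le_mul hpq' (ha n) (abs_nonneg _) zero_le_one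
  have t2 : (p ^ n * (1 - p) + (1 - p) ^ n * p) * |a n|
      ≤ (p ^ n + (1 - p) ^ n) * (C * (n : ℝ) ^ 2) := by
    refine mul_le_mul ?_ ha' (abs_nonneg _) (by positivity)
    nlinarith
  have t3 : (p ^ n + (1 - p) ^ n) * (C * (n : ℝ) ^ 2) ≤ C * (B₁ + B₂) := by
    have := mul_le_mul_of_nonneg_left (add_le_add (hB₁ n) (hB₂ n)) hC
    linarith
  have t4 : C * (B₁ + B₂) ≤ C * (B₁ + B₂) * (n : ℝ) ^ γ :=
    le_mul_of_one_le_right (by positivity) hnγ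
  linarith

/-! ### Coefficient estimates on circles -/

/-- Cauchy's formula on |z| = n for two consecutive coefficients combines into the integrand F(z) (n
+ 1 - z) / z^(n+2). The factor n + 1 - z is small near the positive axis, where e^z concentrates,
and this gains √n over estimating the coefficients separately. -/
theorem coeff_increment_le_integral {F : ℂ → ℂ} {a : ℕ → ℂ}
    (hF : ∀ z, HasSum (fun n => a n * z ^ n) (F z)) (hd : Differentiable ℂ F) {n : ℕ}
    (hn : 0 < n) :
    ‖((n : ℂ) + 1) * a (n + 1) - a n‖ ≤ (2 * Real.pi)⁻¹ * ((n : ℝ) ^ (n + 1))⁻¹ *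
      ∫ φ in (-Real.pi)..Real.pi, ‖F (circleMap 0 n φ)‖ * ‖(n : ℂ) + 1 - circleMap 0 n φ‖ := by
  have hn' : (0 : ℝ) < n := by exact_mod_cast hn
  have hps : HasFPowerSeriesAt F (FormalMultilinearSeries.ofScalars ℂ a) 0 := by
    rw [hasFPowerSeriesAt_iff]
    refine Eventually.of_forall fun z => ?_
    rw [zero_add]
    refine (hF z).congr_fun fun k => ?_
    rw [FormalMultilinearSeries.coeff_ofScalars, smul_eq_mul, mul_comm]
  have hcs := (hd.hasFPowerSeriesOnBall 0 (R := (n : NNReal))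
    (by exact_mod_cast hn)).hasFPowerSeriesAt
  have heq := hps.eq_formalMultilinearSeries hcs
  have hcoeff : ∀ k, a k = (2 * Real.pi * Complex.I : ℂ)⁻¹ •
      ∮ z in C(0, (n : ℝ)), (1 / z) ^ k • z⁻¹ • F z := by
    intro k
    have h1 := congrFun heq k
    have h2 := congrArg (fun m => m fun _ => (1 : ℂ)) h1
    simp only [cauchyPowerSeries_apply, sub_zero, FormalMultilinearSeries.ofScalars_apply_eq,
      one_pow, smul_eq_mul, mul_one] at h2
    simpa using h2
  have hci : ∀ k, CircleIntegrable (fun z => (1 / z) ^ k • z⁻¹ • F z) 0 (n : ℝ) := by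
    intro k
    refine ContinuousOn.circleIntegrable hn'.le ?_
    have h0 : ∀ z ∈ Metric.sphere (0 : ℂ) n, z ≠ 0 := fun z hz => by
      rintro rfl
      simp at hz
      linarith
    exact ((continuousOn_const.div continuousOn_id h0).pow k).smul
      ((continuousOn_id.inv₀ h0).smul hd.continuous.continuousOn)
  have hint : ((n : ℂ) + 1) * a (n + 1) - a n = (2 * Real.pi * Complex.I : ℂ)⁻¹ •
      ∮ z in C(0, (n : ℝ)), (((n : ℂ) + 1) • ((1 / z) ^ (n + 1) • z⁻¹ • F z)
        - (1 / z) ^ n • z⁻¹ • F z) := by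
    have hci' : CircleIntegrable (fun z => ((n : ℂ) + 1) • ((1 / z) ^ (n + 1) • z⁻¹ • F z))
        0 (n : ℝ) := (hci (n + 1)).const_smul
    rw [circleIntegral.integral_sub hci' (hci n), circleIntegral.integral_smul, hcoeff (n + 1),
      hcoeff n]
    simp only [smul_eq_mul]
    ring
  rw [hint, norm_smul, norm_inv]
  have h2pi : ‖(2 * Real.pi * Complex.I : ℂ)‖ = 2 * Real.pi := by
    simp [abs_of_pos Real.pi_pos]
  rw [h2pi, mul_assoc]
  refine mul_le_mul_of_nonneg_left ?_ (by positivity)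
  rw [circleIntegral]
  refine (intervalIntegral.norm_integral_le_integral_norm (by positivity)).trans ?_
  rw [← intervalIntegral.integral_const_mul]
  set w : ℝ → ℝ := fun φ => ((n : ℝ) ^ (n + 1))⁻¹ *
    (‖F (circleMap 0 n φ)‖ * ‖(n : ℂ) + 1 - circleMap 0 n φ‖) with hw
  -- Moves the parameter from [0, 2π] to [-π, π], where it agrees with the principal argument.
  have hper : Function.Periodic w (2 * Real.pi) := fun φ => by
    simp only [hw, periodic_circleMap 0 (n : ℝ) φ]
  have hshift := hper.intervalIntegral_add_eq 0 (-Real.pi)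
  rw [zero_add, show -Real.pi + 2 * Real.pi = Real.pi by ring] at hshift
  rw [← hshift]
  refine le_of_eq (intervalIntegral.integral_congr fun φ _ => ?_)
  simp only [hw, deriv_circleMap]
  set z := circleMap 0 (n : ℝ) φ with hz
  have hzn : ‖z‖ = n := by simp [hz]
  have hz0 : z ≠ 0 := fun h => by rw [h, norm_zero] at hzn; linarith
  have e : z * Complex.I * ((((n : ℂ) + 1) * ((1 / z) ^ (n + 1) * (z⁻¹ * F z))
      - (1 / z) ^ n * (z⁻¹ * F z))) = Complex.I * (z⁻¹ ^ (n + 1) * (F z * ((n : ℂ) + 1 - z))) := by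
    rw [one_div, pow_succ]
    field_simp
  simp only [smul_eq_mul]
  rw [e]
  simp only [norm_mul, norm_pow, norm_inv, Complex.norm_I, one_mul, hzn, inv_pow]

theorem factorial_le_stirling {n : ℕ} (hn : 0 < n) :
    (n.factorial : ℝ) ≤ Real.exp 1 * √n * ((n : ℝ) / Real.exp 1) ^ n := by
  obtain ⟨m, rfl⟩ : ∃ m, n = m + 1 := ⟨n - 1, by omega⟩
  have h : Stirling.stirlingSeq (m + 1) ≤ Stirling.stirlingSeq 1 :=
    Stirling.stirlingSeq'_antitone (Nat.zero_le m)
  rw [Stirling.stirlingSeq_one, Stirling.stirlingSeq, div_le_iff₀ (by positivity)] at h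
  refine h.trans (le_of_eq ?_)
  have h2 : √(2 * ((m + 1 : ℕ) : ℝ)) = √2 * √((m + 1 : ℕ) : ℝ) := Real.sqrt_mul (by norm_num) _
  rw [h2]
  have : √(2 : ℝ) ≠ 0 := by positivity
  field_simp

/-- Bound for the factor `1 + n |φ|` against a Gaussian. -/
theorem one_add_mul_abs_le_gaussian {n : ℝ} (hn : 1 ≤ n) (φ : ℝ) :
    1 + n * |φ| ≤ (1 + Real.pi) * √n * Real.exp (n * φ ^ 2 / Real.pi ^ 2) := by
  have hpi := Real.pi_pos
  have hs1 : 1 ≤ √n := Real.one_le_sqrt.2 hn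
  have hss : √n * √n = n := Real.mul_self_sqrt (by linarith)
  set u := √n * |φ| / Real.pi with hu
  have hu2 : u ^ 2 = n * φ ^ 2 / Real.pi ^ 2 := by
    rw [hu, div_pow, mul_pow, sq_abs, Real.sq_sqrt (by linarith)]
  have h1 : u ^ 2 + 1 ≤ Real.exp (u ^ 2) := Real.add_one_le_exp _
  have h2 : n * |φ| = Real.pi * √n * u := by
    rw [hu]; field_simp; rw [sq, hss, mul_comm]
  rw [← hu2, h2]
  have h3 : u ≤ Real.exp (u ^ 2) := by nlinarith [sq_nonneg (u - 1)]
  have h4 : 1 ≤ Real.exp (u ^ 2) := Real.one_le_exp (sq_nonneg u)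
  have h5 : Real.pi * √n * u ≤ Real.pi * √n * Real.exp (u ^ 2) := by gcongr
  have h6 : 1 * 1 ≤ √n * Real.exp (u ^ 2) := by gcongr
  linarith

theorem integral_gaussian_circle_le {n : ℝ} (hn : 0 < n) :
    ∫ φ in (-Real.pi)..Real.pi, Real.exp (-(n / Real.pi ^ 2) * φ ^ 2)
      ≤ Real.pi * √Real.pi / √n := by
  have hb : 0 < n / Real.pi ^ 2 := by positivity
  rw [intervalIntegral.integral_of_le (by linarith [Real.pi_pos])]
  refine (setIntegral_le_integral (integrable_exp_neg_mul_sq hb)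
    (ae_of_all _ fun _ => (Real.exp_pos _).le)).trans (le_of_eq ?_)
  rw [integral_gaussian]
  rw [show Real.pi / (n / Real.pi ^ 2) = Real.pi ^ 2 * Real.pi / n by field_simp,
    Real.sqrt_div (by positivity), Real.sqrt_mul (by positivity), Real.sqrt_sq Real.pi_pos.le]

theorem abs_arg_circleMap {r φ : ℝ} (hr : 0 < r) (h1 : -Real.pi < φ) (h2 : φ ≤ Real.pi) :
    (circleMap 0 r φ).arg = φ := by
  rw [circleMap_zero, Complex.arg_real_mul _ hr, Complex.arg_exp_mul_I, toIocMod_eq_self]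
  constructor <;> linarith

theorem norm_one_add_sub_circleMap_le {n : ℝ} (hn : 0 ≤ n) (φ : ℝ) :
    ‖(n : ℂ) + 1 - circleMap 0 n φ‖ ≤ 1 + n * |φ| := by
  have h1 := Real.norm_exp_I_mul_ofReal_sub_one_le (x := φ)
  have e : (n : ℂ) + 1 - circleMap 0 n φ = 1 - n * (Complex.exp (Complex.I * φ) - 1) := by
    rw [circleMap_zero, mul_comm Complex.I]; ring
  rw [e]
  refine (norm_sub_le _ _).trans ?_
  rw [norm_one, norm_mul, Complex.norm_real, Real.norm_of_nonneg hn]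
  gcongr
  exact h1

/-- Increments of a sequence whose Poisson generating function is `O(|z|^b)` in a sector and
exponentially small outside are `O(n^{b-1/2})`. -/
theorem increment_bound_of_poissonGF {s : ℕ → ℝ} {g : ℂ → ℂ} {θ b ε C₁ C₂ : ℝ} (hb : 0 ≤ b)
    (hε : 0 < ε) (hC₁ : 0 ≤ C₁) (hC₂ : 0 ≤ C₂) (hg : IsPoissonGF s g) (hd : Differentiable ℂ g)
    (hin : ∀ z : ℂ, 1 ≤ ‖z‖ → |z.arg| ≤ θ → ‖g z‖ ≤ C₁ * ‖z‖ ^ b)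
    (hout : ∀ z : ℂ, 1 ≤ ‖z‖ → θ ≤ |z.arg| →
      ‖Complex.exp z * g z‖ ≤ C₂ * Real.exp ((1 - ε) * ‖z‖)) :
    ∃ C, 0 ≤ C ∧ ∀ n : ℕ, 1 ≤ n → |s (n + 1) - s n| ≤ C * (n : ℝ) ^ (b - 1 / 2) := by
  have hpi := Real.pi_pos
  set D₁ := C₁ * (1 + Real.pi) * (Real.pi * √Real.pi) with hD₁
  set D₂ := 2 * Real.pi * (3 * C₂ / ε) with hD₂
  have hD₁0 : 0 ≤ D₁ := by positivity
  have hD₂0 : 0 ≤ D₂ := by positivity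
  refine ⟨Real.exp 1 * ((2 * Real.pi)⁻¹ * (D₁ + D₂)), by positivity, fun n hn => ?_⟩
  have hn1 : (1 : ℝ) ≤ n := by exact_mod_cast hn
  have hn0 : (0 : ℝ) < n := by linarith
  have hsq : 0 < √(n : ℝ) := Real.sqrt_pos.2 hn0
  have hnb : 1 ≤ (n : ℝ) ^ b := Real.one_le_rpow hn1 hb
  have hfac : ((n.factorial : ℕ) : ℂ) ≠ 0 := by exact_mod_cast n.factorial_ne_zero
  have h1 := coeff_increment_le_integral (F := fun z => Complex.exp z * g z)
    (a := fun k => (s k : ℂ) / (k.factorial : ℂ))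
    (fun z => (hg z).congr_fun fun k => by ring) (Complex.differentiable_exp.mul hd) hn
  have e1 : ((n : ℂ) + 1) * ((s (n + 1) : ℂ) / ((n + 1).factorial : ℂ))
      - (s n : ℂ) / (n.factorial : ℂ) = ((s (n + 1) - s n : ℝ) : ℂ) / (n.factorial : ℂ) := by
    have : ((n : ℂ) + 1) ≠ 0 := by exact_mod_cast n.succ_ne_zero
    rw [Nat.factorial_succ]
    push_cast
    field_simp
  rw [e1, norm_div, Complex.norm_real, Complex.norm_natCast, div_le_iff₀ (by positivity),
    Real.norm_eq_abs] at h1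
  set A := C₁ * (n : ℝ) ^ b * ((1 + Real.pi) * √n) * Real.exp n with hA
  set B := C₂ * Real.exp ((1 - ε) * n) * (3 * n) with hB
  have hA0 : 0 ≤ A := by positivity
  have hB0 : 0 ≤ B := by positivity
  have hpt : ∀ φ, -Real.pi < φ → φ ≤ Real.pi →
      ‖Complex.exp (circleMap 0 n φ) * g (circleMap 0 n φ)‖ * ‖(n : ℂ) + 1 - circleMap 0 n φ‖
        ≤ A * Real.exp (-((n : ℝ) / Real.pi ^ 2) * φ ^ 2) + B := by
    intro φ hφ1 hφ2
    have harg := abs_arg_circleMap hn0 hφ1 hφ2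
    have hnorm : ‖circleMap 0 (n : ℝ) φ‖ = n := by simp
    have hle : ‖(n : ℂ) + 1 - circleMap 0 (n : ℝ) φ‖ ≤ 1 + n * |φ| := by
      exact_mod_cast norm_one_add_sub_circleMap_le hn0.le φ
    have habs : |φ| ≤ Real.pi := abs_le.2 ⟨hφ1.le, hφ2⟩
    rcases le_total |φ| θ with h | h
    · have hg1 := hin (circleMap 0 n φ) (by rw [hnorm]; exact hn1) (by rw [harg]; exact h)
      rw [hnorm] at hg1
      have hre : (circleMap 0 (n : ℝ) φ).re = n * Real.cos φ := by
        rw [circleMap_zero, Complex.re_ofReal_mul, Complex.exp_ofReal_mul_I_re]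
      -- From cos φ ≤ 1 - 2φ²/π². Half of this Gaussian decay absorbs 1 + n|φ|, the other half is
      -- integrated over φ.
      have hexp : ‖Complex.exp (circleMap 0 n φ)‖
          ≤ Real.exp (n + -(2 * (n * φ ^ 2 / Real.pi ^ 2))) := by
        rw [Complex.norm_exp, hre]
        apply Real.exp_le_exp.2
        have := mul_le_mul_of_nonneg_left (Real.cos_le_one_sub_mul_cos_sq habs) hn0.le
        refine this.trans (le_of_eq ?_)
        ring
      have hgs := one_add_mul_abs_le_gaussian hn1 φ
      rw [norm_mul]
      refine le_add_of_le_of_nonneg ?_ hB0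
      calc _ ≤ (Real.exp (n + -(2 * (n * φ ^ 2 / Real.pi ^ 2))) * (C₁ * (n : ℝ) ^ b))
            * ((1 + Real.pi) * √n * Real.exp (n * φ ^ 2 / Real.pi ^ 2)) := by
            gcongr
            exact hle.trans hgs
        _ = C₁ * (n : ℝ) ^ b * ((1 + Real.pi) * √n) * (Real.exp (n + -(2 * (n * φ ^ 2 / Real.pi ^ 2)))
            * Real.exp (n * φ ^ 2 / Real.pi ^ 2)) := by ring
        _ = _ := by
            rw [hA, mul_assoc _ (Real.exp n), ← Real.exp_add, ← Real.exp_add]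
            congr 2
            ring
    · have hg2 := hout (circleMap 0 n φ) (by rw [hnorm]; exact hn1) (by rw [harg]; exact h)
      rw [hnorm] at hg2
      refine le_add_of_nonneg_of_le (by positivity) ?_
      have h3 : ‖(n : ℂ) + 1 - circleMap 0 (n : ℝ) φ‖ ≤ 3 * n := by
        refine (norm_sub_le _ _).trans ?_
        rw [hnorm]
        have : ‖(n : ℂ) + 1‖ = n + 1 := by exact_mod_cast Complex.norm_natCast (n + 1)
        rw [this]
        linarith
      rw [hB]
      gcongr
  have hI : ∫ φ in (-Real.pi)..Real.pi, ‖Complex.exp (circleMap 0 n φ) * g (circleMap 0 n φ)‖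
      * ‖(n : ℂ) + 1 - circleMap 0 n φ‖ ≤ (n : ℝ) ^ b * Real.exp n * (D₁ + D₂) := by
    have hc1 : Continuous fun φ : ℝ => A * Real.exp (-((n : ℝ) / Real.pi ^ 2) * φ ^ 2) := by
      fun_prop
    have hc2 : Continuous fun φ : ℝ => ‖Complex.exp (circleMap 0 n φ) * g (circleMap 0 n φ)‖
        * ‖(n : ℂ) + 1 - circleMap 0 n φ‖ := by
      have := hd.continuous
      have := continuous_circleMap 0 (n : ℝ)
      fun_prop
    have hmono : ∫ φ in (-Real.pi)..Real.pi,
        ‖Complex.exp (circleMap 0 n φ) * g (circleMap 0 n φ)‖ * ‖(n : ℂ) + 1 - circleMap 0 n φ‖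
        ≤ ∫ φ in (-Real.pi)..Real.pi, (A * Real.exp (-((n : ℝ) / Real.pi ^ 2) * φ ^ 2) + B) := by
      refine intervalIntegral.integral_mono_on_of_le_Ioo (by linarith)
        (hc2.intervalIntegrable _ _) ((hc1.add continuous_const).intervalIntegrable _ _)
        fun φ hφ => hpt φ hφ.1 hφ.2.le
    refine hmono.trans ?_
    rw [intervalIntegral.integral_add (hc1.intervalIntegrable _ _)
      intervalIntegrable_const, intervalIntegral.integral_const_mul,
      intervalIntegral.integral_const, smul_eq_mul, mul_add]
    refine add_le_add ?_ ?_
    · refine (mul_le_mul_of_nonneg_left (integral_gaussian_circle_le hn0) hA0).trans (le_of_eq ?_)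
      rw [hA, hD₁]
      field_simp
    · have h4 : n * Real.exp (-(ε * n)) ≤ 1 / ε := by
        have := Real.add_one_le_exp (ε * n)
        rw [Real.exp_neg, ← div_eq_mul_inv, div_le_div_iff₀ (Real.exp_pos _) hε]
        linarith
      have h5 : Real.exp ((1 - ε) * n) = Real.exp n * Real.exp (-(ε * n)) := by
        rw [← Real.exp_add]; ring_nf
      rw [hB, hD₂, h5]
      calc (Real.pi - -Real.pi) * (C₂ * (Real.exp n * Real.exp (-(ε * n))) * (3 * n))
          = 2 * Real.pi * 3 * C₂ * Real.exp n * (n * Real.exp (-(ε * n))) := by ring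
        _ ≤ 2 * Real.pi * 3 * C₂ * Real.exp n * (1 / ε) := by gcongr
        _ = 1 * Real.exp n * (2 * Real.pi * (3 * C₂ / ε)) := by ring
        _ ≤ _ := by gcongr
  -- Balance of powers: the √n from absorbing 1 + n|φ| cancels the 1/√n of the Gaussian integral,
  -- and Stirling's √n against the extra n in n^(n+1) leaves n^(b - 1/2).
  have hst := factorial_le_stirling hn
  have h6 : (2 * Real.pi)⁻¹ * ((n : ℝ) ^ (n + 1))⁻¹ *
      ((n : ℝ) ^ b * Real.exp n * (D₁ + D₂)) * (n.factorial : ℝ)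
      ≤ (2 * Real.pi)⁻¹ * ((n : ℝ) ^ (n + 1))⁻¹ *
      ((n : ℝ) ^ b * Real.exp n * (D₁ + D₂)) *
        (Real.exp 1 * √n * ((n : ℝ) / Real.exp 1) ^ n) := by gcongr
  refine h1.trans ((mul_le_mul_of_nonneg_right (mul_le_mul_of_nonneg_left hI (by positivity))
    (by positivity)).trans (h6.trans (le_of_eq ?_)))
  have e2 : Real.exp n = Real.exp 1 ^ n := by rw [← Real.exp_nat_mul, mul_one]
  have e3 : (n : ℝ) ^ (b - 1 / 2) = (n : ℝ) ^ b / √n := by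
    rw [Real.rpow_sub hn0, Real.sqrt_eq_rpow]
  have e4 : √(n : ℝ) * √n = n := Real.mul_self_sqrt hn0.le
  rw [e2, e3, div_pow, pow_succ]
  have : (n : ℝ) ^ n ≠ 0 := by positivity
  have : Real.exp 1 ^ n ≠ 0 := by positivity
  field_simp
  rw [sq, e4, mul_comm]

/-! ### Bounds for the tolls in a sector -/

/-- `z log z (1 - e^{-z})`, an approximate solution of the functional equation with toll `h z`. -/
noncomputable def logSolution (z : ℂ) : ℂ := z * (Complex.log z * (1 - Complex.exp (-z)))

/-- The toll generated by `logSolution`. -/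
noncomputable def logToll (p : ℝ) (z : ℂ) : ℂ :=
  logSolution z - logSolution (p * z) - logSolution (((1 - p : ℝ) : ℂ) * z)

/-- `patriciaToll` as a function of a complex variable, with the linear part `c z` at infinity
removed. -/
noncomputable def reducedToll (p c : ℝ) (g : ℂ → ℂ) (z : ℂ) : ℂ :=
  g z - Complex.exp (-((1 - p : ℝ) : ℂ) * z) * g (p * z)
    - Complex.exp (-(p : ℂ) * z) * g (((1 - p : ℝ) : ℂ) * z)
    - (c : ℂ) / (Real.binEntropy p : ℂ) * logToll p z

theorem patriciaToll_eq_reducedToll (p c : ℝ) (g : ℂ → ℂ) (t : ℝ) :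
    patriciaToll p g t = reducedToll p c g t
      + (c : ℂ) / (Real.binEntropy p : ℂ) * logToll p t := by
  rw [patriciaToll, reducedToll, sub_add_cancel]

theorem reducedToll_zero (p : ℝ) (g : ℂ → ℂ) (t : ℝ) :
    reducedToll p 0 g t = patriciaToll p g t := by
  simp [patriciaToll, reducedToll]

theorem norm_log_le (z : ℂ) : ‖Complex.log z‖ ≤ |Real.log ‖z‖| + Real.pi := by
  refine (Complex.norm_le_abs_re_add_abs_im _).trans ?_
  rw [Complex.log_re, Complex.log_im]
  gcongr
  exact Complex.abs_arg_le_pi z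

theorem mul_cos_le_re {z : ℂ} {θ : ℝ} (hθ : θ ≤ Real.pi) (hz : |z.arg| ≤ θ) :
    ‖z‖ * Real.cos θ ≤ z.re := by
  rw [← Complex.norm_mul_cos_arg z, ← Real.cos_abs z.arg]
  gcongr
  exact Real.cos_le_cos_of_nonneg_of_le_pi (abs_nonneg _) hθ hz

theorem norm_exp_neg_mul_le {z : ℂ} {θ s : ℝ} (hθ : θ ≤ Real.pi) (hz : |z.arg| ≤ θ)
    (hs : 0 ≤ s) : ‖Complex.exp (-(s : ℂ) * z)‖ ≤ Real.exp (-(s * Real.cos θ * ‖z‖)) := by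
  rw [Complex.norm_exp]
  apply Real.exp_le_exp.2
  rw [neg_mul, Complex.neg_re, Complex.re_ofReal_mul]
  have := mul_le_mul_of_nonneg_left (mul_cos_le_re hθ hz) hs
  linarith

theorem norm_logSolution_le_of_norm_le_one {z : ℂ} (hz : ‖z‖ ≤ 1) :
    ‖logSolution z‖ ≤ 2 * ‖z‖ ^ 2 * (|Real.log ‖z‖| + Real.pi) := by
  have h1 : ‖1 - Complex.exp (-z)‖ ≤ 2 * ‖z‖ := by
    rw [norm_sub_rev]
    simpa using Complex.norm_exp_sub_one_le (x := -z) (by simpa using hz)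
  rw [logSolution, norm_mul, norm_mul]
  calc ‖z‖ * (‖Complex.log z‖ * ‖1 - Complex.exp (-z)‖)
      ≤ ‖z‖ * ((|Real.log ‖z‖| + Real.pi) * (2 * ‖z‖)) := by
        gcongr
        exact norm_log_le z
    _ = _ := by ring

theorem norm_logSolution_scale_le {z : ℂ} {s : ℝ} (hs0 : 0 < s) (hs1 : s ≤ 1) (hz0 : z ≠ 0)
    (hz : ‖z‖ ≤ 1) : ‖logSolution (s * z)‖
      ≤ 2 * ‖z‖ ^ 2 * (|Real.log ‖z‖| + (|Real.log s| + Real.pi)) := by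
  have hn : ‖(s : ℂ) * z‖ = s * ‖z‖ := by
    rw [norm_mul, Complex.norm_real, Real.norm_of_nonneg hs0.le]
  have hzn := norm_nonneg z
  have hle : s * ‖z‖ ≤ ‖z‖ := by nlinarith
  refine (norm_logSolution_le_of_norm_le_one (by rw [hn]; linarith)).trans ?_
  rw [hn, Real.log_mul hs0.ne' (norm_ne_zero_iff.2 hz0)]
  have h2 := abs_add_le (Real.log s) (Real.log ‖z‖)
  have h3 : (s * ‖z‖) ^ 2 ≤ ‖z‖ ^ 2 := by gcongr
  have h4 : |Real.log s + Real.log ‖z‖| + Real.pi ≤ |Real.log ‖z‖| + (|Real.log s| + Real.pi) := by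
    linarith
  have := Real.pi_pos
  exact mul_le_mul (by linarith) h4 (by positivity) (by positivity)

/-- As p + q = 1, the terms z log z cancel and -pz log p - qz log q = hz is left; all else carries a
decaying exponential. -/
theorem logToll_eq {p : ℝ} (hp0 : 0 < p) (hp1 : p < 1) {z : ℂ} (hz : z ≠ 0) :
    logToll p z = (Real.binEntropy p : ℂ) * z - z * (Complex.exp (-z) * Complex.log z
      - p * (Complex.exp (-(p : ℂ) * z) * (Real.log p + Complex.log z))
      - (1 - p : ℝ) * (Complex.exp (-((1 - p : ℝ) : ℂ) * z)
        * (Real.log (1 - p) + Complex.log z))) := by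
  have hq0 : 0 < 1 - p := by linarith
  rw [logToll, logSolution, logSolution, logSolution, Complex.log_ofReal_mul hp0 hz,
    Complex.log_ofReal_mul hq0 hz, binEntropy_eq_neg_log]
  push_cast
  ring_nf

theorem rpow_mul_exp_bounded (r : ℝ) {m : ℝ} (hm : 0 < m) :
    ∃ B, 0 ≤ B ∧ ∀ x : ℝ, 1 ≤ x → Real.exp (-(m * x)) ≤ B * x ^ r := by
  have h := (isLittleO_exp_neg_mul_rpow_atTop hm r).isBigO
  obtain ⟨c, hc⟩ := h.bound
  obtain ⟨X, hX⟩ := eventually_atTop.1 hc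
  have hcont : ContinuousOn (fun x : ℝ => Real.exp (-(m * x)) * x ^ (-r)) (Set.Icc 1 (max X 1)) := by
    refine ContinuousOn.mul (by fun_prop) (continuousOn_id.rpow_const fun x hx => Or.inl ?_)
    have : (1 : ℝ) ≤ x := hx.1
    simp only [id]
    linarith
  obtain ⟨B, hB⟩ := isCompact_Icc.exists_bound_of_continuousOn hcont
  refine ⟨max (max c B) 0, le_max_right _ _, fun x hx => ?_⟩
  have hx0 : (0 : ℝ) < x := by linarith
  have hxr : 0 < x ^ r := Real.rpow_pos_of_pos hx0 r
  rcases le_total X x with h | h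
  · have := hX x h
    rw [Real.norm_of_nonneg (Real.exp_pos _).le, Real.norm_of_nonneg hxr.le, neg_mul] at this
    refine this.trans ?_
    gcongr
    exact (le_max_left _ _).trans (le_max_left _ _)
  · have := hB x ⟨hx, h.trans (le_max_left _ _)⟩
    rw [Real.norm_of_nonneg (by positivity), Real.rpow_neg hx0.le, ← div_eq_mul_inv,
      div_le_iff₀ hxr] at this
    refine this.trans ?_
    gcongr
    exact (le_max_right _ _).trans (le_max_left _ _)

theorem one_add_abs_log_le {a : ℝ} (ha : 0 < a) (A : ℝ) (hA : 0 ≤ A) :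
    ∃ B, 0 ≤ B ∧ ∀ x : ℝ, 0 < x → x ≤ 1 → |Real.log x| + A ≤ B * x ^ (-a) := by
  refine ⟨1 / a + A, by positivity, fun x hx0 hx1 => ?_⟩
  have h1 : Real.log x⁻¹ ≤ x⁻¹ ^ a / a := Real.log_le_rpow_div (by positivity) ha
  have hlog : |Real.log x| = Real.log x⁻¹ := by
    rw [Real.log_inv, abs_of_nonpos (Real.log_nonpos hx0.le hx1)]
  have h2 : x⁻¹ ^ a = x ^ (-a) := by rw [Real.inv_rpow hx0.le, Real.rpow_neg hx0.le]
  have h3 : 1 ≤ x ^ (-a) := by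
    rw [← h2]
    exact Real.one_le_rpow ((one_le_inv₀ hx0).2 hx1) ha.le
  rw [hlog, add_mul]
  rw [h2] at h1
  have : A ≤ A * x ^ (-a) := le_mul_of_one_le_right hA h3
  have e : 1 / a * x ^ (-a) = x ^ (-a) / a := by ring
  linarith

/-- An entire function with Poisson coefficients `a_0 = a_1 = 0` is `O(z²)` at the origin. -/
theorem IsPoissonGF.norm_le_sq {a : ℕ → ℝ} {g : ℂ → ℂ} (hg : IsPoissonGF a g) (h0 : a 0 = 0)
    (h1 : a 1 = 0) : ∃ C, 0 ≤ C ∧ ∀ z : ℂ, ‖z‖ ≤ 1 → ‖g z‖ ≤ C * ‖z‖ ^ 2 := by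
  have hs := (hg 1).summable.norm
  set S := ∑' n : ℕ, ‖(a n : ℂ) * 1 ^ n / (n.factorial : ℂ)‖ with hS
  have hS0 : 0 ≤ S := tsum_nonneg fun _ => norm_nonneg _
  refine ⟨Real.exp 1 * S, by positivity, fun z hz => ?_⟩
  have h2 : ‖Complex.exp z * g z‖ ≤ S * ‖z‖ ^ 2 := by
    rw [← (hg z).tsum_eq]
    refine tsum_of_norm_bounded (hs.hasSum.mul_right _) fun n => ?_
    rcases n with _ | _ | n
    · simp [h0]
    · simp [h1]
    · simp only [norm_div, norm_mul, norm_pow, one_pow, mul_one]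
      rw [mul_div_right_comm]
      exact mul_le_mul_of_nonneg_left
        (pow_le_pow_of_le_one (norm_nonneg _) hz (by omega : 2 ≤ n + 1 + 1)) (by positivity)
  have h3 : g z = Complex.exp (-z) * (Complex.exp z * g z) := by
    rw [← mul_assoc, ← Complex.exp_add, neg_add_cancel, Complex.exp_zero, one_mul]
  rw [h3, norm_mul, mul_assoc]
  refine mul_le_mul ?_ h2 (norm_nonneg _) (Real.exp_pos _).le
  rw [Complex.norm_exp]
  apply Real.exp_le_exp.2
  have := Complex.abs_re_le_norm z
  rw [Complex.neg_re]
  linarith [neg_abs_le z.re]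

/-- A single crude power serves for g(pz) and g(qz), whose arguments may lie on either side of the
unit circle; at infinity the exponential prefactors outweigh it. -/
theorem norm_le_sq_of_sector {c θ b C₁ C₀ : ℝ} {g : ℂ → ℂ} (hb : b < 1) (hC₁ : 0 ≤ C₁)
    (hC₀ : 0 ≤ C₀) (h0 : ∀ z : ℂ, ‖z‖ ≤ 1 → ‖g z‖ ≤ C₀ * ‖z‖ ^ 2)
    (hin : ∀ z : ℂ, 1 ≤ ‖z‖ → |z.arg| ≤ θ → ‖g z - c * z‖ ≤ C₁ * ‖z‖ ^ b) (z : ℂ)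
    (hz : |z.arg| ≤ θ) : ‖g z‖ ≤ (C₀ + |c| + C₁) * ‖z‖ ^ 2 := by
  rcases le_total ‖z‖ 1 with h1 | h1
  · refine (h0 z h1).trans ?_
    gcongr
    have := abs_nonneg c
    linarith
  · have h2 : ‖g z‖ ≤ ‖g z - c * z‖ + ‖(c : ℂ) * z‖ := by
      simpa using norm_add_le (g z - c * z) (c * z)
    rw [norm_mul, Complex.norm_real, Real.norm_eq_abs] at h2
    have h3 : ‖z‖ ^ b ≤ ‖z‖ ^ 2 := by
      rw [← Real.rpow_natCast]
      exact Real.rpow_le_rpow_of_exponent_le h1 (by push_cast; linarith)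
    have h4 : |c| * ‖z‖ ≤ |c| * ‖z‖ ^ 2 := by
      gcongr
      nlinarith
    have h5 : C₁ * ‖z‖ ^ b ≤ C₁ * ‖z‖ ^ 2 := by gcongr
    have h6 : 0 ≤ C₀ * ‖z‖ ^ 2 := by positivity
    have := hin z h1 hz
    linarith

theorem norm_comp_mul_le_sq {θ D s : ℝ} {g : ℂ → ℂ} (hD0 : 0 ≤ D)
    (hquad : ∀ z : ℂ, |z.arg| ≤ θ → ‖g z‖ ≤ D * ‖z‖ ^ 2) (hs0 : 0 < s) (hs1 : s < 1) {z : ℂ}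
    (hz : |z.arg| ≤ θ) : ‖g (s * z)‖ ≤ D * ‖z‖ ^ 2 := by
  refine (hquad _ (by rwa [Complex.arg_real_mul _ hs0])).trans ?_
  rw [norm_mul, Complex.norm_real, Real.norm_of_nonneg hs0.le]
  have hzn := norm_nonneg z
  have : s * ‖z‖ ≤ ‖z‖ := by nlinarith
  gcongr

/-- Each piece is quadratic up to a logarithm: those of g by assumption, those of `logSolution`
because 1 - e^(-z) = O(z). -/
theorem norm_reducedToll_le_near_zero {p c θ D : ℝ} {g : ℂ → ℂ} (hp0 : 0 < p) (hp1 : p < 1)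
    (hθ0 : 0 < θ) (hθ : θ < Real.pi / 2) (hD0 : 0 ≤ D)
    (hquad : ∀ z : ℂ, |z.arg| ≤ θ → ‖g z‖ ≤ D * ‖z‖ ^ 2) {z : ℂ} (hz0 : z ≠ 0)
    (hz : |z.arg| ≤ θ) (hz1 : ‖z‖ ≤ 1) :
    ‖reducedToll p c g z‖ ≤ (3 * D + |c| / Real.binEntropy p * 6) *
      (‖z‖ ^ 2 * (|Real.log ‖z‖| + (1 + (|Real.log p| + |Real.log (1 - p)| + Real.pi)))) := by
  have hq0 : 0 < 1 - p := by linarith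
  have hpi := Real.pi_pos
  have hcos : 0 < Real.cos θ := Real.cos_pos_of_mem_Ioo ⟨by linarith, hθ⟩
  have hθπ : θ ≤ Real.pi := by linarith
  set h := Real.binEntropy p with hh
  have hh0 : 0 < h := Real.binEntropy_pos hp0 hp1
  set A := 1 + (|Real.log p| + |Real.log (1 - p)| + Real.pi) with hA
  have hexp : ∀ s : ℝ, 0 ≤ s → ‖Complex.exp (-(s : ℂ) * z)‖ ≤ 1 := fun s hs =>
    (norm_exp_neg_mul_le hθπ hz hs).trans (by
      rw [Real.exp_le_one_iff]
      have : 0 ≤ s * Real.cos θ * ‖z‖ := by positivity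
      linarith)
  have k1 := hquad z hz
  have k2 : ‖Complex.exp (-((1 - p : ℝ) : ℂ) * z) * g (p * z)‖ ≤ D * ‖z‖ ^ 2 := by
    rw [norm_mul, ← one_mul (D * ‖z‖ ^ 2)]
    exact mul_le_mul (hexp _ hq0.le) (norm_comp_mul_le_sq hD0 hquad hp0 hp1 hz) (norm_nonneg _) zero_le_one
  have k3 : ‖Complex.exp (-(p : ℂ) * z) * g (((1 - p : ℝ) : ℂ) * z)‖ ≤ D * ‖z‖ ^ 2 := by
    rw [norm_mul, ← one_mul (D * ‖z‖ ^ 2)]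
    exact mul_le_mul (hexp _ hp0.le) (norm_comp_mul_le_sq hD0 hquad hq0 (by linarith) hz) (norm_nonneg _)
      zero_le_one
  have hla := abs_nonneg (Real.log ‖z‖)
  have hlp := abs_nonneg (Real.log p)
  have hlq := abs_nonneg (Real.log (1 - p))
  have l1 : ‖logSolution z‖ ≤ 2 * ‖z‖ ^ 2 * (|Real.log ‖z‖| + A) :=
    (norm_logSolution_le_of_norm_le_one hz1).trans (by gcongr; linarith)
  have l2 : ‖logSolution (p * z)‖ ≤ 2 * ‖z‖ ^ 2 * (|Real.log ‖z‖| + A) :=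
    (norm_logSolution_scale_le hp0 hp1.le hz0 hz1).trans (by gcongr; linarith)
  have l3 : ‖logSolution (((1 - p : ℝ) : ℂ) * z)‖ ≤ 2 * ‖z‖ ^ 2 * (|Real.log ‖z‖| + A) :=
    (norm_logSolution_scale_le hq0 (by linarith) hz0 hz1).trans (by gcongr; linarith)
  have k4 : ‖(c : ℂ) / (h : ℂ) * logToll p z‖
      ≤ |c| / h * (6 * (‖z‖ ^ 2 * (|Real.log ‖z‖| + A))) := by
    rw [norm_mul, norm_div, Complex.norm_real, Complex.norm_real, Real.norm_eq_abs,
      Real.norm_of_nonneg hh0.le]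
    gcongr
    refine (norm_sub_le _ _).trans ?_
    have := norm_sub_le (logSolution z) (logSolution (p * z))
    linarith
  have hone : ‖z‖ ^ 2 ≤ ‖z‖ ^ 2 * (|Real.log ‖z‖| + A) :=
    le_mul_of_one_le_right (by positivity) (by linarith)
  have k5 : D * ‖z‖ ^ 2 ≤ D * (‖z‖ ^ 2 * (|Real.log ‖z‖| + A)) := by gcongr
  rw [reducedToll]
  refine (norm_sub_le _ _).trans ?_
  have s1 := norm_sub_le (g z - Complex.exp (-((1 - p : ℝ) : ℂ) * z) * g (p * z))
    (Complex.exp (-(p : ℂ) * z) * g (((1 - p : ℝ) : ℂ) * z))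
  have s2 := norm_sub_le (g z) (Complex.exp (-((1 - p : ℝ) : ℂ) * z) * g (p * z))
  linarith

/-- The linear part hz of `logToll`, multiplied by c/h, cancels cz. Every other term contains
e^(-sz) with s at least min p q, and Re z ≥ |z| cos θ in the sector. -/
theorem norm_reducedToll_le_near_top {p c θ D : ℝ} {g : ℂ → ℂ} (hp0 : 0 < p) (hp1 : p < 1)
    (hθ0 : 0 < θ) (hθ : θ < Real.pi / 2) (hD0 : 0 ≤ D)
    (hquad : ∀ z : ℂ, |z.arg| ≤ θ → ‖g z‖ ≤ D * ‖z‖ ^ 2) {z : ℂ} (hz0 : z ≠ 0)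
    (hz : |z.arg| ≤ θ) (hz1 : 1 ≤ ‖z‖) :
    ‖reducedToll p c g z‖ ≤ ‖g z - c * z‖ + (2 * D + |c| / Real.binEntropy p *
      (3 * (1 + |Real.log p| + |Real.log (1 - p)| + Real.pi))) *
        (‖z‖ ^ 2 * Real.exp (-(min p (1 - p) * Real.cos θ * ‖z‖))) := by
  have hq0 : 0 < 1 - p := by linarith
  have hpi := Real.pi_pos
  have hcos : 0 < Real.cos θ := Real.cos_pos_of_mem_Ioo ⟨by linarith, hθ⟩
  have hθπ : θ ≤ Real.pi := by linarith
  set h := Real.binEntropy p with hh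
  have hh0 : 0 < h := Real.binEntropy_pos hp0 hp1
  set m := min p (1 - p) * Real.cos θ with hm
  have hmin : 0 < min p (1 - p) := lt_min hp0 hq0
  have hm0 : 0 < m := by positivity
  set A' := 1 + |Real.log p| + |Real.log (1 - p)| + Real.pi with hA'
  have hA'0 : 0 ≤ A' := by positivity
  have hzn := norm_nonneg z
  have hexp : ∀ s : ℝ, min p (1 - p) ≤ s →
      ‖Complex.exp (-(s : ℂ) * z)‖ ≤ Real.exp (-(m * ‖z‖)) := fun s hs => by
    refine (norm_exp_neg_mul_le hθπ hz (hmin.le.trans hs)).trans ?_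
    apply Real.exp_le_exp.2
    rw [hm]
    have : min p (1 - p) * Real.cos θ * ‖z‖ ≤ s * Real.cos θ * ‖z‖ := by gcongr
    linarith
  have hex := Real.exp_pos (-(m * ‖z‖))
  have k2 : ‖Complex.exp (-((1 - p : ℝ) : ℂ) * z) * g (p * z)‖
      ≤ Real.exp (-(m * ‖z‖)) * (D * ‖z‖ ^ 2) := by
    rw [norm_mul]
    exact mul_le_mul (hexp _ (min_le_right _ _)) (norm_comp_mul_le_sq hD0 hquad hp0 hp1 hz) (norm_nonneg _) hex.le
  have k3 : ‖Complex.exp (-(p : ℂ) * z) * g (((1 - p : ℝ) : ℂ) * z)‖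
      ≤ Real.exp (-(m * ‖z‖)) * (D * ‖z‖ ^ 2) := by
    rw [norm_mul]
    exact mul_le_mul (hexp _ (min_le_left _ _)) (norm_comp_mul_le_sq hD0 hquad hq0 (by linarith) hz)
      (norm_nonneg _) hex.le
  have hlogz : ‖Complex.log z‖ ≤ ‖z‖ + Real.pi := by
    refine (norm_log_le z).trans ?_
    rw [abs_of_nonneg (Real.log_nonneg hz1)]
    have := Real.log_le_sub_one_of_pos (by linarith : 0 < ‖z‖)
    linarith
  have hlp := abs_nonneg (Real.log p)
  have hlq := abs_nonneg (Real.log (1 - p))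
  have hAz : ‖z‖ + (|Real.log p| + |Real.log (1 - p)| + Real.pi) ≤ A' * ‖z‖ := by
    rw [hA']
    have : |Real.log p| + |Real.log (1 - p)| + Real.pi
        ≤ (|Real.log p| + |Real.log (1 - p)| + Real.pi) * ‖z‖ :=
      le_mul_of_one_le_right (by positivity) hz1
    linarith
  have hl : ∀ s : ℝ, |s| ≤ |Real.log p| + |Real.log (1 - p)| →
      ‖(s : ℂ) + Complex.log z‖ ≤ A' * ‖z‖ := fun s hs => by
    refine (norm_add_le _ _).trans ?_
    rw [Complex.norm_real, Real.norm_eq_abs]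
    linarith
  have l1 : ‖Complex.exp (-z) * Complex.log z‖ ≤ Real.exp (-(m * ‖z‖)) * (A' * ‖z‖) := by
    have e1 := hexp 1 ((min_le_left _ _).trans hp1.le)
    have e2 := hl 0 (by simp only [abs_zero]; positivity)
    rw [Complex.ofReal_one, neg_one_mul] at e1
    rw [Complex.ofReal_zero, zero_add] at e2
    rw [norm_mul]
    exact mul_le_mul e1 e2 (norm_nonneg _) hex.le
  have l2 : ‖p * (Complex.exp (-(p : ℂ) * z) * (Real.log p + Complex.log z))‖
      ≤ Real.exp (-(m * ‖z‖)) * (A' * ‖z‖) := by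
    rw [norm_mul, norm_mul, Complex.norm_real, Real.norm_of_nonneg hp0.le]
    have := mul_le_mul (hexp _ (min_le_left _ _)) (hl (Real.log p) (by linarith))
      (norm_nonneg _) hex.le
    have hnn : 0 ≤ ‖Complex.exp (-(p : ℂ) * z)‖ * ‖(Real.log p : ℂ) + Complex.log z‖ := by
      positivity
    nlinarith
  have l3 : ‖((1 - p : ℝ) : ℂ) * (Complex.exp (-((1 - p : ℝ) : ℂ) * z)
      * (Real.log (1 - p) + Complex.log z))‖ ≤ Real.exp (-(m * ‖z‖)) * (A' * ‖z‖) := by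
    rw [norm_mul, norm_mul, Complex.norm_real, Real.norm_of_nonneg hq0.le]
    have := mul_le_mul (hexp _ (min_le_right _ _)) (hl (Real.log (1 - p)) (by linarith))
      (norm_nonneg _) hex.le
    have hnn : 0 ≤ ‖Complex.exp (-((1 - p : ℝ) : ℂ) * z)‖
        * ‖(Real.log (1 - p) : ℂ) + Complex.log z‖ := by
      positivity
    nlinarith
  have hhc : (h : ℂ) ≠ 0 := by exact_mod_cast hh0.ne'
  set Y := Complex.exp (-z) * Complex.log z
    - p * (Complex.exp (-(p : ℂ) * z) * (Real.log p + Complex.log z))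
    - (1 - p : ℝ) * (Complex.exp (-((1 - p : ℝ) : ℂ) * z)
      * (Real.log (1 - p) + Complex.log z)) with hY
  have hYle : ‖Y‖ ≤ 3 * (Real.exp (-(m * ‖z‖)) * (A' * ‖z‖)) := by
    refine (norm_sub_le _ _).trans ?_
    have := norm_sub_le (Complex.exp (-z) * Complex.log z)
      (p * (Complex.exp (-(p : ℂ) * z) * (Real.log p + Complex.log z)))
    linarith
  have e : reducedToll p c g z = (g z - c * z)
      - Complex.exp (-((1 - p : ℝ) : ℂ) * z) * g (p * z)
      - Complex.exp (-(p : ℂ) * z) * g (((1 - p : ℝ) : ℂ) * z) + (c : ℂ) / (h : ℂ) * (z * Y) := by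
    rw [reducedToll, logToll_eq hp0 hp1 hz0, ← hY, ← hh]
    field_simp
    ring
  have k4 : ‖(c : ℂ) / (h : ℂ) * (z * Y)‖
      ≤ |c| / h * (‖z‖ * (3 * (Real.exp (-(m * ‖z‖)) * (A' * ‖z‖)))) := by
    rw [norm_mul, norm_mul, norm_div, Complex.norm_real, Complex.norm_real, Real.norm_eq_abs,
      Real.norm_of_nonneg hh0.le]
    gcongr
  rw [e]
  refine (norm_add_le _ _).trans ?_
  have s1 := norm_sub_le ((g z - c * z) - Complex.exp (-((1 - p : ℝ) : ℂ) * z) * g (p * z))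
    (Complex.exp (-(p : ℂ) * z) * g (((1 - p : ℝ) : ℂ) * z))
  have s2 := norm_sub_le (g z - c * z) (Complex.exp (-((1 - p : ℝ) : ℂ) * z) * g (p * z))
  have s3 : (2 * D + |c| / h * (3 * A')) * (‖z‖ ^ 2 * Real.exp (-(m * ‖z‖)))
      = Real.exp (-(m * ‖z‖)) * (D * ‖z‖ ^ 2) + Real.exp (-(m * ‖z‖)) * (D * ‖z‖ ^ 2)
        + |c| / h * (‖z‖ * (3 * (Real.exp (-(m * ‖z‖)) * (A' * ‖z‖)))) := by
    ring
  rw [s3]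
  linarith

/-- Bounds on `reducedToll` at the origin and at infinity. -/
theorem norm_reducedToll_le {p c θ r b C₁ C₀ : ℝ} {g : ℂ → ℂ} (hp0 : 0 < p) (hp1 : p < 1)
    (hθ0 : 0 < θ) (hθ : θ < Real.pi / 2) (hr : r < 2) (hb : b < 1) (hC₁ : 0 ≤ C₁) (hC₀ : 0 ≤ C₀)
    (h0 : ∀ z : ℂ, ‖z‖ ≤ 1 → ‖g z‖ ≤ C₀ * ‖z‖ ^ 2)
    (hin : ∀ z : ℂ, 1 ≤ ‖z‖ → |z.arg| ≤ θ → ‖g z - c * z‖ ≤ C₁ * ‖z‖ ^ b) :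
    ∃ C, 0 ≤ C ∧ ∀ z : ℂ, z ≠ 0 → |z.arg| ≤ θ →
      (‖z‖ ≤ 1 → ‖reducedToll p c g z‖ ≤ C * ‖z‖ ^ r) ∧
      (1 ≤ ‖z‖ → ‖reducedToll p c g z‖ ≤ C * ‖z‖ ^ b) := by
  have hq0 : 0 < 1 - p := by linarith
  have hpi := Real.pi_pos
  have hcos : 0 < Real.cos θ := Real.cos_pos_of_mem_Ioo ⟨by linarith, hθ⟩
  have hh0 : 0 < Real.binEntropy p := Real.binEntropy_pos hp0 hp1
  have hD0 : 0 ≤ C₀ + |c| + C₁ := by positivity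
  have hquad := norm_le_sq_of_sector hb hC₁ hC₀ h0 hin
  set D := C₀ + |c| + C₁ with hD
  set E := 3 * D + |c| / Real.binEntropy p * 6 with hE
  set A := 1 + (|Real.log p| + |Real.log (1 - p)| + Real.pi) with hA
  set m := min p (1 - p) * Real.cos θ with hm
  have hm0 : 0 < m := mul_pos (lt_min hp0 hq0) hcos
  set E' := 2 * D + |c| / Real.binEntropy p *
    (3 * (1 + |Real.log p| + |Real.log (1 - p)| + Real.pi)) with hE'
  have hE0 : 0 ≤ E := by positivity
  have hE'0 : 0 ≤ E' := by positivity
  obtain ⟨B₁, hB₁0, hB₁⟩ := one_add_abs_log_le (show 0 < 2 - r by linarith) A (by positivity)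
  obtain ⟨B₂, hB₂0, hB₂⟩ := rpow_mul_exp_bounded (b - 2) hm0
  refine ⟨max (E * B₁) (C₁ + E' * B₂), le_max_of_le_left (by positivity), fun z hz0 hz => ⟨?_, ?_⟩⟩
  · intro hz1
    have hzp : 0 < ‖z‖ := norm_pos_iff.2 hz0
    refine (norm_reducedToll_le_near_zero hp0 hp1 hθ0 hθ hD0 hquad hz0 hz hz1).trans ?_
    have h1 := hB₁ ‖z‖ hzp hz1
    have h2 : ‖z‖ ^ 2 * ‖z‖ ^ (-(2 - r)) = ‖z‖ ^ r := by
      rw [← Real.rpow_natCast, ← Real.rpow_add hzp]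
      congr 1; push_cast; ring
    calc E * (‖z‖ ^ 2 * (|Real.log ‖z‖| + A)) ≤ E * (‖z‖ ^ 2 * (B₁ * ‖z‖ ^ (-(2 - r)))) := by
          gcongr
      _ = E * B₁ * (‖z‖ ^ 2 * ‖z‖ ^ (-(2 - r))) := by ring
      _ ≤ _ := by rw [h2]; gcongr; exact le_max_left _ _
  · intro hz1
    have hzp : 0 < ‖z‖ := norm_pos_iff.2 hz0
    refine ((norm_reducedToll_le_near_top hp0 hp1 hθ0 hθ hD0 hquad hz0 hz hz1).trans
      (add_le_add_left (hin z hz1 hz) _)).trans ?_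
    have h1 := hB₂ ‖z‖ hz1
    have h2 : ‖z‖ ^ 2 * ‖z‖ ^ (b - 2) = ‖z‖ ^ b := by
      rw [← Real.rpow_natCast, ← Real.rpow_add hzp]
      congr 1; push_cast; ring
    calc C₁ * ‖z‖ ^ b + E' * (‖z‖ ^ 2 * Real.exp (-(m * ‖z‖)))
        ≤ C₁ * ‖z‖ ^ b + E' * (‖z‖ ^ 2 * (B₂ * ‖z‖ ^ (b - 2))) := by gcongr
      _ = C₁ * ‖z‖ ^ b + E' * B₂ * (‖z‖ ^ 2 * ‖z‖ ^ (b - 2)) := by ring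
      _ = (C₁ + E' * B₂) * ‖z‖ ^ b := by rw [h2]; ring
      _ ≤ _ := by gcongr; exact le_max_right _ _

/-! ### Mellin transforms -/

theorem norm_one_sub_exp_neg_le {t : ℝ} (ht : 0 ≤ t) :
    ‖(1 : ℂ) - Complex.exp (-(t : ℂ))‖ ≤ 1 ∧ ‖(1 : ℂ) - Complex.exp (-(t : ℂ))‖ ≤ t := by
  have e : (1 : ℂ) - Complex.exp (-(t : ℂ)) = ((1 - Real.exp (-t) : ℝ) : ℂ) := by
    push_cast; ring
  have h1 : Real.exp (-t) ≤ 1 := by rw [Real.exp_le_one_iff]; linarith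
  rw [e, Complex.norm_real, Real.norm_of_nonneg (by linarith)]
  constructor
  · linarith [Real.exp_pos (-t)]
  · linarith [Real.add_one_le_exp (-t)]

theorem one_sub_exp_neg_isBigO_top :
    (fun t : ℝ => (1 : ℂ) - Complex.exp (-(t : ℂ))) =O[atTop] fun t : ℝ => t ^ (-(0 : ℝ)) := by
  refine Asymptotics.IsBigO.of_bound 1 ?_
  filter_upwards [eventually_ge_atTop 0] with t ht
  simpa using (norm_one_sub_exp_neg_le ht).1

theorem one_sub_exp_neg_isBigO_zero :
    (fun t : ℝ => (1 : ℂ) - Complex.exp (-(t : ℂ))) =O[𝓝[>] 0] fun t : ℝ => t ^ (-(-1 : ℝ)) := by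
  refine Asymptotics.IsBigO.of_bound 1 ?_
  filter_upwards [self_mem_nhdsWithin] with t ht
  have ht' : (0 : ℝ) < t := ht
  simpa [abs_of_pos ht'] using (norm_one_sub_exp_neg_le ht'.le).2

theorem one_sub_exp_neg_locallyIntegrableOn :
    LocallyIntegrableOn (fun t : ℝ => (1 : ℂ) - Complex.exp (-(t : ℂ))) (Set.Ioi 0) :=
  (by fun_prop : Continuous fun t : ℝ => (1 : ℂ) - Complex.exp (-(t : ℂ))).continuousOn
    |>.locallyIntegrableOn measurableSet_Ioi

/-- The Cauchy–Saalschütz formula on the strip `-1 < Re s < 0`. -/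
theorem mellin_one_sub_exp_neg {s : ℂ} (h1 : -1 < s.re) (h0 : s.re < 0) :
    mellin (fun t : ℝ => (1 : ℂ) - Complex.exp (-(t : ℂ))) s = -Complex.Gamma s := by
  have hs0 : s ≠ 0 := by rintro rfl; simp at h0
  have hconv := mellinConvergent_of_isBigO_rpow one_sub_exp_neg_locallyIntegrableOn
    one_sub_exp_neg_isBigO_top h0 one_sub_exp_neg_isBigO_zero h1
  have hs1 : 0 < (s + 1).re := by simp; linarith
  have hG := Complex.GammaIntegral_convergent hs1
  have hnorm : ∀ t : ℝ, 0 < t → ‖((t : ℂ)) ^ s‖ = t ^ s.re := fun t ht =>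
    Complex.norm_cpow_eq_rpow_re_of_pos ht s
  -- Integrating by parts against t^s reduces to Γ(s + 1) = s Γ(s); the boundary terms vanish at 0
  -- because Re s > -1 and at ∞ because Re s < 0.
  have hparts := integral_Ioi_mul_deriv_eq_deriv_mul (a := (0 : ℝ)) (a' := (0 : ℂ)) (b' := (0 : ℂ))
    (u := fun t : ℝ => (1 : ℂ) - Complex.exp (-(t : ℂ))) (u' := fun t : ℝ => Complex.exp (-(t : ℂ)))
    (v := fun t : ℝ => (t : ℂ) ^ s) (v' := fun t : ℝ => s * (t : ℂ) ^ (s - 1))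
    (fun t _ => by
      have := ((((hasDerivAt_id (t : ℂ)).neg).cexp).const_sub 1).comp_ofReal
      simpa using this)
    (fun t ht => hasDerivAt_ofReal_cpow_const (ne_of_gt ht) hs0)
    (by
      have : IntegrableOn _ (Set.Ioi (0 : ℝ)) := hconv.const_mul s
      refine this.congr_fun (fun t _ => ?_) measurableSet_Ioi
      simp only [Pi.mul_apply, smul_eq_mul]
      ring)
    (by
      refine hG.congr_fun (fun t _ => ?_) measurableSet_Ioi
      simp only [Pi.mul_apply, add_sub_cancel_right]
      push_cast
      rfl)
    (by
      refine squeeze_zero_norm' (a := fun t : ℝ => t ^ (1 + s.re)) ?_ ?_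
      · filter_upwards [self_mem_nhdsWithin] with t ht
        have ht' : (0 : ℝ) < t := ht
        rw [Pi.mul_apply, norm_mul, hnorm t ht', Real.rpow_add ht', Real.rpow_one]
        gcongr
        exact (norm_one_sub_exp_neg_le ht'.le).2
      · have : ContinuousAt (fun t : ℝ => t ^ (1 + s.re)) 0 :=
          Real.continuousAt_rpow_const _ _ (Or.inr (by linarith))
        have h := this.tendsto
        rw [Real.zero_rpow (by linarith)] at h
        exact h.mono_left nhdsWithin_le_nhds)
    (by
      refine squeeze_zero_norm' (a := fun t : ℝ => t ^ (-(-s.re))) ?_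
        (tendsto_rpow_neg_atTop (by linarith))
      filter_upwards [eventually_gt_atTop 0] with t ht
      rw [Pi.mul_apply, norm_mul, hnorm t ht, neg_neg]
      exact mul_le_of_le_one_left (by positivity) (norm_one_sub_exp_neg_le ht.le).1)
  have e1 : ∫ t in Set.Ioi (0 : ℝ), ((1 : ℂ) - Complex.exp (-(t : ℂ))) * (s * (t : ℂ) ^ (s - 1))
      = s * mellin (fun t : ℝ => (1 : ℂ) - Complex.exp (-(t : ℂ))) s := by
    rw [mellin, ← integral_const_mul]
    congr 1
    ext t
    rw [smul_eq_mul]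
    ring
  have e2 : ∫ t in Set.Ioi (0 : ℝ), Complex.exp (-(t : ℂ)) * (t : ℂ) ^ s
      = Complex.Gamma (s + 1) := by
    rw [Complex.Gamma_eq_integral hs1, Complex.GammaIntegral]
    congr 1
    ext t
    rw [add_sub_cancel_right]
    push_cast
    ring
  rw [e1, e2, Complex.Gamma_add_one s hs0] at hparts
  have : s * (mellin (fun t : ℝ => (1 : ℂ) - Complex.exp (-(t : ℂ))) s + Complex.Gamma s) = 0 := by
    linear_combination hparts
  rcases mul_eq_zero.1 this with h | h
  · exact absurd h hs0
  · exact eq_neg_of_add_eq_zero_left h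

/-- Differentiating the Cauchy–Saalschütz formula in s inserts the logarithm under the integral. -/
theorem hasMellin_log_mul_one_sub_exp_neg {s : ℂ} (h1 : -1 < s.re) (h0 : s.re < 0) :
    HasMellin (fun t : ℝ => Complex.log t * (1 - Complex.exp (-(t : ℂ)))) s
      (-deriv Complex.Gamma s) := by
  obtain ⟨hc, hd⟩ := mellin_hasDerivAt_of_isBigO_rpow one_sub_exp_neg_locallyIntegrableOn
    one_sub_exp_neg_isBigO_top h0 one_sub_exp_neg_isBigO_zero h1
  have hopen : IsOpen {z : ℂ | -1 < z.re ∧ z.re < 0} :=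
    (isOpen_lt continuous_const Complex.continuous_re).inter
      (isOpen_lt Complex.continuous_re continuous_const)
  have heq : mellin (fun t : ℝ => (1 : ℂ) - Complex.exp (-(t : ℂ))) =ᶠ[𝓝 s]
      fun z => -Complex.Gamma z := by
    filter_upwards [hopen.mem_nhds (show s ∈ {z : ℂ | -1 < z.re ∧ z.re < 0} from ⟨h1, h0⟩)]
      with z hz
    exact mellin_one_sub_exp_neg hz.1 hz.2
  have h2 := hd.congr_of_eventuallyEq heq.symm
  have h3 := h2.deriv
  rw [deriv.fun_neg] at h3
  have hcongr : Set.EqOn (fun t : ℝ => (t : ℂ) ^ (s - 1) •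
        (Real.log t • ((1 : ℂ) - Complex.exp (-(t : ℂ)))))
      (fun t : ℝ => (t : ℂ) ^ (s - 1) • (Complex.log t * (1 - Complex.exp (-(t : ℂ)))))
      (Set.Ioi 0) := fun t ht => by
    have ht' : (0 : ℝ) < t := ht
    simp only [Complex.real_smul, Complex.ofReal_log ht'.le]
  refine ⟨hc.congr_fun hcongr measurableSet_Ioi, ?_⟩
  rw [h3, mellin, mellin]
  exact (setIntegral_congr_fun measurableSet_Ioi hcongr).symm

/-- The meromorphic continuation of the Mellin transform of `logToll`. -/
noncomputable def logTollMellin (p : ℝ) (s : ℂ) : ℂ :=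
  (1 - (p : ℂ) ^ (-s) - ((1 - p : ℝ) : ℂ) ^ (-s)) * (-deriv Complex.Gamma (s + 1))

/-- The factor z in `logSolution` shifts s to s + 1, and each dilation by r multiplies the transform
by r^(-s). -/
theorem hasMellin_logToll {p : ℝ} (hp0 : 0 < p) (hp1 : p < 1) {s : ℂ} (h2 : -2 < s.re)
    (h1 : s.re < -1) : HasMellin (fun t : ℝ => logToll p t) s (logTollMellin p s) := by
  have hq0 : 0 < 1 - p := by linarith
  have hL := hasMellin_log_mul_one_sub_exp_neg (s := s + 1) (by simp; linarith) (by simp; linarith)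
  have hK : HasMellin (fun t : ℝ => logSolution t) s (-deriv Complex.Gamma (s + 1)) := by
    have hfun : (fun t : ℝ => logSolution t) = fun t : ℝ => (t : ℂ) ^ (1 : ℂ) •
        (Complex.log t * (1 - Complex.exp (-(t : ℂ)))) := by
      ext t
      rw [Complex.cpow_one, logSolution, smul_eq_mul]
    rw [hfun]
    exact ⟨MellinConvergent.cpow_smul.2 hL.1, by rw [mellin_cpow_smul]; exact hL.2⟩
  have hKs : ∀ r : ℝ, 0 < r → HasMellin (fun t : ℝ => logSolution (r * t)) s
      ((r : ℂ) ^ (-s) * -deriv Complex.Gamma (s + 1)) := by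
    intro r hr
    have c := (MellinConvergent.comp_mul_left (f := fun t : ℝ => logSolution t) hr).2 hK.1
    have m := mellin_comp_mul_left (fun t : ℝ => logSolution t) s hr
    simp only [Complex.ofReal_mul] at c m
    exact ⟨c, by rw [m, hK.2, smul_eq_mul]⟩
  have hp := hKs p hp0
  have hq := hKs (1 - p) hq0
  have s1 := hasMellin_sub hK.1 hp.1
  have s2 := hasMellin_sub s1.1 hq.1
  refine ⟨s2.1, s2.2.trans ?_⟩
  rw [s1.2, hK.2, hp.2, hq.2, logTollMellin]
  ring

theorem analyticAt_Gamma {s : ℂ} (h1 : -1 < s.re) (h0 : s ≠ 0) :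
    AnalyticAt ℂ Complex.Gamma s := by
  have hopen : IsOpen ({z : ℂ | -1 < z.re} \ {0}) :=
    (isOpen_lt continuous_const Complex.continuous_re).sdiff isClosed_singleton
  refine DifferentiableOn.analyticAt (s := {z : ℂ | -1 < z.re} \ {0}) (fun z hz => ?_)
    (hopen.mem_nhds ⟨h1, h0⟩)
  refine (Complex.differentiableAt_Gamma z fun m => ?_).differentiableWithinAt
  rintro rfl
  obtain ⟨hz1, hz0⟩ := hz
  rcases m with _ | m
  · simp at hz0
  · simp only [Set.mem_ofPred_eq, Nat.cast_add, Nat.cast_one, Complex.neg_re, Complex.add_re,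
      Complex.natCast_re, Complex.one_re] at hz1
    have : (0 : ℝ) ≤ m := Nat.cast_nonneg m
    linarith

theorem differentiableAt_logTollMellin {p : ℝ} (hp0 : 0 < p) (hp1 : p < 1) {s : ℂ}
    (h2 : -2 < s.re) (h1 : s ≠ -1) : DifferentiableAt ℂ (logTollMellin p) s := by
  have hp : (p : ℂ) ≠ 0 := by exact_mod_cast hp0.ne'
  have hq : ((1 - p : ℝ) : ℂ) ≠ 0 := by
    have : 1 - p ≠ 0 := by linarith
    exact_mod_cast this
  have hG : DifferentiableAt ℂ (deriv Complex.Gamma) (s + 1) :=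
    (analyticAt_Gamma (by simp; linarith)
      (fun h => h1 (eq_neg_of_add_eq_zero_left h))).deriv.differentiableAt
  have hG' : DifferentiableAt ℂ (fun z => deriv Complex.Gamma (z + 1)) s :=
    hG.comp (f := fun z : ℂ => z + 1) s (by fun_prop)
  have c : ∀ r : ℂ, r ≠ 0 → DifferentiableAt ℂ (fun z : ℂ => r ^ (-z)) s := fun r hr =>
    differentiableAt_id.neg.const_cpow (Or.inl hr)
  exact (((differentiableAt_const 1).sub (c _ hp)).sub (c _ hq)).mul hG'.neg

theorem meromorphicAt_logTollMellin {p : ℝ} (hp0 : 0 < p) (hp1 : p < 1) (s : ℂ) :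
    MeromorphicAt (logTollMellin p) s := by
  have hp : (p : ℂ) ≠ 0 := by exact_mod_cast hp0.ne'
  have hq : ((1 - p : ℝ) : ℂ) ≠ 0 := by
    have : 1 - p ≠ 0 := by linarith
    exact_mod_cast this
  have hG : MeromorphicAt (fun z => deriv Complex.Gamma (z + 1)) s :=
    (Meromorphic.Gamma (s + 1)).deriv.comp_analyticAt (g := fun z : ℂ => z + 1) (by fun_prop)
  have c : ∀ r : ℂ, r ≠ 0 → MeromorphicAt (fun z : ℂ => r ^ (-z)) s := fun r hr =>
    (Differentiable.analyticAt (fun z => differentiableAt_id.neg.const_cpow (Or.inl hr))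
      s).meromorphicAt
  exact (((MeromorphicAt.const 1 s).sub (c _ hp)).sub (c _ hq)).mul hG.neg

/-! ### Laurent expansion of the continued transform at -1 -/

theorem tendsto_exp_second_order (l : ℂ) :
    Tendsto (fun e : ℂ => (Complex.exp (l * e) - 1 - l * e) / e ^ 2) (𝓝[≠] 0)
      (𝓝 (l ^ 2 / 2)) := by
  rw [tendsto_iff_norm_sub_tendsto_zero]
  have hlim : Tendsto (fun e : ℂ => ‖l‖ ^ 3 * ‖e‖) (𝓝[≠] 0) (𝓝 0) := by
    have : Tendsto (fun e : ℂ => ‖l‖ ^ 3 * ‖e‖) (𝓝 0) (𝓝 (‖l‖ ^ 3 * ‖(0 : ℂ)‖)) :=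
      (continuous_const.mul continuous_norm).tendsto 0
    rw [norm_zero, mul_zero] at this
    exact this.mono_left nhdsWithin_le_nhds
  refine squeeze_zero' (Eventually.of_forall fun _ => norm_nonneg _) ?_ hlim
  have hsmall : ∀ᶠ e : ℂ in 𝓝[≠] 0, ‖l * e‖ ≤ 1 := by
    have : Tendsto (fun e : ℂ => ‖l * e‖) (𝓝 0) (𝓝 ‖l * 0‖) :=
      (by fun_prop : Continuous fun e : ℂ => ‖l * e‖).tendsto 0
    rw [mul_zero, norm_zero] at this
    exact ((this.eventually (gt_mem_nhds one_pos)).mono fun e he => he.le).filter_mono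
      nhdsWithin_le_nhds
  filter_upwards [hsmall, self_mem_nhdsWithin] with e he hne
  have hne' : e ≠ 0 := hne
  have hb := Complex.exp_bound he (n := 3) (by norm_num)
  simp only [Finset.sum_range_succ, Finset.sum_range_zero, Nat.factorial, pow_zero, pow_one,
    zero_add] at hb
  have e1 : (Complex.exp (l * e) - 1 - l * e) / e ^ 2 - l ^ 2 / 2
      = (Complex.exp (l * e) - (1 + l * e + (l * e) ^ 2 / 2)) / e ^ 2 := by
    field_simp
    ring
  rw [e1, norm_div, norm_pow, div_le_iff₀ (by positivity)]
  norm_num at hb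
  refine hb.trans ?_
  have : 0 ≤ (‖l‖ * ‖e‖) ^ 3 := by positivity
  calc (‖l‖ * ‖e‖) ^ 3 * (2 / 9) ≤ (‖l‖ * ‖e‖) ^ 3 * 1 := by gcongr; norm_num
    _ = _ := by ring

theorem tendsto_logTollMellin {p : ℝ} (hp0 : 0 < p) (hp1 : p < 1) :
    Tendsto (fun s : ℂ => logTollMellin p s + (Real.binEntropy p : ℂ) / (s + 1)) (𝓝[≠] (-1))
      (𝓝 (-((p * Real.log p ^ 2 + (1 - p) * Real.log (1 - p) ^ 2 : ℝ) : ℂ) / 2)) := by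
  have hq0 : 0 < 1 - p := by linarith
  have hp : (p : ℂ) ≠ 0 := by exact_mod_cast hp0.ne'
  have hq : ((1 - p : ℝ) : ℂ) ≠ 0 := by exact_mod_cast hq0.ne'
  set h : ℂ := (Real.binEntropy p : ℂ) with hh
  have hh' : h = -(p * Real.log p + (1 - p : ℝ) * Real.log (1 - p)) := by
    rw [hh, binEntropy_eq_neg_log]; push_cast; ring
  set N : ℂ → ℂ := fun e => 1 - p * Complex.exp (-Real.log p * e)
    - (1 - p : ℝ) * Complex.exp (-Real.log (1 - p) * e) with hN
  -- With e = s + 1 one has -Γ'(e) = R(e)/e². Since R(0) = 1 and R'(0) = 0, Γ'(1) drops out, and the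
  -- constant term is the second-order coefficient of N alone.
  set R : ℂ → ℂ := fun e => Complex.Gamma (e + 1) - e * deriv Complex.Gamma (e + 1) with hR
  have hGa : AnalyticAt ℂ Complex.Gamma (0 + 1) := analyticAt_Gamma (by simp) (by simp)
  -- the second order expansion of `N`
  have hN2 : Tendsto (fun e => (N e + h * e) / e ^ 2) (𝓝[≠] 0)
      (𝓝 (-((p * Real.log p ^ 2 + (1 - p) * Real.log (1 - p) ^ 2 : ℝ) : ℂ) / 2)) := by
    have t1 := (tendsto_exp_second_order (-Real.log p)).const_mul (-(p : ℂ))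
    have t2 := (tendsto_exp_second_order (-Real.log (1 - p))).const_mul (-((1 - p : ℝ) : ℂ))
    convert t1.add t2 using 1
    · ext e
      rw [hN, hh']
      push_cast
      ring
    · congr 1
      push_cast
      ring
  have hN1 : Tendsto (fun e => N e / e) (𝓝[≠] 0) (𝓝 (-h)) := by
    have t1 : Tendsto (fun e : ℂ => e) (𝓝[≠] 0) (𝓝 0) := tendsto_id.mono_left nhdsWithin_le_nhds
    have t2 := (hN2.mul t1).sub_const h
    rw [mul_zero, zero_sub] at t2
    refine t2.congr' ?_
    filter_upwards [self_mem_nhdsWithin] with e he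
    have he' : e ≠ 0 := he
    field_simp
    ring
  have hR0 : R 0 = 1 := by simp [hR]
  have hR1 : Tendsto (fun e => (R e - 1) / e) (𝓝[≠] 0) (𝓝 0) := by
    have hcomp : HasDerivAt (fun e : ℂ => e + 1) 1 0 := (hasDerivAt_id 0).add_const 1
    have d1 : HasDerivAt (fun e : ℂ => Complex.Gamma (e + 1)) (deriv Complex.Gamma (0 + 1)) 0 := by
      have := hGa.differentiableAt.hasDerivAt.comp (0 : ℂ) hcomp
      rw [mul_one] at this
      exact this
    have d2 : HasDerivAt (fun e : ℂ => deriv Complex.Gamma (e + 1))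
        (deriv (deriv Complex.Gamma) (0 + 1)) 0 := by
      have := hGa.deriv.differentiableAt.hasDerivAt.comp (0 : ℂ) hcomp
      rw [mul_one] at this
      exact this
    have d3 := d1.sub ((hasDerivAt_id (0 : ℂ)).mul d2)
    have d4 : HasDerivAt R 0 0 := by
      refine d3.congr_deriv ?_
      simp
    have := d4.tendsto_slope
    refine this.congr' ?_
    filter_upwards [self_mem_nhdsWithin] with e _
    rw [slope_def_field, hR0, sub_zero]
  have hkey : Tendsto (fun e => N e * R e / e ^ 2 + h / e) (𝓝[≠] 0)
      (𝓝 (-((p * Real.log p ^ 2 + (1 - p) * Real.log (1 - p) ^ 2 : ℝ) : ℂ) / 2)) := by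
    have := hN2.add (hN1.mul hR1)
    rw [mul_zero, add_zero] at this
    refine this.congr' ?_
    filter_upwards [self_mem_nhdsWithin] with e he
    have he' : e ≠ 0 := he
    field_simp
    ring
  have hshift : Tendsto (fun s : ℂ => s + 1) (𝓝[≠] (-1)) (𝓝[≠] 0) := by
    refine tendsto_nhdsWithin_iff.2 ⟨?_, ?_⟩
    · have : Tendsto (fun s : ℂ => s + 1) (𝓝 (-1)) (𝓝 (-1 + 1)) :=
        (continuous_id.add continuous_const).tendsto _
      rw [neg_add_cancel] at this
      exact this.mono_left nhdsWithin_le_nhds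
    · filter_upwards [self_mem_nhdsWithin] with s hs h
      exact hs (eq_neg_of_add_eq_zero_left h)
  refine (hkey.comp hshift).congr' ?_
  filter_upwards [self_mem_nhdsWithin] with s hs
  have hs' : s + 1 ≠ 0 := fun h => hs (eq_neg_of_add_eq_zero_left h)
  simp only [Function.comp_apply]
  have hpow : ∀ r : ℝ, 0 < r → (r : ℂ) ^ (-s) = r * Complex.exp (-Real.log r * (s + 1)) := by
    intro r hr
    have hr' : (r : ℂ) ≠ 0 := by exact_mod_cast hr.ne'
    have : (r : ℂ) = Complex.exp (Real.log r) := by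
      rw [← Complex.ofReal_exp, Real.exp_log hr]
    rw [Complex.cpow_def_of_ne_zero hr', ← Complex.ofReal_log hr.le]
    conv_rhs => rw [this, ← Complex.exp_add]
    congr 1
    ring
  rw [logTollMellin, hpow p hp0, hpow (1 - p) hq0]
  have hG1 := Complex.deriv_Gamma_add_one (s + 1) hs'
  have hG2 := Complex.Gamma_add_one (s + 1) hs'
  have : R (s + 1) = (s + 1) ^ 2 * -deriv Complex.Gamma (s + 1) := by
    rw [hR]
    simp only
    rw [hG1, hG2]
    ring
  rw [this, hN]
  field_simp

/-! ### Tolls of JS-admissible functions -/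

/-- Any logarithmic power costs an arbitrarily small increase of the exponent, so β plays no further
role. -/
theorem exists_rpow_mul_log_rpow_le {α b : ℝ} (β : ℝ) (hb : α < b) :
    ∃ B : ℝ, 0 ≤ B ∧ ∀ x : ℝ, 1 ≤ x → x ^ α * Real.log (1 + x) ^ β ≤ B * x ^ b := by
  have key : ∃ B : ℝ, 0 ≤ B ∧ ∀ x : ℝ, 1 ≤ x → Real.log (1 + x) ^ β ≤ B * x ^ (b - α) := by
    rcases le_or_gt β 0 with hβ | hβ
    · refine ⟨Real.log 2 ^ β, by positivity, fun x hx => ?_⟩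
      have h2 : 0 < Real.log 2 := Real.log_pos (by norm_num)
      calc Real.log (1 + x) ^ β ≤ Real.log 2 ^ β :=
            Real.rpow_le_rpow_of_nonpos h2 (Real.log_le_log (by norm_num) (by linarith)) hβ
        _ ≤ Real.log 2 ^ β * x ^ (b - α) :=
            le_mul_of_one_le_right (by positivity) (Real.one_le_rpow hx (by linarith))
    · have he : 0 < (b - α) / β := div_pos (by linarith) hβ
      set e := (b - α) / β with hedef
      refine ⟨(2 ^ e / e) ^ β, by positivity, fun x hx => ?_⟩
      have hx0 : 0 ≤ x := by linarith
      calc Real.log (1 + x) ^ β ≤ ((2 * x) ^ e / e) ^ β := by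
            refine Real.rpow_le_rpow (Real.log_nonneg (by linarith)) ?_ hβ.le
            exact (Real.log_le_log (by linarith) (by linarith)).trans
              (Real.log_le_rpow_div (by linarith) he)
        _ = (2 ^ e / e) ^ β * x ^ (b - α) := by
            rw [Real.mul_rpow (by norm_num) hx0, mul_div_right_comm,
              Real.mul_rpow (by positivity) (by positivity), ← Real.rpow_mul hx0, hedef,
              div_mul_cancel₀ _ hβ.ne']
  obtain ⟨B, hB, h⟩ := key
  refine ⟨B, hB, fun x hx => ?_⟩
  have hx0 : 0 < x := by linarith
  calc x ^ α * Real.log (1 + x) ^ β ≤ x ^ α * (B * x ^ (b - α)) := by gcongr; exact h x hx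
    _ = B * x ^ b := by
        rw [mul_left_comm, ← Real.rpow_add hx0, add_sub_cancel]

theorem SectorBound.exists_rpow {θ α β b : ℝ} {f : ℂ → ℂ} (h : SectorBound θ α β f)
    (hb : α < b) :
    ∃ C : ℝ, 0 ≤ C ∧ ∀ z : ℂ, 1 ≤ ‖z‖ → |z.arg| ≤ θ → ‖f z‖ ≤ C * ‖z‖ ^ b := by
  obtain ⟨C, hC⟩ := h
  obtain ⟨B, hB, hB'⟩ := exists_rpow_mul_log_rpow_le β hb
  refine ⟨|C| * B, by positivity, fun z hz hzθ => (hC z hz hzθ).trans ?_⟩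
  have hlog : 0 ≤ Real.log (1 + ‖z‖) := Real.log_nonneg (by linarith)
  calc C * (‖z‖ ^ α * Real.log (1 + ‖z‖) ^ β)
      ≤ |C| * (‖z‖ ^ α * Real.log (1 + ‖z‖) ^ β) := by
        gcongr
        exact le_abs_self C
    _ ≤ |C| * (B * ‖z‖ ^ b) := mul_le_mul_of_nonneg_left (hB' _ hz) (abs_nonneg C)
    _ = _ := by ring

theorem Complex.ofReal_mul_mem_slitPlane {r : ℝ} (hr : 0 < r) {z : ℂ}
    (hz : z ∈ Complex.slitPlane) : (r : ℂ) * z ∈ Complex.slitPlane := by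
  rw [Complex.mem_slitPlane_iff] at hz ⊢
  rw [Complex.re_ofReal_mul, Complex.im_ofReal_mul]
  exact hz.imp (mul_pos hr) (mul_ne_zero hr.ne')

theorem differentiableAt_logSolution {z : ℂ} (hz : z ∈ Complex.slitPlane) :
    DifferentiableAt ℂ logSolution z := by
  unfold logSolution
  exact differentiableAt_id.mul ((Complex.differentiableAt_log hz).mul (by fun_prop))

theorem differentiableAt_reducedToll {p c : ℝ} {g : ℂ → ℂ} (hp0 : 0 < p) (hp1 : p < 1)
    (hg : Differentiable ℂ g) {z : ℂ} (hz : z ∈ Complex.slitPlane) :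
    DifferentiableAt ℂ (reducedToll p c g) z := by
  have hL : ∀ r : ℝ, 0 < r → DifferentiableAt ℂ (fun w : ℂ => logSolution (r * w)) z :=
    fun r hr => (differentiableAt_logSolution (Complex.ofReal_mul_mem_slitPlane hr hz)).comp
      (f := fun w : ℂ => (r : ℂ) * w) z (by fun_prop)
  have hG : ∀ r : ℝ, DifferentiableAt ℂ (fun w : ℂ => g (r * w)) z := fun r =>
    (hg _).comp (f := fun w : ℂ => (r : ℂ) * w) z (by fun_prop)
  have hT : DifferentiableAt ℂ (logToll p) z :=
    ((differentiableAt_logSolution hz).sub (hL p hp0)).sub (hL (1 - p) (by linarith))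
  have hE : ∀ r : ℂ, DifferentiableAt ℂ (fun w : ℂ => Complex.exp (r * w)) z := fun r => by
    fun_prop
  exact (((hg z).sub ((hE _).mul (hG p))).sub ((hE _).mul (hG (1 - p)))).sub (hT.const_mul _)

/-- The exponents 2 - b at the origin and b at infinity lie symmetrically about 1, which gives the
common rate 1 - b. -/
theorem sectorDecay_reducedToll {p c θ b C₁ C₀ : ℝ} {g : ℂ → ℂ} (hp0 : 0 < p) (hp1 : p < 1)
    (hg : Differentiable ℂ g) (hθ0 : 0 < θ) (hθ : θ < Real.pi / 2) (hb0 : 0 < b) (hb : b < 1)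
    (hC₁ : 0 ≤ C₁) (hC₀ : 0 ≤ C₀) (h0 : ∀ z : ℂ, ‖z‖ ≤ 1 → ‖g z‖ ≤ C₀ * ‖z‖ ^ 2)
    (hin : ∀ z : ℂ, 1 ≤ ‖z‖ → |z.arg| ≤ θ → ‖g z - c * z‖ ≤ C₁ * ‖z‖ ^ b) :
    ∃ C, SectorDecay θ (1 - b) C (reducedToll p c g) := by
  have hpi := Real.pi_pos
  obtain ⟨C, hC, h⟩ := norm_reducedToll_le (r := 2 - b) hp0 hp1 hθ0 hθ (by linarith) hb hC₁ hC₀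
    h0 hin
  refine ⟨C, ⟨fun z hz => ?_, fun z hz hzθ => ?_⟩⟩
  · refine (differentiableAt_reducedToll hp0 hp1 hg ?_).differentiableWithinAt
    refine Complex.mem_slitPlane_iff_arg.2 ⟨fun h => ?_, hz.1⟩
    have := hz.2
    rw [h, abs_of_pos hpi] at this
    linarith
  · have hn : 0 < ‖z‖ := norm_pos_iff.2 hz
    rw [mul_assoc]
    rcases le_total ‖z‖ 1 with h1 | h1
    · refine ((h z hz hzθ.le).1 h1).trans (le_of_eq ?_)
      rw [abs_of_nonpos (Real.log_nonpos hn.le h1), Real.rpow_def_of_pos hn]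
      nth_rw 2 [← Real.exp_log hn]
      rw [← Real.exp_add]
      congr 2
      ring
    · refine ((h z hz hzθ.le).2 h1).trans (le_of_eq ?_)
      rw [abs_of_nonneg (Real.log_nonneg h1), Real.rpow_def_of_pos hn]
      nth_rw 2 [← Real.exp_log hn]
      rw [← Real.exp_add]
      congr 2
      ring

theorem mellin_reducedToll {p c θ α β : ℝ} {a : ℕ → ℝ} {g : ℂ → ℂ} (hp0 : 0 < p) (hp1 : p < 1)
    (ha : IsPoissonGF a g) (ha0 : a 0 = 0) (ha1 : a 1 = 0) (hg : Differentiable ℂ g)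
    (hθ0 : 0 < θ) (hθ : θ < Real.pi / 2) (hα : α < 1)
    (hin : SectorBound θ α β fun z => g z - (c : ℂ) * z) {s : ℂ} (h2 : -2 < s.re)
    (h1 : s.re < -α) :
    MellinConvergent (fun t : ℝ => reducedToll p c g t) s ∧
      DifferentiableAt ℂ (mellin fun t : ℝ => reducedToll p c g t) s := by
  obtain ⟨C₀, hC₀, h0⟩ := ha.norm_le_sq ha0 ha1
  -- The exponents b at infinity and r at the origin are adapted to s, so that s lies in the open
  -- strip -r < Re s < -b. The strip of the lemma contains -1, since α < 1.
  obtain ⟨b, hb1, hb2⟩ := exists_between (lt_min hα (show α < -s.re by linarith))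
  obtain ⟨r, hr1, hr2⟩ := exists_between (show -s.re < 2 by linarith)
  obtain ⟨C₁, hC₁, hin'⟩ := hin.exists_rpow hb1
  obtain ⟨C, hC, h⟩ := norm_reducedToll_le (c := c) hp0 hp1 hθ0 hθ hr2
    (hb2.trans_le (min_le_left _ _)) hC₁ hC₀ h0 hin'
  have harg : ∀ t : ℝ, 0 < t → |(t : ℂ).arg| ≤ θ := fun t ht => by
    rw [Complex.arg_ofReal_of_nonneg ht.le, abs_zero]
    exact hθ0.le
  have hnorm : ∀ t : ℝ, 0 < t → ‖(t : ℂ)‖ = t := fun t ht => by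
    rw [Complex.norm_real, Real.norm_of_nonneg ht.le]
  have hloc : LocallyIntegrableOn (fun t : ℝ => reducedToll p c g t) (Set.Ioi 0) := by
    refine ContinuousOn.locallyIntegrableOn (fun t ht => ?_) measurableSet_Ioi
    have ht' : (0 : ℝ) < t := ht
    have := (differentiableAt_reducedToll (c := c) hp0 hp1 hg
      (Complex.ofReal_mem_slitPlane.2 ht')).continuousAt
    exact (this.comp (f := fun t : ℝ => (t : ℂ))
      Complex.continuous_ofReal.continuousAt).continuousWithinAt
  have htop : (fun t : ℝ => reducedToll p c g t) =O[atTop] fun t : ℝ => t ^ (-(-b)) := by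
    refine Asymptotics.IsBigO.of_bound C ?_
    filter_upwards [eventually_ge_atTop 1] with t ht
    have ht' : 0 < t := by linarith
    have := (h t (by exact_mod_cast ht'.ne') (harg t ht')).2 (by rwa [hnorm t ht'])
    rw [hnorm t ht'] at this
    rwa [neg_neg, Real.norm_of_nonneg (by positivity)]
  have hbot : (fun t : ℝ => reducedToll p c g t) =O[𝓝[>] 0] fun t : ℝ => t ^ (-(-r)) := by
    refine Asymptotics.IsBigO.of_bound C ?_
    filter_upwards [self_mem_nhdsWithin, nhdsWithin_le_nhds (gt_mem_nhds one_pos)] with t ht ht1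
    have ht' : (0 : ℝ) < t := ht
    have := (h t (by exact_mod_cast ht'.ne') (harg t ht')).1 (by rw [hnorm t ht']; exact ht1.le)
    rw [hnorm t ht'] at this
    rwa [neg_neg, Real.norm_of_nonneg (by positivity)]
  have hs1 : s.re < -b := by linarith [hb2.trans_le (min_le_right _ _)]
  have hs2 : -r < s.re := by linarith
  exact ⟨mellinConvergent_of_isBigO_rpow hloc htop hs1 hbot hs2,
    mellin_differentiableAt_of_isBigO_rpow hloc htop hs1 hbot hs2⟩

/-- At these points p^(-s) = p and q^(-s) = q, so the first factor is 1 - p - q = 0 and removing the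
logarithmic part leaves the Fourier coefficients unchanged. At k = 0 the other factor is a
placeholder value at the pole of Γ; the series omits that index. -/
theorem logTollMellin_chi {p : ℝ} (hp0 : 0 < p) (hp1 : p < 1) (h : IsLattice p) (k : ℤ) :
    logTollMellin p (-1 + chi p k) = 0 := by
  obtain ⟨r, m, l, hr, hm, -, hl, hnum, hlp, hlq⟩ := h.exists_span hp0 hp1
  have hq0 : 0 < 1 - p := by linarith
  have hchi : chi p k = -(2 * k * Real.pi * Complex.I / (l : ℂ)) := by
    have e : Real.log p = -(r * l) := by linarith
    have hr' : (r : ℂ) ≠ 0 := by exact_mod_cast hr.ne'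
    have hl' : (l : ℂ) ≠ 0 := by exact_mod_cast hl.ne'
    rw [chi, hnum, e]
    push_cast
    field_simp
  have hpow : ∀ (x : ℝ) (j : ℕ), 0 < x → -Real.log x = j * l →
      (x : ℂ) ^ (-(-1 + chi p k)) = x := by
    intro x j hx hj
    have hx' : (x : ℂ) ≠ 0 := by exact_mod_cast hx.ne'
    have hl' : (l : ℂ) ≠ 0 := by exact_mod_cast hl.ne'
    have e : Real.log x = -(j * l) := by linarith
    rw [show -(-1 + chi p k) = 1 + -chi p k by ring, Complex.cpow_add _ _ hx', Complex.cpow_one,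
      Complex.cpow_def_of_ne_zero hx', ← Complex.ofReal_log hx.le, e, hchi]
    have : ((-(j * l) : ℝ) : ℂ) * - -(2 * k * Real.pi * Complex.I / (l : ℂ))
        = ((-(j * k) : ℤ) : ℂ) * (2 * Real.pi * Complex.I) := by
      push_cast
      field_simp
    rw [this, Complex.exp_int_mul_two_pi_mul_I, mul_one]
  rw [logTollMellin, hpow p r hp0 hlp, hpow (1 - p) m hq0 hlq]
  push_cast
  ring

theorem tendsto_logSolution_div_zero :
    Tendsto (fun x : ℝ => logSolution x / x) (𝓝[>] 0) (𝓝 0) := by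
  have h0 : Tendsto (fun x : ℝ => |Real.log x * x|) (𝓝[>] 0) (𝓝 0) := by
    have := (Real.continuous_mul_log.tendsto 0).abs
    simp only [zero_mul, abs_zero] at this
    refine (this.mono_left nhdsWithin_le_nhds).congr fun x => ?_
    rw [mul_comm]
  refine squeeze_zero_norm' ?_ h0
  filter_upwards [self_mem_nhdsWithin] with x hx
  have hx' : (0 : ℝ) < x := hx
  have hne : (x : ℂ) ≠ 0 := by exact_mod_cast hx'.ne'
  rw [logSolution, mul_div_cancel_left₀ _ hne, norm_mul, ← Complex.ofReal_log hx'.le,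
    Complex.norm_real, Real.norm_eq_abs, abs_mul, abs_of_pos hx']
  exact mul_le_mul_of_nonneg_left (norm_one_sub_exp_neg_le hx'.le).2 (abs_nonneg _)

theorem tendsto_logSolution_div_sub_log :
    Tendsto (fun n : ℕ => logSolution ((n : ℝ) : ℂ) / ((n : ℝ) : ℂ) - (Real.log n : ℂ)) atTop
      (𝓝 0) := by
  have h0 : Tendsto (fun n : ℕ => (n : ℝ) ^ 1 * Real.exp (-(n : ℝ))) atTop (𝓝 0) :=
    (Real.tendsto_pow_mul_exp_neg_atTop_nhds_zero 1).comp tendsto_natCast_atTop_atTop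
  refine squeeze_zero_norm' ?_ h0
  filter_upwards [eventually_ge_atTop 1] with n hn
  have hn' : (1 : ℝ) ≤ n := by exact_mod_cast hn
  have hne : ((n : ℝ) : ℂ) ≠ 0 := by
    have : (n : ℝ) ≠ 0 := by linarith
    exact_mod_cast this
  have e : logSolution ((n : ℝ) : ℂ) / ((n : ℝ) : ℂ) - (Real.log n : ℂ)
      = ((-(Real.log n * Real.exp (-(n : ℝ))) : ℝ) : ℂ) := by
    rw [logSolution, mul_div_cancel_left₀ _ hne, ← Complex.ofReal_log (by linarith)]
    push_cast
    ring
  rw [e, Complex.norm_real, norm_neg, norm_mul, Real.norm_of_nonneg (Real.log_nonneg hn'),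
    Real.norm_of_nonneg (Real.exp_pos _).le, pow_one]
  gcongr
  exact Real.log_le_self (by linarith)

/-! ### The recurrence for the mean -/

theorem sum_range_succ_eq_sum_Ioo {M : Type*} [AddCommMonoid M] (f : ℕ → M) {n : ℕ}
    (hn : 0 < n) : ∑ k ∈ Finset.range (n + 1), f k = f 0 + (f n + ∑ k ∈ Finset.Ioo 0 n, f k) := by
  have : Finset.range (n + 1) = insert 0 (insert n (Finset.Ioo 0 n)) := by
    ext k
    simp only [Finset.mem_range, Finset.mem_insert, Finset.mem_Ioo]
    omega
  rw [this, Finset.sum_insert, Finset.sum_insert]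
  · simp
  · simp only [Finset.mem_insert, Finset.mem_Ioo]
    omega

theorem one_sub_pow_sub_pow_pos {p : ℝ} (hp0 : 0 < p) (hp1 : p < 1) {n : ℕ} (hn : 2 ≤ n) :
    0 < 1 - p ^ n - (1 - p) ^ n := by
  have h1 : p ^ n ≤ p ^ 2 := pow_le_pow_of_le_one hp0.le hp1.le hn
  have h2 : (1 - p) ^ n ≤ (1 - p) ^ 2 :=
    pow_le_pow_of_le_one (by linarith) (by linarith) hn
  nlinarith [mul_pos hp0 (sub_pos.2 hp1)]

theorem patriciaSplit_nonneg {p : ℝ} (hp0 : 0 < p) (hp1 : p < 1) {n : ℕ} (hn : 2 ≤ n) (k : ℕ) :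
    0 ≤ patriciaSplit p n k :=
  div_nonneg (mul_nonneg (mul_nonneg (Nat.cast_nonneg _) (pow_nonneg hp0.le _))
    (pow_nonneg (by linarith) _)) (one_sub_pow_sub_pow_pos hp0 hp1 hn).le

theorem sum_patriciaSplit {p : ℝ} (hp0 : 0 < p) (hp1 : p < 1) {n : ℕ} (hn : 2 ≤ n) :
    ∑ k ∈ Finset.Ioo 0 n, patriciaSplit p n k = 1 := by
  have hD := one_sub_pow_sub_pow_pos hp0 hp1 hn
  have h := add_pow p (1 - p) n
  rw [sum_range_succ_eq_sum_Ioo _ (by omega), add_sub_cancel, one_pow] at h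
  simp only [pow_zero, Nat.sub_zero, Nat.choose_zero_right, Nat.cast_one, mul_one, one_mul,
    Nat.sub_self, Nat.choose_self] at h
  unfold patriciaSplit
  rw [← Finset.sum_div, div_eq_one_iff_eq hD.ne']
  have e : ∑ k ∈ Finset.Ioo 0 n, (n.choose k : ℝ) * p ^ k * (1 - p) ^ (n - k)
      = ∑ k ∈ Finset.Ioo 0 n, p ^ k * (1 - p) ^ (n - k) * (n.choose k : ℝ) :=
    Finset.sum_congr rfl fun k _ => by ring
  linear_combination e - h

/-- Isolates the terms k = 0 and k = n, which the conditioned split excludes; since x 0 = 0 they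
amount to (p^n + q^n) x n. -/
theorem binomialMean_add_swap {p q : ℝ} {x : ℕ → ℝ} (hx : x 0 = 0) {n : ℕ} (hn : 0 < n) :
    binomialMean p q x n + binomialMean q p x n = (p ^ n + q ^ n) * x n
      + ∑ k ∈ Finset.Ioo 0 n, (n.choose k : ℝ) * p ^ k * q ^ (n - k) * (x k + x (n - k)) := by
  have e : binomialMean q p x n
      = ∑ ij ∈ Finset.HasAntidiagonal.antidiagonal n,
        (n.choose ij.1 : ℝ) * (p ^ ij.1 * q ^ ij.2 * x ij.2) := by
    rw [binomialMean, ← Finset.Nat.sum_antidiagonal_swap]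
    refine Finset.sum_congr rfl fun ij hij => ?_
    have hij' := Finset.HasAntidiagonal.mem_antidiagonal.1 hij
    simp only [Prod.fst_swap, Prod.snd_swap]
    rw [Nat.choose_symm_of_eq_add (by omega : n = ij.2 + ij.1)]
    ring
  rw [e, binomialMean, ← Finset.sum_add_distrib,
    Finset.Nat.sum_antidiagonal_eq_sum_range_succ (fun i j => (n.choose i : ℝ) *
      (p ^ i * q ^ j * x i) + (n.choose i : ℝ) * (p ^ i * q ^ j * x j)),
    sum_range_succ_eq_sum_Ioo _ hn]
  simp only [hx, Nat.sub_zero, Nat.sub_self, Nat.choose_zero_right, Nat.choose_self, pow_zero,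
    Nat.cast_one]
  rw [← add_assoc]
  congr 1
  · ring
  · exact Finset.sum_congr rfl fun k _ => by ring

namespace IsPatriciaParameter

variable {Ω : Type*} [MeasurableSpace Ω] {P : Measure Ω} {p : ℝ}
  {X Xs : ℕ → Ω → ℝ} {I : ℕ → Ω → ℕ} {T : ℕ → Ω → ℝ}

/-- The law of I n is prescribed only on 1 ≤ k < n, but these masses already sum to 1. -/
theorem split_mem_ae [IsProbabilityMeasure P] (hX : IsPatriciaParameter P p X Xs I T) (hp0 : 0 < p) (hp1 : p < 1) {n : ℕ}
    (hn : 2 ≤ n) : ∀ᵐ ω ∂P, I n ω ∈ Finset.Ioo 0 n := by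
  have hm : ∀ k, MeasurableSet {ω | I n ω = k} := fun k =>
    hX.split_measurable n (measurableSet_singleton k)
  have hset : {ω | I n ω ∈ Finset.Ioo 0 n} = ⋃ k ∈ Finset.Ioo 0 n, {ω | I n ω = k} := by
    ext ω
    simp
  have hmeas : MeasurableSet {ω | I n ω ∈ Finset.Ioo 0 n} := by
    rw [hset]
    exact Finset.measurableSet_biUnion _ fun k _ => hm k
  refine (mem_ae_iff_prob_eq_one hmeas).2 ?_
  rw [hset, measure_biUnion_finset _ fun k _ => hm k]
  · rw [Finset.sum_congr rfl fun k hk => hX.split_law n hn k (Finset.mem_Ioo.1 hk).1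
      (Finset.mem_Ioo.1 hk).2, ← ENNReal.ofReal_sum_of_nonneg fun k _ =>
      patriciaSplit_nonneg hp0 hp1 hn k, sum_patriciaSplit hp0 hp1 hn, ENNReal.ofReal_one]
  · intro i _ j _ hij
    refine Set.disjoint_left.2 fun ω hi hj => hij ?_
    exact (show I n ω = i from hi).symm.trans hj

theorem recurrence_ae_eq [IsProbabilityMeasure P] (hX : IsPatriciaParameter P p X Xs I T) (hp0 : 0 < p) (hp1 : p < 1)
    {n : ℕ} (hn : 2 ≤ n) :
    (fun ω => X (I n ω) ω + Xs (n - I n ω) ω + T n ω) =ᵐ[P] fun ω =>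
      ∑ k ∈ Finset.Ioo 0 n, {ω | I n ω = k}.indicator (fun ω => X k ω + Xs (n - k) ω) ω
        + T n ω := by
  filter_upwards [hX.split_mem_ae hp0 hp1 hn] with ω hω
  rw [Finset.sum_eq_single (I n ω)]
  · simp [Set.indicator]
  · intro k _ hk
    have : ω ∉ {ω | I n ω = k} := fun h => hk (show I n ω = k from h).symm
    exact Set.indicator_of_notMem this _
  · exact fun h => absurd hω h

theorem integrable [IsProbabilityMeasure P] (hX : IsPatriciaParameter P p X Xs I T) (hp0 : 0 < p) (hp1 : p < 1)
    (hT : ∀ n, Integrable (T n) P) (n : ℕ) : Integrable (X n) P := by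
  induction n using Nat.strong_induction_on with
  | _ n ih =>
    rcases Nat.lt_or_ge n 2 with hn | hn
    · interval_cases n
      · exact (integrable_zero Ω ℝ P).congr hX.init_zero.symm
      · exact (integrable_zero Ω ℝ P).congr hX.init_one.symm
    · rw [(hX.recurrence n hn).integrable_iff]
      refine Integrable.congr ?_ (hX.recurrence_ae_eq hp0 hp1 hn).symm
      refine (integrable_finsetSum _ fun k hk => ?_).add (hT n)
      obtain ⟨h1, h2⟩ := Finset.mem_Ioo.1 hk
      exact ((ih k h2).add (((hX.copy (n - k)).integrable_iff).2 (ih _ (by omega)))).indicator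
        (hX.split_measurable n (measurableSet_singleton k))

theorem setIntegral_split {Y : Ω → ℝ} {n k : ℕ} (hX : IsPatriciaParameter P p X Xs I T)
    (hp0 : 0 < p) (hp1 : p < 1) (hn : 2 ≤ n) (hk : 1 ≤ k) (hkn : k < n) (hY : Integrable Y P)
    (hind : IndepFun Y (fun ω => (I n ω : ℝ)) P) :
    ∫ ω, {ω | I n ω = k}.indicator Y ω ∂P = patriciaSplit p n k * ∫ ω, Y ω ∂P := by
  have hm : MeasurableSet {ω | I n ω = k} := hX.split_measurable n (measurableSet_singleton k)
  have hψ : Measurable (Set.indicator {(k : ℝ)} (fun _ : ℝ => (1 : ℝ))) :=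
    measurable_const.indicator (measurableSet_singleton _)
  have h := hind.comp measurable_id hψ
  have e : ∀ ω, Set.indicator {(k : ℝ)} (fun _ : ℝ => (1 : ℝ)) (I n ω : ℝ)
      = {ω | I n ω = k}.indicator (fun _ => (1 : ℝ)) ω := fun ω => by
    by_cases hω : I n ω = k
    · simp [hω]
    · simp [Set.indicator, hω]
  have hfun : (Set.indicator {(k : ℝ)} (fun _ : ℝ => (1 : ℝ))) ∘ (fun ω => (I n ω : ℝ))
      = {ω | I n ω = k}.indicator (fun _ => (1 : ℝ)) := funext e
  rw [hfun] at h
  have hmul := h.integral_fun_mul_eq_mul_integral hY.aestronglyMeasurable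
    (measurable_const.indicator hm).aestronglyMeasurable
  have hpt : ∀ ω, {ω | I n ω = k}.indicator Y ω
      = (id ∘ Y) ω * {ω | I n ω = k}.indicator (fun _ => (1 : ℝ)) ω := fun ω => by
    by_cases hω : I n ω = k
    · simp [hω]
    · simp [Set.indicator, hω]
  simp_rw [hpt]
  rw [hmul, integral_indicator_const _ hm, Measure.real, hX.split_law n hn k hk hkn,
    ENNReal.toReal_ofReal (patriciaSplit_nonneg hp0 hp1 hn k), mul_comm, smul_eq_mul, mul_one]
  rfl

theorem integral_eq [IsProbabilityMeasure P] (hX : IsPatriciaParameter P p X Xs I T) (hp0 : 0 < p) (hp1 : p < 1)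
    (hT : ∀ n, Integrable (T n) P) {n : ℕ} (hn : 2 ≤ n) :
    ∫ ω, X n ω ∂P = ∑ k ∈ Finset.Ioo 0 n, patriciaSplit p n k
      * (∫ ω, X k ω ∂P + ∫ ω, X (n - k) ω ∂P) + ∫ ω, T n ω ∂P := by
  have hi := hX.integrable hp0 hp1 hT
  have his : ∀ k, Integrable (Xs k) P := fun k => ((hX.copy k).integrable_iff).2 (hi k)
  have hm : ∀ k, MeasurableSet {ω | I n ω = k} := fun k =>
    hX.split_measurable n (measurableSet_singleton k)
  have hint : ∀ k, Integrable
      ({ω | I n ω = k}.indicator fun ω => X k ω + Xs (n - k) ω) P := fun k =>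
    ((hi k).add (his (n - k))).indicator (hm k)
  rw [(hX.recurrence n hn).integral_eq, integral_congr_ae (hX.recurrence_ae_eq hp0 hp1 hn),
    integral_add (integrable_finsetSum _ fun k _ => hint k) (hT n),
    integral_finsetSum _ fun k _ => hint k]
  congr 1
  refine Finset.sum_congr rfl fun k hk => ?_
  obtain ⟨h1, h2⟩ := Finset.mem_Ioo.1 hk
  have hind := hX.indep n hn k h1 h2
  have h03 : IndepFun (X k) (fun ω => (I n ω : ℝ)) P :=
    hind.indepFun (i := 0) (j := 3) (by decide)
  have h13 : IndepFun (Xs (n - k)) (fun ω => (I n ω : ℝ)) P :=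
    hind.indepFun (i := 1) (j := 3) (by decide)
  have e1 := hX.setIntegral_split hp0 hp1 hn h1 h2 (hi k) h03
  have e2 := hX.setIntegral_split hp0 hp1 hn h1 h2 (his (n - k)) h13
  rw [mul_add, ← (hX.copy (n - k)).integral_eq, ← e1, ← e2,
    ← integral_add ((hi k).indicator (hm k)) ((his (n - k)).indicator (hm k))]
  refine integral_congr_ae (Eventually.of_forall fun ω => ?_)
  by_cases hω : I n ω = k
  · simp [hω]
  · simp [Set.indicator, hω]

theorem integral_zero (hX : IsPatriciaParameter P p X Xs I T) : ∫ ω, X 0 ω ∂P = 0 := by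
  rw [integral_congr_ae hX.init_zero]
  simp

theorem integral_one (hX : IsPatriciaParameter P p X Xs I T) : ∫ ω, X 1 ω ∂P = 0 := by
  rw [integral_congr_ae hX.init_one]
  simp

/-- Clearing the denominator of the split gives an equation valid for every n: at n = 1 the toll
factor vanishes, and at n = 0 it is -1 but the mean toll is 0. -/
theorem integral_eq_binomialMean [IsProbabilityMeasure P] (hX : IsPatriciaParameter P p X Xs I T) (hp0 : 0 < p)
    (hp1 : p < 1) (hT : ∀ n, Integrable (T n) P) (hT0 : ∫ ω, T 0 ω ∂P = 0) (n : ℕ) :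
    ∫ ω, X n ω ∂P = binomialMean p (1 - p) (fun k => ∫ ω, X k ω ∂P) n
      + binomialMean (1 - p) p (fun k => ∫ ω, X k ω ∂P) n
      + (1 - p ^ n - (1 - p) ^ n) * ∫ ω, T n ω ∂P := by
  have h0 := hX.integral_zero
  have h1 := hX.integral_one
  rcases Nat.lt_or_ge n 2 with hn | hn
  · interval_cases n
    · simp [binomialMean, h0, hT0]
    · rw [binomialMean_add_swap h0 one_pos]
      have : Finset.Ioo 0 1 = (∅ : Finset ℕ) := rfl
      simp [h1, this]
  · have hD := one_sub_pow_sub_pow_pos hp0 hp1 hn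
    rw [binomialMean_add_swap h0 (by omega)]
    have h := hX.integral_eq hp0 hp1 hT hn
    have hs : ∑ k ∈ Finset.Ioo 0 n, (n.choose k : ℝ) * p ^ k * (1 - p) ^ (n - k)
          * (∫ ω, X k ω ∂P + ∫ ω, X (n - k) ω ∂P)
        = (1 - p ^ n - (1 - p) ^ n) * ∑ k ∈ Finset.Ioo 0 n, patriciaSplit p n k
          * (∫ ω, X k ω ∂P + ∫ ω, X (n - k) ω ∂P) := by
      rw [Finset.mul_sum]
      refine Finset.sum_congr rfl fun k _ => ?_
      rw [patriciaSplit]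
      field_simp
    rw [hs]
    linear_combination (1 - p ^ n - (1 - p) ^ n) * h

end IsPatriciaParameter

/-! ### Asymptotics of the mean -/

/-- Outside the sector |e^z| ≤ e^(|z| cos θ), and half of the gap 1 - cos θ absorbs the power of
|z|. -/
theorem exists_norm_exp_mul_rpow_le {θ : ℝ} (hθ0 : 0 < θ) (hθ : θ < Real.pi / 2) (b : ℝ) :
    ∃ B : ℝ, 0 ≤ B ∧ ∀ z : ℂ, 1 ≤ ‖z‖ → θ ≤ |z.arg| →
      ‖Complex.exp z‖ * ‖z‖ ^ b ≤ B * Real.exp ((1 - (1 - Real.cos θ) / 2) * ‖z‖) := by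
  have hpi := Real.pi_pos
  have hcos : Real.cos θ < 1 := by
    have := Real.cos_lt_cos_of_nonneg_of_le_pi (le_refl 0) (by linarith : θ ≤ Real.pi) hθ0
    rwa [Real.cos_zero] at this
  set m := (1 - Real.cos θ) / 2 with hm
  have hm0 : 0 < m := by rw [hm]; linarith
  obtain ⟨B, hB, hB'⟩ := rpow_mul_exp_bounded (-b) hm0
  refine ⟨B, hB, fun z hz hzθ => ?_⟩
  have hz0 : 0 < ‖z‖ := by linarith
  have hre : z.re ≤ Real.cos θ * ‖z‖ := by
    rw [← Complex.norm_mul_cos_arg, mul_comm, ← Real.cos_abs]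
    gcongr
    exact Real.cos_le_cos_of_nonneg_of_le_pi hθ0.le (Complex.abs_arg_le_pi z) hzθ
  have h1 := hB' ‖z‖ hz
  have h2 : ‖z‖ ^ b ≤ B * Real.exp (m * ‖z‖) := by
    rw [Real.rpow_neg hz0.le, Real.exp_neg, ← div_eq_mul_inv, le_div_iff₀ (by positivity),
      inv_mul_le_iff₀ (Real.exp_pos _), mul_comm] at h1
    exact h1
  calc ‖Complex.exp z‖ * ‖z‖ ^ b
      ≤ Real.exp (Real.cos θ * ‖z‖) * (B * Real.exp (m * ‖z‖)) := by
        rw [Complex.norm_exp]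
        gcongr
    _ = B * Real.exp ((1 - m) * ‖z‖) := by
        rw [mul_left_comm, ← Real.exp_add]
        congr 2
        rw [hm]
        ring

/-- The exponential bound for a JS-admissible function holds outside every sector of positive
opening. -/
theorem JSAdmissible.exists_exp_bound {g : ℂ → ℂ} (hg : JSAdmissible g) {θ : ℝ} (hθ0 : 0 < θ)
    (hθ : θ < Real.pi / 2) (c : ℝ) :
    ∃ ε C : ℝ, 0 < ε ∧ 0 ≤ C ∧ ∀ z : ℂ, 1 ≤ ‖z‖ → θ ≤ |z.arg| →
      ‖Complex.exp z * (g z - c * z)‖ ≤ C * Real.exp ((1 - ε) * ‖z‖) := by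
  obtain ⟨α, β, -, θ', hθ'0, hθ', hin, ε, hε, C, hC⟩ := hg
  obtain ⟨C₁, hC₁, hin'⟩ := hin.exists_rpow (lt_add_one α)
  obtain ⟨B, hB, hB'⟩ := exists_norm_exp_mul_rpow_le hθ0 hθ (α + 1)
  obtain ⟨B₁, hB₁, hB₁'⟩ := exists_norm_exp_mul_rpow_le hθ0 hθ 1
  have hcos : Real.cos θ < 1 := by
    have := Real.cos_lt_cos_of_nonneg_of_le_pi (le_refl 0) (by linarith [Real.pi_pos]) hθ0
    rwa [Real.cos_zero] at this
  set m := (1 - Real.cos θ) / 2 with hm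
  have hm0 : 0 < m := by rw [hm]; linarith
  refine ⟨min ε m, |C| + C₁ * B + |c| * B₁, lt_min hε hm0, by positivity, fun z hz hzθ => ?_⟩
  set E := Real.exp ((1 - min ε m) * ‖z‖) with hE
  have hE0 : 0 < E := Real.exp_pos _
  have hEm : Real.exp ((1 - m) * ‖z‖) ≤ E := by
    rw [hE]; gcongr; exact min_le_right _ _
  have hEε : Real.exp ((1 - ε) * ‖z‖) ≤ E := by
    rw [hE]; gcongr; exact min_le_left _ _
  have h1 : ‖Complex.exp z * g z‖ ≤ (|C| + C₁ * B) * E := by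
    -- The angle θ' of the class may exceed θ; in the region between them the polynomial bound of
    -- the class replaces its exponential one.
    rcases le_total θ' |z.arg| with h | h
    · calc ‖Complex.exp z * g z‖ ≤ C * Real.exp ((1 - ε) * ‖z‖) := hC z hz h
        _ ≤ |C| * E := mul_le_mul (le_abs_self C) hEε (Real.exp_pos _).le (abs_nonneg C)
        _ ≤ (|C| + C₁ * B) * E := by
          gcongr
          exact le_add_of_nonneg_right (by positivity)
    · calc ‖Complex.exp z * g z‖ ≤ ‖Complex.exp z‖ * (C₁ * ‖z‖ ^ (α + 1)) := by
            rw [norm_mul]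
            exact mul_le_mul_of_nonneg_left (hin' z hz h) (norm_nonneg _)
        _ = C₁ * (‖Complex.exp z‖ * ‖z‖ ^ (α + 1)) := by ring
        _ ≤ C₁ * (B * E) := mul_le_mul_of_nonneg_left
            ((hB' z hz hzθ).trans (mul_le_mul_of_nonneg_left hEm hB)) hC₁
        _ ≤ (|C| + C₁ * B) * E := by
          rw [← mul_assoc]
          gcongr
          exact le_add_of_nonneg_left (abs_nonneg C)
  have h2 : ‖Complex.exp z * (c * z)‖ ≤ |c| * B₁ * E := by
    calc ‖Complex.exp z * (c * z)‖ = |c| * (‖Complex.exp z‖ * ‖z‖ ^ (1 : ℝ)) := by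
          rw [norm_mul, norm_mul, Complex.norm_real, Real.norm_eq_abs, Real.rpow_one]
          ring
      _ ≤ |c| * (B₁ * E) := mul_le_mul_of_nonneg_left
          ((hB₁' z hz hzθ).trans (mul_le_mul_of_nonneg_left hEm hB₁)) (abs_nonneg c)
      _ = _ := by ring
  rw [mul_sub]
  refine (norm_sub_le _ _).trans ?_
  linarith

theorem IsPoissonGF.sub_linear {a : ℕ → ℝ} {g : ℂ → ℂ} (ha : IsPoissonGF a g) (c : ℝ) :
    IsPoissonGF (fun n => a n - c * n) fun z => g z - c * z := by
  intro z
  have h : HasSum (fun n : ℕ => (n : ℂ) * z ^ n / (n.factorial : ℂ)) (z * Complex.exp z) := by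
    rw [← hasSum_nat_add_iff' 1]
    have he : HasSum (fun n : ℕ => z ^ n / (n.factorial : ℂ)) (Complex.exp z) := by
      rw [Complex.exp_eq_exp_ℂ]
      exact NormedSpace.expSeries_div_hasSum_exp z
    simp only [Finset.sum_range_one, Nat.cast_zero, zero_mul, zero_div, sub_zero]
    refine (he.mul_left z).congr_fun fun n => ?_
    have hn : ((n : ℂ) + 1) ≠ 0 := by exact_mod_cast n.succ_ne_zero
    have hf : (n.factorial : ℂ) ≠ 0 := by exact_mod_cast n.factorial_ne_zero
    rw [Nat.factorial_succ]
    push_cast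
    field_simp
    ring
  have e : Complex.exp z * (g z - c * z) = Complex.exp z * g z - c * (z * Complex.exp z) := by
    ring
  rw [e]
  refine ((ha z).sub (h.mul_left (c : ℂ))).congr_fun fun n => ?_
  push_cast
  ring

/-- The circle estimate is applied to a_n - cn, whose Poisson transform is g(z) - cz. Restoring cn
adds the constant c to the increments, which is harmless because b > 1/2. -/
theorem exists_toll_increment_bound {c θ b C₁ : ℝ} {a : ℕ → ℝ} {g : ℂ → ℂ}
    (ha : IsPoissonGF a g) (ha0 : a 0 = 0) (ha1 : a 1 = 0) (hg : JSAdmissible g) (hθ0 : 0 < θ)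
    (hθ : θ < Real.pi / 2) (hb : 1 / 2 < b) (hC₁ : 0 ≤ C₁)
    (hin : ∀ z : ℂ, 1 ≤ ‖z‖ → |z.arg| ≤ θ → ‖g z - c * z‖ ≤ C₁ * ‖z‖ ^ b) :
    ∃ C, 0 ≤ C ∧ ∀ n : ℕ, |a (n + 1) - a n| ≤ C * (n : ℝ) ^ (b - 1 / 2) := by
  obtain ⟨ε, C₂, hε, hC₂, hout⟩ := hg.exists_exp_bound hθ0 hθ c
  obtain ⟨-, -, hd, -⟩ := hg
  obtain ⟨C, hC, h⟩ := increment_bound_of_poissonGF (by linarith) hε hC₁ hC₂ (ha.sub_linear c)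
    (hd.sub (by fun_prop)) hin hout
  refine ⟨C + |c|, by positivity, fun n => ?_⟩
  rcases Nat.eq_zero_or_pos n with rfl | hn
  · simp [ha0, ha1]
    positivity
  · have h1 : (1 : ℝ) ≤ (n : ℝ) ^ (b - 1 / 2) :=
      Real.one_le_rpow (by exact_mod_cast hn) (by linarith)
    have h2 := h n hn
    push_cast at h2
    calc |a (n + 1) - a n| = |(a (n + 1) - c * (n + 1) - (a n - c * n)) + c| := by ring_nf
      _ ≤ |a (n + 1) - c * (n + 1) - (a n - c * n)| + |c| := abs_add_le _ _
      _ ≤ C * (n : ℝ) ^ (b - 1 / 2) + |c| * (n : ℝ) ^ (b - 1 / 2) :=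
          add_le_add h2 (le_mul_of_one_le_right (abs_nonneg c) h1)
      _ = _ := by ring

theorem tendsto_mean_of_recurrence {p c θ α β : ℝ} {x a : ℕ → ℝ} {g : ℂ → ℂ} (hp0 : 0 < p)
    (hp1 : p < 1) (hx : ∀ n, x n = binomialMean p (1 - p) x n + binomialMean (1 - p) p x n
      + (1 - p ^ n - (1 - p) ^ n) * a n) (hx0 : x 0 = 0) (hx1 : x 1 = 0)
    (ha : IsPoissonGF a g) (ha0 : a 0 = 0) (ha1 : a 1 = 0) (hg : JSAdmissible g) (hθ0 : 0 < θ)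
    (hθ : θ < Real.pi / 2) (hα : α < 1) (hin : SectorBound θ α β fun z => g z - (c : ℂ) * z) :
    FluctuationSummable p (mellin fun t : ℝ => reducedToll p c g t) ∧
    Tendsto (fun n : ℕ => ((x n / n : ℝ) : ℂ)
      - (((c / Real.binEntropy p * Real.log n : ℝ) : ℂ)
        + mellin (fun t : ℝ => reducedToll p c g t) (-1) / (Real.binEntropy p : ℂ)
        + fluctuation p (mellin fun t : ℝ => reducedToll p c g t)
            ((latticeNum p : ℝ) * Real.logb (1 / p) n))) atTop (𝓝 0) := by
  have hq0 : 0 < 1 - p := by linarith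
  have hd : Differentiable ℂ g := by
    obtain ⟨-, -, hd, -⟩ := hg
    exact hd
  -- Here b > α absorbs the logarithm, b > 1/2 makes γ = b - 1/2 positive for the contraction, and b
  -- < 1 makes the depoissonization error n^γ √n = n^b negligible against n.
  obtain ⟨b, hb1, hb2⟩ := exists_between (max_lt hα (by norm_num : (1 / 2 : ℝ) < 1))
  have hαb : α < b := (le_max_left _ _).trans_lt hb1
  have hb0 : 1 / 2 < b := (le_max_right _ _).trans_lt hb1
  have hγ0 : 0 < b - 1 / 2 := by linarith
  have hγ1 : b - 1 / 2 ≤ 1 := by linarith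
  obtain ⟨C₁, hC₁, hin'⟩ := hin.exists_rpow hαb
  obtain ⟨C₀, hC₀, h0⟩ := ha.norm_le_sq ha0 ha1
  obtain ⟨C, hC, hinc⟩ := exists_toll_increment_bound ha ha0 ha1 hg hθ0 hθ hb0 hC₁ hin'
  obtain ⟨C', hC', hinc'⟩ := toll_increment_bound hp0 hp1 hγ0.le hγ1 hC hinc ha0 ha1
  obtain ⟨K, hK, hxinc⟩ := increment_bound hp0 hq0 (by ring) hγ0 hγ1 hC' hx hinc' hx0 hx1
  have hxb := abs_le_of_increment hγ0.le hγ1 hK hxinc hx0 hx1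
  obtain ⟨D, hD⟩ := sectorDecay_reducedToll (c := c) hp0 hp1 hd hθ0 hθ (by linarith) hb2 hC₁ hC₀
    h0 hin'
  -- Subtracting the approximate solution replaces the toll by `reducedToll`; after division by n
  -- the subtracted part returns as (c/h) log n + o(1).
  set f : ℝ → ℂ := fun t => ((Real.exp (-t) * expGF x t : ℝ) : ℂ)
    - (c : ℂ) / (Real.binEntropy p : ℂ) * logSolution t with hf
  have hfe : ∀ t, 0 < t → f t = f (p * t) + f ((1 - p) * t) + reducedToll p c g t := by
    intro t _
    have h1 := poisson_functional_equation hx hxb ha t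
    rw [patriciaToll_eq_reducedToll p c, logToll] at h1
    simp only [hf]
    rw [h1, Complex.ofReal_mul p t, Complex.ofReal_mul (1 - p) t]
    ring
  have hf0 : Tendsto (fun t : ℝ => f t / t) (𝓝[>] 0) (𝓝 0) := by
    have h1 : Tendsto (fun t : ℝ => ((Real.exp (-t) * expGF x t : ℝ) : ℂ) / t) (𝓝[>] 0)
        (𝓝 0) := by
      have hlim : Tendsto (fun t : ℝ => K * t) (𝓝[>] 0) (𝓝 0) := by
        have : Tendsto (fun t : ℝ => K * t) (𝓝 0) (𝓝 (K * 0)) :=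
          (continuous_const.mul continuous_id).tendsto 0
        rw [mul_zero] at this
        exact this.mono_left nhdsWithin_le_nhds
      refine squeeze_zero_norm' ?_ hlim
      filter_upwards [self_mem_nhdsWithin] with t ht
      have ht' : (0 : ℝ) < t := ht
      rw [norm_div, Complex.norm_real, Complex.norm_real, Real.norm_of_nonneg ht'.le, norm_mul,
        Real.norm_of_nonneg (Real.exp_pos _).le, Real.norm_eq_abs, div_le_iff₀ ht']
      calc Real.exp (-t) * |expGF x t| ≤ Real.exp (-t) * (K * t ^ 2 * Real.exp t) := by
            gcongr
            exact abs_expGF_le hxb ht'.le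
        _ = K * t ^ 2 * (Real.exp (-t) * Real.exp t) := by ring
        _ = K * t * t := by
            rw [← Real.exp_add, neg_add_cancel, Real.exp_zero]
            ring
    have h2 := h1.sub (tendsto_logSolution_div_zero.const_mul
      ((c : ℂ) / (Real.binEntropy p : ℂ)))
    rw [mul_zero, sub_zero] at h2
    refine h2.congr fun t => ?_
    simp only [hf]
    ring
  obtain ⟨hsum, hlim⟩ := tendsto_of_functional_equation hp0 hp1 hθ0
    (by linarith [Real.pi_pos]) (by linarith : 0 < 1 - b) hD hfe hf0
  refine ⟨hsum, ?_⟩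
  have hdep : Tendsto (fun n : ℕ => (((Real.exp (-n) * expGF x n - x n) / n : ℝ) : ℂ)) atTop
      (𝓝 0) := by
    have hz : Tendsto (fun n : ℕ => 2 * K * (n : ℝ) ^ (-(1 - b))) atTop (𝓝 0) := by
      have := ((tendsto_rpow_neg_atTop (by linarith : 0 < 1 - b)).comp
        tendsto_natCast_atTop_atTop).const_mul (2 * K)
      rwa [mul_zero] at this
    refine squeeze_zero_norm' ?_ hz
    filter_upwards [eventually_ge_atTop 1] with n hn
    have hn1 : (1 : ℝ) ≤ n := by exact_mod_cast hn
    have hn0 : (0 : ℝ) < n := by linarith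
    have h1 := depoissonization hγ0.le hγ1 hK hxinc hxb hn
    have hsq : (1 : ℝ) ≤ √n := Real.one_le_sqrt.2 hn1
    rw [Complex.norm_real, norm_div, Real.norm_eq_abs, Real.norm_of_nonneg hn0.le,
      div_le_iff₀ hn0]
    calc |Real.exp (-n) * expGF x n - x n| ≤ K * (n : ℝ) ^ (b - 1 / 2) * (√n + 1) := h1
      _ ≤ K * (n : ℝ) ^ (b - 1 / 2) * (2 * √n) := by gcongr; linarith
      _ = 2 * K * ((n : ℝ) ^ (b - 1 / 2) * (n : ℝ) ^ (1 / 2 : ℝ)) := by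
          rw [Real.sqrt_eq_rpow]
          ring
      _ = 2 * K * ((n : ℝ) ^ (-(1 - b)) * (n : ℝ) ^ (1 : ℝ)) := by
          rw [← Real.rpow_add hn0, ← Real.rpow_add hn0]
          congr 2
          ring
      _ = 2 * K * (n : ℝ) ^ (-(1 - b)) * n := by
          rw [Real.rpow_one]
          ring
  have hlog := tendsto_logSolution_div_sub_log.const_mul ((c : ℂ) / (Real.binEntropy p : ℂ))
  have hall := (hlim.sub hdep).add hlog
  rw [mul_zero, sub_zero, add_zero] at hall
  refine hall.congr fun n => ?_
  simp only [hf]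
  push_cast
  ring

/-! ### Mellin continuation and assembly of the theorem -/

theorem fluctuation_congr {p : ℝ} {G H : ℂ → ℂ}
    (h : IsLattice p → ∀ k : ℤ, G (-1 + chi p k) = H (-1 + chi p k)) (x : ℝ) :
    fluctuation p G x = fluctuation p H x := by
  unfold fluctuation
  split_ifs with hl
  · simp_rw [h hl]
  · rfl

/-- On -2 < Re s < -1 both parts of the toll have convergent transforms. The reduced part remains
holomorphic up to -α, so a singularity at -1 can come only from the explicit logarithmic part. -/
theorem isMellinContinuation_patriciaToll {p c θ α β : ℝ} {a : ℕ → ℝ} {g : ℂ → ℂ} (hp0 : 0 < p)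
    (hp1 : p < 1) (ha : IsPoissonGF a g) (ha0 : a 0 = 0) (ha1 : a 1 = 0)
    (hg : Differentiable ℂ g) (hθ0 : 0 < θ) (hθ : θ < Real.pi / 2) (hα : α < 1)
    (hin : SectorBound θ α β fun z => g z - (c : ℂ) * z) :
    IsMellinContinuation (patriciaToll p g) (-α) fun s =>
      mellin (fun t : ℝ => reducedToll p c g t) s
        + (c : ℂ) / (Real.binEntropy p : ℂ) * logTollMellin p s := by
  have hM := fun s => mellin_reducedToll (s := s) hp0 hp1 ha ha0 ha1 hg hθ0 hθ hα hin
  have hopen : IsOpen {s : ℂ | -2 < s.re ∧ s.re < -α} :=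
    (isOpen_lt continuous_const Complex.continuous_re).inter
      (isOpen_lt Complex.continuous_re continuous_const)
  have hmel : ∀ s : ℂ, -2 < s.re → s.re < -1 → HasMellin (patriciaToll p g) s
      (mellin (fun t : ℝ => reducedToll p c g t) s
        + (c : ℂ) / (Real.binEntropy p : ℂ) * logTollMellin p s) := by
    intro s h2 h1
    have hL := hasMellin_logToll hp0 hp1 h2 h1
    have hLc := hasMellin_const_smul hL.1 ((c : ℂ) / (Real.binEntropy p : ℂ))
    have hadd := hasMellin_add (hM s h2 (by linarith)).1 hLc.1
    rw [hLc.2, hL.2] at hadd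
    have hfun : patriciaToll p g = fun t : ℝ => reducedToll p c g t
        + ((c : ℂ) / (Real.binEntropy p : ℂ)) • logToll p t :=
      funext fun t => patriciaToll_eq_reducedToll p c g t
    rw [hfun]
    exact hadd
  refine ⟨fun s hs => ?_, fun s hs => ?_, fun s h2 h1 => (hmel s h2 h1).1,
    fun s h2 h1 => (hmel s h2 h1).2.symm⟩
  · have han : AnalyticAt ℂ (mellin fun t : ℝ => reducedToll p c g t) s :=
      DifferentiableOn.analyticAt
        (fun z hz => (hM z hz.1 hz.2).2.differentiableWithinAt) (hopen.mem_nhds hs)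
    exact han.meromorphicAt.add
      ((MeromorphicAt.const _ s).mul (meromorphicAt_logTollMellin hp0 hp1 s))
  · exact ((hM s hs.1.1 hs.1.2).2.add ((differentiableAt_logTollMellin hp0 hp1 hs.1.1
      hs.2).const_mul _)).differentiableWithinAt

theorem theorem5 {Ω : Type*} [MeasurableSpace Ω] (P : Measure Ω) [IsProbabilityMeasure P]
    (p : ℝ) (hp0 : 0 < p) (hp1 : p < 1)
    (X Xs : ℕ → Ω → ℝ) (I : ℕ → Ω → ℕ) (T : ℕ → Ω → ℝ)
    (hX : IsPatriciaParameter P p X Xs I T)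
    (hT : ∀ n, Integrable (T n) P)
    (hT0 : ∫ ω, T 0 ω ∂P = 0) (hT1 : ∫ ω, T 1 ω ∂P = 0)
    (g : ℂ → ℂ) (hg : IsPoissonGF (fun n => ∫ ω, T n ω ∂P) g)
    (α β : ℝ) (hα : α < 1) :
    (∀ n, Integrable (X n) P) ∧
    -- first part
    (JSAdmissibleWith α β g →
      (∀ s : ℂ, -2 < s.re → s.re < -α → MellinConvergent (patriciaToll p g) s) ∧
      FluctuationSummable p (mellin (patriciaToll p g)) ∧
      Tendsto (fun n : ℕ => (((∫ ω, X n ω ∂P) / n : ℝ) : ℂ)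
          - (mellin (patriciaToll p g) (-1) / (Real.binEntropy p : ℂ)
            + fluctuation p (mellin (patriciaToll p g))
                ((latticeNum p : ℝ) * Real.logb (1 / p) n)))
        atTop (𝓝 0)) ∧
    -- second part
    (∀ (θ c : ℝ), 0 < θ → θ < Real.pi / 2 → JSAdmissible g →
      SectorBound θ α β (fun z => g z - (c : ℂ) * z) →
      ∃ (G : ℂ → ℂ) (d : ℂ),
        IsMellinContinuation (patriciaToll p g) (-α) G ∧
        Tendsto (fun s : ℂ => G s + (c : ℂ) / (s + 1)) (𝓝[≠] (-1)) (𝓝 d) ∧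
        FluctuationSummable p G ∧
        Tendsto (fun n : ℕ => (((∫ ω, X n ω ∂P) / n : ℝ) : ℂ)
            - (((c / Real.binEntropy p * Real.log n : ℝ) : ℂ)
              + d / (Real.binEntropy p : ℂ)
              + ((c * (p * Real.log p ^ 2 + (1 - p) * Real.log (1 - p) ^ 2)
                  / (2 * Real.binEntropy p ^ 2) : ℝ) : ℂ)
              + fluctuation p G ((latticeNum p : ℝ) * Real.logb (1 / p) n)))
          atTop (𝓝 0)) := by
  have hrec := hX.integral_eq_binomialMean hp0 hp1 hT hT0
  have hx0 := hX.integral_zero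
  have hx1 := hX.integral_one
  have hh0 : (Real.binEntropy p : ℂ) ≠ 0 := by
    exact_mod_cast (Real.binEntropy_pos hp0 hp1).ne'
  refine ⟨hX.integrable hp0 hp1 hT, fun hJS => ?_, fun θ c hθ0 hθ hJS hin => ?_⟩
  · have hJS' : JSAdmissible g := ⟨α, β, hJS⟩
    obtain ⟨hd, θ, hθ0, hθ, hin, -⟩ := hJS
    have hin' : SectorBound θ α β fun z => g z - ((0 : ℝ) : ℂ) * z := by
      simpa using hin
    have hred : (fun t : ℝ => reducedToll p 0 g t) = patriciaToll p g :=
      funext fun t => reducedToll_zero p g t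
    have hM := tendsto_mean_of_recurrence hp0 hp1 hrec hx0 hx1 hg hT0 hT1 hJS' hθ0 hθ hα hin'
    have hC := fun s => mellin_reducedToll (s := s) hp0 hp1 hg hT0 hT1 hd hθ0 hθ hα hin'
    rw [hred] at hM hC
    refine ⟨fun s h2 h1 => (hC s h2 h1).1, hM.1, ?_⟩
    simpa using hM.2
  · have hd : Differentiable ℂ g := by
      obtain ⟨-, -, hd, -⟩ := hJS
      exact hd
    have hM := tendsto_mean_of_recurrence hp0 hp1 hrec hx0 hx1 hg hT0 hT1 hJS hθ0 hθ hα hin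
    have hC := fun s => mellin_reducedToll (s := s) hp0 hp1 hg hT0 hT1 hd hθ0 hθ hα hin
    have hG : IsLattice p → ∀ k : ℤ, mellin (fun t : ℝ => reducedToll p c g t) (-1 + chi p k)
        + (c : ℂ) / (Real.binEntropy p : ℂ) * logTollMellin p (-1 + chi p k)
        = mellin (fun t : ℝ => reducedToll p c g t) (-1 + chi p k) := fun hl k => by
      rw [logTollMellin_chi hp0 hp1 hl, mul_zero, add_zero]
    -- The value d is the reduced transform at -1 plus c/h times the constant Laurent term of
    -- `logTollMellin`. The explicit term with 2h² in the asymptotics cancels exactly this second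
    -- summand divided by h.
    refine ⟨_, mellin (fun t : ℝ => reducedToll p c g t) (-1)
      + (c : ℂ) / (Real.binEntropy p : ℂ) *
        (-((p * Real.log p ^ 2 + (1 - p) * Real.log (1 - p) ^ 2 : ℝ) : ℂ) / 2),
      isMellinContinuation_patriciaToll hp0 hp1 hg hT0 hT1 hd hθ0 hθ hα hin, ?_, ?_, ?_⟩
    · have h1 : Tendsto (mellin fun t : ℝ => reducedToll p c g t) (𝓝[≠] (-1))
          (𝓝 (mellin (fun t : ℝ => reducedToll p c g t) (-1))) :=
        (hC (-1) (by norm_num) (by simpa using hα)).2.continuousAt.tendsto.mono_left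
          nhdsWithin_le_nhds
      refine (h1.add ((tendsto_logTollMellin hp0 hp1).const_mul
        ((c : ℂ) / (Real.binEntropy p : ℂ)))).congr fun s => ?_
      field_simp
      ring
    · intro hl
      simp_rw [hG hl]
      exact hM.1 hl
    · refine hM.2.congr fun n => ?_
      rw [fluctuation_congr (G := fun s => mellin (fun t : ℝ => reducedToll p c g t) s
        + (c : ℂ) / (Real.binEntropy p : ℂ) * logTollMellin p s) hG]
      push_cast
      field_simp
      ring
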